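/- Let $G$ be a finite, simple, undirected graph with $n$ vertices and $m$ edges, and let $s,t\in V(G)$ be distinct and non-adjacent. An $s,t$-separator is a set $S\subseteq V(G)\setminus\{s,t\}$ such that $s$ and $t$ lie in distinct connected components of $G-S$; it is minimal if no strict subset of it is an $s,t$-separator, and minimum if no $s,t$-separator has fewer vertices. Running times are counted in steps of a uniform-cost random access machine with addition and truncated subtraction, and graphs are given to it by adjacency lists. Let $T(n,m)\ge n+m$ be a function such that some algorithm finds a minimum $s,t$-separator, in every graph with $n$ vertices and $m$ edges and for all distinct non-adjacent vertices $s,t$ of it, in time at most $T(n,m)$. Then there is an algorithm that, given $G$, $s$, $t$ and an integer $k\ge 1$, lists the minimal $s,t$-separators of $G$ of cardinality at most $k$, each exactly once, with delay $O(n\cdot k\cdot 4^k\cdot T(n,m))$, where the constant in $O(\cdot)$ is absolute. Here the delay bounds the time until the first output has been completed, the time between any two consecutive outputs, and the time from the last output until the algorithm halts. -/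

import Mathlib

/-! ### Separators of a graph -/

/-- `S` is an `s,t`-separator of `G`: neither `s` nor `t` is removed, and they lie in distinct
connected components of the graph that is left when the vertices of `S` are removed. -/
def IsSeparator {n : ℕ} (G : SimpleGraph (Fin n)) (s t : Fin n) (S : Finset (Fin n)) : Prop :=
  ∃ (hs : s ∉ S) (ht : t ∉ S),
    (G.induce {v | v ∉ S}).connectedComponentMk ⟨s, hs⟩ ≠
      (G.induce {v | v ∉ S}).connectedComponentMk ⟨t, ht⟩

/-- An `s,t`-separator none of whose strict subsets is an `s,t`-separator. -/
def IsMinimalSeparator {n : ℕ} (G : SimpleGraph (Fin n)) (s t : Fin n)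
    (S : Finset (Fin n)) : Prop :=
  IsSeparator G s t S ∧ ∀ S' : Finset (Fin n), S' ⊂ S → ¬ IsSeparator G s t S'

/-- An `s,t`-separator of least cardinality. -/
def IsMinimumSeparator {n : ℕ} (G : SimpleGraph (Fin n)) (s t : Fin n)
    (S : Finset (Fin n)) : Prop :=
  IsSeparator G s t S ∧ ∀ S' : Finset (Fin n), IsSeparator G s t S' → S.card ≤ S'.card

/-! ### The machine model

Structured programs for a uniform-cost random access machine.  The memory consists of scalar
registers and of unbounded arrays, all holding natural numbers; a program names finitely many of
them.  The arithmetic is addition and truncated subtraction, and every elementary operation costs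
one step. -/

/-- Expressions: constants, registers, array entries (indirect addressing), sum, difference. -/
inductive RamExpr : Type
  | lit (c : ℕ) : RamExpr
  | reg (x : ℕ) : RamExpr
  | get (a : ℕ) (i : RamExpr) : RamExpr
  | plus (e₁ e₂ : RamExpr) : RamExpr
  | minus (e₁ e₂ : RamExpr) : RamExpr

/-- Programs.  `emit e` writes the value of `e` to the output, `flush` ends an output item, and the
guard of `cond` and `loop` counts as true if its value is not zero. -/
inductive RamProg : Type
  | skip : RamProg
  | assign (x : ℕ) (e : RamExpr) : RamProg
  | store (a : ℕ) (i e : RamExpr) : RamProg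
  | emit (e : RamExpr) : RamProg
  | flush : RamProg
  | seq (p q : RamProg) : RamProg
  | cond (e : RamExpr) (p q : RamProg) : RamProg
  | loop (e : RamExpr) (p : RamProg) : RamProg

/-- Memory contents: register `x` holds `regs x`, entry `i` of array `a` is `arrs a i`. -/
structure RamState : Type where
  regs : ℕ → ℕ
  arrs : ℕ → ℕ → ℕ

/-- The value of an expression. -/
def RamExpr.eval (σ : RamState) : RamExpr → ℕ
  | .lit c => c
  | .reg x => σ.regs x
  | .get a i => σ.arrs a (i.eval σ)
  | .plus e₁ e₂ => e₁.eval σ + e₂.eval σ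
  | .minus e₁ e₂ => e₁.eval σ - e₂.eval σ

/-- The number of steps that the evaluation of an expression takes. -/
def RamExpr.cost : RamExpr → ℕ
  | .lit _ => 1
  | .reg _ => 1
  | .get _ i => i.cost + 1
  | .plus e₁ e₂ => e₁.cost + e₂.cost + 1
  | .minus e₁ e₂ => e₁.cost + e₂.cost + 1

/-- One step of a computation: an internal step, a step that writes a number to the output, or a
step that ends an output item. -/
inductive RamEvent : Type
  | tick : RamEvent
  | emit (v : ℕ) : RamEvent
  | flush : RamEvent

/-- `r` internal steps. -/
def ticks (r : ℕ) : List RamEvent := List.replicate r RamEvent.tick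

/-- `Exec p σ tr σ'`: started in `σ`, the program `p` halts in `σ'` after performing exactly the
steps `tr`, so that `tr.length` is its running time. -/
inductive Exec : RamProg → RamState → List RamEvent → RamState → Prop
  | skip (σ : RamState) : Exec .skip σ (ticks 1) σ
  | assign (x : ℕ) (e : RamExpr) (σ : RamState) :
      Exec (.assign x e) σ (ticks (e.cost + 1))
        ⟨Function.update σ.regs x (e.eval σ), σ.arrs⟩
  | store (a : ℕ) (i e : RamExpr) (σ : RamState) :
      Exec (.store a i e) σ (ticks (i.cost + e.cost + 1))
        ⟨σ.regs, Function.update σ.arrs a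
          (Function.update (σ.arrs a) (i.eval σ) (e.eval σ))⟩
  | emit (e : RamExpr) (σ : RamState) :
      Exec (.emit e) σ (ticks e.cost ++ [RamEvent.emit (e.eval σ)]) σ
  | flush (σ : RamState) : Exec .flush σ [RamEvent.flush] σ
  | seq {p q : RamProg} {σ₁ σ₂ σ₃ : RamState} {tr₁ tr₂ : List RamEvent} :
      Exec p σ₁ tr₁ σ₂ → Exec q σ₂ tr₂ σ₃ → Exec (.seq p q) σ₁ (tr₁ ++ tr₂) σ₃
  | cond_true {e : RamExpr} {p : RamProg} (q : RamProg) {σ σ' : RamState}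
      {tr : List RamEvent} :
      e.eval σ ≠ 0 → Exec p σ tr σ' → Exec (.cond e p q) σ (ticks e.cost ++ tr) σ'
  | cond_false {e : RamExpr} (p : RamProg) {q : RamProg} {σ σ' : RamState}
      {tr : List RamEvent} :
      e.eval σ = 0 → Exec q σ tr σ' → Exec (.cond e p q) σ (ticks e.cost ++ tr) σ'
  | loop_true {e : RamExpr} {p : RamProg} {σ₁ σ₂ σ₃ : RamState} {tr₁ tr₂ : List RamEvent} :
      e.eval σ₁ ≠ 0 → Exec p σ₁ tr₁ σ₂ → Exec (.loop e p) σ₂ tr₂ σ₃ →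
      Exec (.loop e p) σ₁ (ticks e.cost ++ tr₁ ++ tr₂) σ₃
  | loop_false {e : RamExpr} (p : RamProg) {σ : RamState} :
      e.eval σ = 0 → Exec (.loop e p) σ (ticks e.cost) σ

/-! ### Input and output -/

/-- `nbrs` is a system of adjacency lists of `G`; the lists may be in any order. -/
def IsAdjacencyLists {n : ℕ} (G : SimpleGraph (Fin n)) (nbrs : Fin n → List (Fin n)) : Prop :=
  ∀ v, (nbrs v).Nodup ∧ ∀ w, w ∈ nbrs v ↔ G.Adj v w

/-- The initial memory for a graph given by adjacency lists.  Register `0` holds `n`, and the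
registers after it hold the parameters.  Array `1` holds the concatenation of the adjacency lists
of the vertices `0, …, n - 1`, and entry `v` of array `0` (for `v ≤ n`) is the position where the
list of `v` starts, so that entry `n` is the total length.  Everything else is `0`. -/
def graphInput {n : ℕ} (nbrs : Fin n → List (Fin n)) (params : List ℕ) : RamState where
  regs x := (n :: params).getD x 0
  arrs a i :=
    if a = 0 then
      if i ≤ n then ∑ v : Fin n, if v.val < i then (nbrs v).length else 0 else 0
    else if a = 1 then (((List.finRange n).flatMap nbrs).map Fin.val).getD i 0
    else 0

/-- The numbers written to the output in the course of the given steps. -/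
def emitted (tr : List RamEvent) : List ℕ :=
  tr.filterMap fun
    | RamEvent.emit v => some v
    | _ => none

/-- The steps, cut at the ends of the output items: `N` items give `N + 1` blocks, the last of
which is what happens after the last item. -/
def blocks (tr : List RamEvent) : List (List RamEvent) :=
  tr.splitOnP fun
    | RamEvent.flush => true
    | _ => false

/-- The word `w` lists the elements of `S`, each exactly once. -/
def Spells {n : ℕ} (w : List ℕ) (S : Finset (Fin n)) : Prop :=
  ∃ l : List (Fin n), l.Nodup ∧ l.toFinset = S ∧ w = l.map Fin.val

/-- `P` finds a minimum `s,t`-separator in at most `T n m` steps, for every graph with `n` vertices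
and `m` edges and all distinct non-adjacent vertices `s`, `t` of it. -/
def FindsMinimumSeparatorInTime (P : RamProg) (T : ℕ → ℕ → ℕ) : Prop :=
  ∀ (n : ℕ) (G : SimpleGraph (Fin n)) (nbrs : Fin n → List (Fin n)) (s t : Fin n),
    IsAdjacencyLists G nbrs → s ≠ t → ¬ G.Adj s t →
      ∃ (tr : List RamEvent) (σ : RamState) (S : Finset (Fin n)),
        Exec P (graphInput nbrs [s.val, t.val]) tr σ ∧
        tr.length ≤ T n G.edgeSet.ncard ∧
        IsMinimumSeparator G s t S ∧ Spells (emitted tr) S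

/-- Started in `σ`, the program `Q` outputs the members of the family `F`, each exactly once and
nothing else, and halts; the number of steps up to and including the end of the first item, between
the ends of any two consecutive items, and from the end of the last item until the machine has
halted is at most `D` each. -/
def ListsWithDelay {n : ℕ} (Q : RamProg) (σ : RamState) (F : Set (Finset (Fin n)))
    (D : ℕ) : Prop :=
  ∃ (tr : List RamEvent) (σ' : RamState) (words : List (List ℕ)) (L : List (Finset (Fin n))),
    Exec Q σ tr σ' ∧
    (blocks tr).map emitted = words ++ [[]] ∧
    List.Forall₂ Spells words L ∧
    L.Nodup ∧ (∀ S, S ∈ L ↔ S ∈ F) ∧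
    ∀ b ∈ blocks tr, b.length + 1 ≤ D

/-!
Minimal separators are enumerated by closure under a local step, and the step is carried out by
bounded branching on minimum vertex cuts.

*Closure.* Write `A` for the component of `s` in `G - S`. A minimal separator `S` is called closest
to a vertex set `X ⊆ A` if no proper subset of `A` that contains `X` has a boundary of size at most
`|S|`. A list that contains the separators of size at most `k` closest to `{s}`, and with each `S`
those closest to `A ∪ {v}` for `v ∈ S`, contains all minimal separators of size at most `k`
(`mem_of_closed`): a given `S'` is either closest to `{s}`, or it is closest to `A ∪ {v}` for any
member `S` of maximal side `A` properly inside the side of `S'`, and any `v ∈ S` outside `S'`.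
The members of the list are output one after the other, and before the next output the step is
applied to the present one. Whatever it adds is appended to the list, so that the list is complete
when all its members have been output.

*Branching.* To find the separators closest to `X`, every vertex carries a status: source (member of
`X`), sink (neither in `S` nor in `A`), chosen (member of `S`), or free. Let `lam` be the size of a
minimum cut of free vertices between sources and sinks, and let `b` be `k` minus the number of
chosen vertices. If `lam > b` nothing can be found (`Target.false_of_lb`), and if `lam = 0` the
chosen vertices are the only candidate (`Target.eq_chosen`). Otherwise take a vertex `v` of the
minimum cut closest to the sources. By submodularity `A` lies on the source side of that cut, so
that `v` is chosen or a sink (`Target.branch`). In the first case `b` drops by one and `lam` by at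
most one; in the second `lam` grows, because the cut was the closest one (`lb_update_sink`). Hence
`2 * b - lam` drops in both cases, and one start of the branching leads to fewer than `4 ^ (k + 1)`
items (`Weight.branch`).

*Minimum cuts.* Systems of disjoint paths from sources to sinks are encoded as matchings between
two copies of the vertex set: a free vertex that is on no path is matched with itself, an edge
`u → w` of a path matches the right copy of `w` with the left copy of `u`, and the number of paths
is the number of right copies matched with sources. Augmentation is the exchange along an
alternating path, and a failed search for one exhibits the minimum cut closest to the sources
(`MateGood.weak_duality`, `Searched.card_cut`, `Searched.reached_subset`).

*Time.* Since only cuts of size at most `k` matter, one item costs at most `k + 2` searches in time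
`O(n + m)` each, and at most `n` starts of the branching happen between two outputs. This gives the
delay `O(n * k * 4 ^ k * (n + m))`, and `n + m ≤ T n m`. Repetitions are recognized in `O(n)` steps
by a table indexed by `∑ v ∈ S, 2 ^ v`; in the uniform-cost model numbers of this size, and
unbounded arrays, are available.

The combinatorial part is about relations on the natural numbers below `n`, as these are what the
machine works with.
-/

/-! ### Minimal separators and their sides -/

open scoped Classical in
/-- The (outer) vertex boundary of `D`. -/
noncomputable def nb (n : ℕ) (E : ℕ → ℕ → Prop) (D : Finset ℕ) : Finset ℕ :=
  (Finset.range n).filter fun w => w ∉ D ∧ ∃ u ∈ D, E u w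

open scoped Classical in
/-- The vertices that can be reached from `r` without entering `S`. -/
noncomputable def reach (n : ℕ) (E : ℕ → ℕ → Prop) (S : Finset ℕ) (r : ℕ) : Finset ℕ :=
  (Finset.range n).filter fun v => Relation.ReflTransGen (fun u w => E u w ∧ w ∉ S) r v

/-- `E` is the adjacency relation of an undirected graph on the vertices below `n`. -/
structure IsGraphOn (n : ℕ) (E : ℕ → ℕ → Prop) : Prop where
  symm : ∀ {u w}, E u w → E w u
  right_lt : ∀ {u w}, E u w → w < n

/-- A minimal `s,t`-separator `S`: it separates, and each of its vertices has neighbours in both the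
component of `s` and that of `t`, which is equivalent to minimality. -/
structure MinSep (n : ℕ) (E : ℕ → ℕ → Prop) (s t : ℕ) (S : Finset ℕ) : Prop where
  left_not_mem : s ∉ S
  right_not_mem : t ∉ S
  separates : t ∉ reach n E S s
  full_left : S ⊆ nb n E (reach n E S s)
  full_right : S ⊆ nb n E (reach n E S t)

section

variable {n : ℕ} {E : ℕ → ℕ → Prop} {S Z D : Finset ℕ} {r s t u v w : ℕ}

theorem mem_nb : w ∈ nb n E D ↔ w < n ∧ w ∉ D ∧ ∃ u ∈ D, E u w := by
  simp [nb]

theorem mem_reach : v ∈ reach n E S r ↔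
    v < n ∧ Relation.ReflTransGen (fun u w => E u w ∧ w ∉ S) r v := by
  simp [reach]

theorem self_mem_reach (hr : r < n) : r ∈ reach n E S r :=
  mem_reach.2 ⟨hr, .refl⟩

theorem reach_step (hE : IsGraphOn n E) (hu : u ∈ reach n E S r) (h : E u w) (hw : w ∉ S) :
    w ∈ reach n E S r :=
  mem_reach.2 ⟨hE.right_lt h, (mem_reach.1 hu).2.tail ⟨h, hw⟩⟩

/-- `reach` is the least set that contains `r` and is closed under steps that avoid `S`. -/
theorem reach_subset (hr : r ∈ D) (h : ∀ u ∈ D, ∀ w, E u w → w ∉ S → w ∈ D) :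
    reach n E S r ⊆ D := by
  intro v hv
  replace hv := (mem_reach.1 hv).2
  induction hv with
  | refl => exact hr
  | tail _ h2 ih => exact h _ ih _ h2.1 h2.2

theorem reach_induction {P : ℕ → Prop} (hr : P r)
    (h : ∀ u ∈ reach n E S r, P u → ∀ w, w < n → E u w → w ∉ S → P w) (hE : IsGraphOn n E)
    (hrn : r < n) : ∀ v ∈ reach n E S r, P v := by
  intro v hv
  replace hv := (mem_reach.1 hv).2
  have : v ∈ reach n E S r ∧ P v := by
    induction hv with
    | refl => exact ⟨self_mem_reach hrn, hr⟩
    | tail _ h2 ih =>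
      exact ⟨reach_step hE ih.1 h2.1 h2.2, h _ ih.1 ih.2 _ (hE.right_lt h2.1) h2.1 h2.2⟩
  exact this.2

theorem not_mem_of_mem_reach (hr : r ∉ S) (h : v ∈ reach n E S r) : v ∉ S := by
  obtain ⟨-, h⟩ := mem_reach.1 h
  cases h with
  | refl => exact hr
  | tail _ h2 => exact h2.2

theorem reach_subset_of_nb_subset (hE : IsGraphOn n E) (hr : r ∈ D) (h : nb n E D ⊆ S) :
    reach n E S r ⊆ D := by
  refine reach_subset hr fun u hu w huw hw => ?_
  by_contra hwD
  exact hw (h (mem_nb.2 ⟨hE.right_lt huw, hwD, u, hu, huw⟩))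

theorem nb_reach_subset (hE : IsGraphOn n E) : nb n E (reach n E S r) ⊆ S := by
  intro w hw
  obtain ⟨-, h2, u, hu, huw⟩ := mem_nb.1 hw
  by_contra hS
  exact h2 (reach_step hE hu huw hS)

theorem reach_anti (h : S ⊆ Z) : reach n E Z r ⊆ reach n E S r := by
  intro v hv
  obtain ⟨h1, h2⟩ := mem_reach.1 hv
  exact mem_reach.2
    ⟨h1, Relation.ReflTransGen.mono (fun a b hab => ⟨hab.1, fun hb => hab.2 (h hb)⟩) _ _ h2⟩

/-- Connectedness within the complement of `S` is symmetric. -/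
theorem mem_reach_comm (hE : IsGraphOn n E) (hsS : s ∉ S)
    (h : t ∈ reach n E S s) : s ∈ reach n E S t := by
  have key : ∀ v ∈ reach n E S s, ∀ x ∈ reach n E S s, E v x → x ∈ reach n E S t →
      v ∈ reach n E S t := fun v hv x _ hvx hx =>
    reach_step hE hx (hE.symm hvx) (not_mem_of_mem_reach hsS hv)
  obtain ⟨ht, h⟩ := mem_reach.1 h
  have : ∀ v, Relation.ReflTransGen (fun u w => E u w ∧ w ∉ S) s v → v < n →
      v ∈ reach n E S t → s ∈ reach n E S t := by
    intro v hv
    induction hv with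
    | refl => exact fun _ h => h
    | @tail b c h1 h2 ih =>
      intro hc hct
      have hb : b < n := hE.right_lt (hE.symm h2.1)
      exact ih hb (key b (mem_reach.2 ⟨hb, h1⟩) c
        (mem_reach.2 ⟨hc, h1.tail h2⟩) h2.1 hct)
  exact this t h ht (self_mem_reach ht)

theorem MinSep.nb_left (hE : IsGraphOn n E) (h : MinSep n E s t S) :
    nb n E (reach n E S s) = S :=
  (nb_reach_subset hE).antisymm h.full_left

theorem MinSep.nb_right (hE : IsGraphOn n E) (h : MinSep n E s t S) :
    nb n E (reach n E S t) = S :=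
  (nb_reach_subset hE).antisymm h.full_right

theorem MinSep.subset_range (h : MinSep n E s t S) : S ⊆ Finset.range n := fun _ hv =>
  Finset.mem_range.2 (mem_nb.1 (h.full_left hv)).1

/-- Passing to the boundary of the component of `t`, and then to the boundary of the component
of `s`, turns any separator into a minimal one. -/
theorem minSep_shrink (hE : IsGraphOn n E) (hs : s < n) (ht : t < n) (hsZ : s ∉ Z) (htZ : t ∉ Z)
    (hst : t ∉ reach n E Z s) :
    MinSep n E s t (nb n E (reach n E (nb n E (reach n E Z t)) s)) ∧
      nb n E (reach n E (nb n E (reach n E Z t)) s) ⊆ Z ∧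
      reach n E (nb n E (reach n E (nb n E (reach n E Z t)) s)) s =
        reach n E (nb n E (reach n E Z t)) s ∧
      ∀ v ∈ reach n E (nb n E (reach n E Z t)) s,
        v ∉ reach n E Z t ∧ v ∉ nb n E (reach n E Z t) := by
  set B := reach n E Z t with hB
  set Z1 := nb n E B with hZ1
  set A := reach n E Z1 s with hA
  set Z2 := nb n E A with hZ2
  have h1 : Z1 ⊆ Z := nb_reach_subset hE
  have h2 : Z2 ⊆ Z1 := nb_reach_subset hE
  have hsB : s ∉ B := fun h => hst (mem_reach_comm hE htZ h)
  have hAB : ∀ v ∈ A, v ∉ B ∧ v ∉ Z1 := by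
    refine reach_induction ⟨hsB, fun h => hsZ (h1 h)⟩ ?_ hE hs
    intro u _ hu w hw huw hwZ
    refine ⟨fun hwB => hu.2 (mem_nb.2 ⟨hE.right_lt (hE.symm huw), hu.1, w, hwB, hE.symm huw⟩), hwZ⟩
  have hAA : reach n E Z2 s = A :=
    (reach_subset_of_nb_subset hE (self_mem_reach hs) le_rfl).antisymm (reach_anti h2)
  have htB : t ∈ B := self_mem_reach ht
  have hZ2t : t ∉ Z2 := fun h => htZ (h1 (h2 h))
  refine ⟨⟨fun h => hsZ (h1 (h2 h)), hZ2t, ?_, ?_, ?_⟩, h2.trans h1, hAA, hAB⟩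
  · rw [hAA]
    exact fun h => (hAB t h).1 htB
  · rw [hAA]
  · intro z hz
    obtain ⟨hzn, -, u, hu, huz⟩ := mem_nb.1 (h2 hz)
    exact mem_nb.2 ⟨hzn, fun h => not_mem_of_mem_reach hZ2t h hz, u,
      reach_anti (h2.trans h1) hu, huz⟩

/-- A minimal separator whose `s`-side `A` has a proper subset `D` with a boundary that is not
larger can be replaced by a minimal separator that is not larger and whose `s`-side lies properly
inside `A`; it still contains the part of `D` that hangs together with `s`. -/
theorem MinSep.descend (hE : IsGraphOn n E) (hs : s < n) (ht : t < n) (h : MinSep n E s t S)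
    (hD : D ⊆ reach n E S s) (hne : D ≠ reach n E S s) (hsD : s ∈ D)
    (hcard : (nb n E D).card ≤ S.card) :
    ∃ S', MinSep n E s t S' ∧ S'.card ≤ S.card ∧ reach n E S' s ⊂ reach n E S s ∧
      reach n E (nb n E D) s ⊆ reach n E S' s := by
  have hZ : ∀ w ∈ nb n E D, w ∈ reach n E S s ∨ w ∈ S := by
    intro w hw
    obtain ⟨-, -, u, hu, huw⟩ := mem_nb.1 hw
    by_cases hwS : w ∈ S
    · exact .inr hwS
    · exact .inl (reach_step hE (hD hu) huw hwS)
  have hsZ : s ∉ nb n E D := fun h => (mem_nb.1 h).2.1 hsD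
  have htZ : t ∉ nb n E D := fun h' => (hZ t h').elim h.separates h.right_not_mem
  have hst : t ∉ reach n E (nb n E D) s := fun h' =>
    h.separates (hD (reach_subset_of_nb_subset hE hsD le_rfl h'))
  obtain ⟨hm, hsub, hre, hdis⟩ := minSep_shrink hE hs ht hsZ htZ hst
  set B := reach n E (nb n E D) t with hB
  set Z1 := nb n E B with hZ1
  set A := reach n E Z1 s with hA
  set Z2 := nb n E A with hZ2
  -- the component of `t` only grows
  have hBB : ∀ v ∈ reach n E S t, v ∈ B := by
    refine reach_induction (self_mem_reach ht) ?_ hE ht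
    intro u hu huB w hw huw hwS
    have hwt : w ∈ reach n E S t := reach_step hE hu huw hwS
    refine reach_step hE huB huw fun hwZ => (hZ w hwZ).elim (fun hws => ?_) hwS
    have h3 : t ∈ reach n E S w := mem_reach_comm hE h.right_not_mem hwt
    exact h.separates (mem_reach.2 ⟨ht, (mem_reach.1 hws).2.trans (mem_reach.1 h3).2⟩)
  have hSB : ∀ z ∈ S, z ∈ B ∨ z ∈ Z1 := by
    intro z hz
    obtain ⟨hzn, -, u, hu, huz⟩ := mem_nb.1 (h.full_right hz)
    by_cases hzB : z ∈ B
    · exact .inl hzB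
    · exact .inr (mem_nb.2 ⟨hzn, hzB, u, hBB u hu, huz⟩)
  have hAsub : A ⊆ reach n E S s := by
    refine reach_induction (self_mem_reach hs) ?_ hE hs
    intro u hu huA w hw huw hwZ
    refine reach_step hE huA huw fun hwS => ?_
    have := hdis w (reach_step hE hu huw hwZ)
    exact (hSB w hwS).elim this.1 this.2
  refine ⟨Z2, hm, (Finset.card_le_card hsub).trans hcard, ?_, reach_anti hsub⟩
  rw [hre]
  refine Finset.ssubset_iff_subset_ne.2 ⟨hAsub, fun heq => hne ?_⟩
  have h1 : Z2 = S := by rw [hZ2, heq, h.nb_left hE]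
  have h2 : nb n E D = S := (Finset.eq_of_subset_of_card_le (h1 ▸ hsub) hcard).symm
  exact hD.antisymm (h2 ▸ reach_subset_of_nb_subset hE hsD le_rfl)

/-- `S` is closest to the source set `X`: every set between `X` and the `s`-side of `S` whose
boundary is not larger than `S` is the whole `s`-side. -/
def Closest (n : ℕ) (E : ℕ → ℕ → Prop) (s : ℕ) (X S : Finset ℕ) : Prop :=
  X ⊆ reach n E S s ∧
    ∀ D ⊆ reach n E S s, X ⊆ D → (nb n E D).card ≤ S.card → D = reach n E S s

/-- A family of minimal separators that contains those closest to `s` and is closed under passing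
from `S` to the separators closest to the `s`-side of `S` enlarged by one vertex of `S`, contains
all minimal separators of size at most `k`. -/
theorem mem_of_closed (hE : IsGraphOn n E) (hs : s < n) (ht : t < n) {k : ℕ}
    {F : Finset ℕ → Prop}
    (hseed : ∀ S, MinSep n E s t S → S.card ≤ k → Closest n E s {s} S → F S)
    (hstep : ∀ S, F S → MinSep n E s t S → ∀ v ∈ S, ∀ S', MinSep n E s t S' → S'.card ≤ k →
      Closest n E s (insert v (reach n E S s)) S' → F S') :
    ∀ S, MinSep n E s t S → S.card ≤ k → F S := by
  classical
  intro S
  induction hc : (reach n E S s).card using Nat.strong_induction_on generalizing S with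
  | _ N ih =>
  intro hS hk
  set cand := (Finset.range n).powerset.filter fun S'' =>
    MinSep n E s t S'' ∧ S''.card ≤ k ∧ reach n E S'' s ⊂ reach n E S s with hcand
  rcases cand.eq_empty_or_nonempty with h0 | hne
  · refine hseed S hS hk ⟨by simpa using self_mem_reach hs, fun D hD hX hcard => ?_⟩
    by_contra hDne
    obtain ⟨S', h1, h2, h3, -⟩ := hS.descend hE hs ht hD hDne (by simpa using hX) hcard
    have : S' ∈ cand := by
      simp only [hcand, Finset.mem_filter, Finset.mem_powerset]
      exact ⟨h1.subset_range, h1, h2.trans hk, h3⟩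
    simp [h0] at this
  · obtain ⟨S2, hS2, hmax⟩ := cand.exists_max_image (fun S'' => (reach n E S'' s).card) hne
    simp only [hcand, Finset.mem_filter, Finset.mem_powerset] at hS2 hmax
    obtain ⟨-, hm2, hk2, hlt⟩ := hS2
    have hF2 : F S2 := ih _ (hc ▸ Finset.card_lt_card hlt) S2 rfl hm2 hk2
    have hex : ∃ v ∈ S2, v ∉ S := by
      by_contra hcon
      push Not at hcon
      exact hlt.2 (reach_subset_of_nb_subset hE (self_mem_reach hs)
        (by rw [hm2.nb_left hE]; exact hcon))
    obtain ⟨v, hv2, hvS⟩ := hex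
    obtain ⟨-, hvn, u, hu, huv⟩ := mem_nb.1 (hm2.full_left hv2)
    refine hstep S2 hF2 hm2 v hv2 S hS hk ⟨?_, fun D hD hX hcard => ?_⟩
    · exact Finset.insert_subset (reach_step hE (hlt.1 hu) huv hvS) hlt.1
    · by_contra hDne
      have hsub : reach n E S2 s ⊆ D := (Finset.subset_insert _ _).trans hX
      obtain ⟨S', h1, h2, h3, h4⟩ := hS.descend hE hs ht hD hDne
        (hsub (self_mem_reach hs)) hcard
      have hin : ∀ x ∈ reach n E S2 s, x ∈ reach n E (nb n E D) s := by
        refine reach_induction (self_mem_reach hs) ?_ hE hs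
        intro a ha haD b _ hab hb
        exact reach_step hE haD hab fun hbD =>
          (mem_nb.1 hbD).2.1 (hsub (reach_step hE ha hab hb))
      have hv' : v ∈ reach n E (nb n E D) s :=
        reach_step hE (hin u hu) huv fun hbD =>
          (mem_nb.1 hbD).2.1 (hX (Finset.mem_insert_self _ _))
      have hlt' : reach n E S2 s ⊂ reach n E S' s :=
        ⟨fun x hx => h4 (hin x hx), fun hcon => hvn (hcon (h4 hv'))⟩
      have := hmax S' ⟨h1.subset_range, h1, h2.trans hk, h3⟩
      exact absurd (Finset.card_lt_card hlt') (by omega)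

/-! ### Vertex cuts and matchings -/

/-- The statuses of the vertices are encoded by a function `c` with the values `0` (free),
`1` (source), `2` (sink) and `3` (chosen). A vertex set `D` is valid for `c` if it contains the
sources, consists of sources and free vertices, and has no edge to a sink. -/
structure Valid (n : ℕ) (E : ℕ → ℕ → Prop) (c : ℕ → ℕ) (D : Finset ℕ) : Prop where
  lt : ∀ v ∈ D, v < n
  status : ∀ v ∈ D, c v = 0 ∨ c v = 1
  source : ∀ v < n, c v = 1 → v ∈ D
  sink : ∀ u ∈ D, ∀ w, E u w → c w ≠ 2

/-- The free vertices in the boundary of `D`. -/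
noncomputable def cut (n : ℕ) (E : ℕ → ℕ → Prop) (c : ℕ → ℕ) (D : Finset ℕ) : Finset ℕ :=
  (nb n E D).filter fun w => c w = 0

/-- The vertices of status `3`, which have been chosen for the separator. -/
def chosen (n : ℕ) (c : ℕ → ℕ) : Finset ℕ := (Finset.range n).filter fun w => c w = 3

/-- Every valid set has at least `lam` free vertices in its boundary. -/
def LB (n : ℕ) (E : ℕ → ℕ → Prop) (c : ℕ → ℕ) (lam : ℕ) : Prop :=
  ∀ D, Valid n E c D → lam ≤ (cut n E c D).card

/-- `mate` assigns to each free vertex `w` itself or a neighbour, which is free or a source: the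
partner of the right copy of `w` is the left copy of `mate w`. -/
def MateTyped (n : ℕ) (E : ℕ → ℕ → Prop) (c mate : ℕ → ℕ) : Prop :=
  ∀ w < n, c w = 0 → mate w < n ∧ (mate w = w ∨ E (mate w) w) ∧ (c (mate w) = 0 ∨ c (mate w) = 1)

/-- `mate` is a matching that encodes `lam` disjoint paths from sources to sinks: left copies of
free vertices are used at most once, those not used see a sink, and `lam` right copies are matched
with sources. -/
structure MateGood (n : ℕ) (E : ℕ → ℕ → Prop) (c mate : ℕ → ℕ) (lam : ℕ) : Prop where
  typed : MateTyped n E c mate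
  inj : ∀ w < n, ∀ w' < n, c w = 0 → c w' = 0 → mate w = mate w' → c (mate w) = 0 → w = w'
  surj : ∀ u < n, c u = 0 → (∀ y, E u y → c y ≠ 2) → ∃ w < n, c w = 0 ∧ mate w = u
  card : ((Finset.range n).filter fun w => c w = 0 ∧ c (mate w) = 1).card = lam

/-- The outcome of a search for alternating paths from the sources: `lm` marks the left copies that
were reached and tells the right copy they were reached from, `par` does so for the right copies,
`pos` is the order of discovery, and `found` tells a reached left copy that sees a sink. All marks
are shifted by one, `0` standing for "not reached". -/
structure Searched (n : ℕ) (E : ℕ → ℕ → Prop) (c mate par lm : ℕ → ℕ) (found : ℕ)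
    (pos : ℕ → ℕ) : Prop where
  source : ∀ x < n, c x = 1 → lm x ≠ 0
  left : ∀ u < n, lm u ≠ 0 → c u = 0 ∨ c u = 1
  expand : ∀ u < n, lm u ≠ 0 → ∀ w < n, w = u ∨ E u w → par w ≠ 0
  back : ∀ w < n, par w ≠ 0 → c w = 0 → lm (mate w) ≠ 0
  sink : found = 0 → ∀ w < n, par w ≠ 0 → c w ≠ 2
  found_spec : found ≠ 0 → found - 1 < n ∧ lm (found - 1) ≠ 0 ∧ ∃ y, E (found - 1) y ∧ c y = 2
  par_spec : ∀ w < n, par w ≠ 0 → par w - 1 < n ∧ lm (par w - 1) ≠ 0 ∧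
    (w = par w - 1 ∨ E (par w - 1) w)
  lm_spec : ∀ u < n, lm u ≠ 0 → c u = 0 → lm u - 1 < n ∧ c (lm u - 1) = 0 ∧
    mate (lm u - 1) = u ∧ par (lm u - 1) ≠ 0 ∧ pos (par (lm u - 1) - 1) < pos u
  pos_lt : ∀ u < n, lm u ≠ 0 → pos u < n

theorem mem_cut {c : ℕ → ℕ} : w ∈ cut n E c D ↔ (w < n ∧ w ∉ D ∧ ∃ u ∈ D, E u w) ∧ c w = 0 := by
  simp [cut, mem_nb]

theorem mem_chosen {c : ℕ → ℕ} : w ∈ chosen n c ↔ w < n ∧ c w = 3 := by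
  simp [chosen]

theorem Valid.nb_status {c : ℕ → ℕ} (hc : ∀ v < n, c v ≤ 3) (h : Valid n E c D)
    (hw : w ∈ nb n E D) : c w = 0 ∨ c w = 3 := by
  obtain ⟨h1, h2, u, hu, huw⟩ := mem_nb.1 hw
  have := hc w h1
  have h3 := h.sink u hu w huw
  have h4 := mt (h.source w h1) h2
  omega

/-- Submodularity of the boundary size. -/
theorem card_nb_inter_add_card_nb_union (A B : Finset ℕ) :
    (nb n E (A ∩ B)).card + (nb n E (A ∪ B)).card ≤ (nb n E A).card + (nb n E B).card := by
  rw [← Finset.card_union_add_card_inter (nb n E A), ← Finset.card_union_add_card_inter]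
  refine Nat.add_le_add (Finset.card_le_card ?_) (Finset.card_le_card ?_)
  all_goals
    intro w
    simp only [Finset.mem_union, Finset.mem_inter, mem_nb]
    grind

open scoped Classical in
theorem Valid.card_free {c : ℕ → ℕ} (hD : Valid n E c D) :
    ((Finset.range n).filter fun w => c w = 0 ∧ (w ∈ D ∨ w ∈ cut n E c D)).card =
      (D.filter fun w => c w = 0).card + (cut n E c D).card := by
  rw [← Finset.card_union_of_disjoint]
  · congr 1
    ext w
    simp only [Finset.mem_filter, Finset.mem_range, Finset.mem_union, mem_cut]
    have := hD.lt w
    tauto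
  · rw [Finset.disjoint_left]
    intro w hw hw'
    exact (mem_cut.1 hw').1.2.1 (Finset.mem_filter.1 hw).1

/-- The count behind weak duality and its equality case. -/
theorem MateGood.weak_duality {c mate : ℕ → ℕ} {lam : ℕ}
    (h : MateGood n E c mate lam) (hD : Valid n E c D) :
    lam ≤ (cut n E c D).card ∧ ((cut n E c D).card ≤ lam →
      ∀ w < n, c w = 0 → (w ∈ D ∨ w ∈ cut n E c D) → mate w ∈ D) := by
  classical
  set Wc := (Finset.range n).filter fun w => c w = 0 ∧ (w ∈ D ∨ w ∈ cut n E c D) with hWc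
  set D0 := D.filter fun w => c w = 0 with hD0
  set T := (Finset.range n).filter fun w => c w = 0 ∧ c (mate w) = 1 with hT
  set P := Wc.filter fun w => mate w ∈ D0 with hP
  have hmem : ∀ w < n, c w = 0 → ∀ u ∈ D, (u = w ∨ E u w) → w ∈ Wc := by
    intro w hw hc u hu huw
    simp only [hWc, Finset.mem_filter, Finset.mem_range, hw, hc, true_and, mem_cut]
    rcases huw with rfl | huw
    · exact .inl hu
    · by_cases hwD : w ∈ D
      · exact .inl hwD
      · exact .inr ⟨⟨hwD, u, hu, huw⟩, trivial⟩
  have hTW : T ⊆ Wc := by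
    intro w hw
    simp only [hT, Finset.mem_filter, Finset.mem_range] at hw
    obtain ⟨hw, hc, h1⟩ := hw
    obtain ⟨h2, h3, -⟩ := h.typed w hw hc
    exact hmem w hw hc _ (hD.source _ h2 h1) h3
  have hPcard : D0.card ≤ P.card := by
    have : D0 ⊆ P.image mate := by
      intro u hu
      obtain ⟨huD, hcu⟩ := Finset.mem_filter.1 hu
      obtain ⟨w, hw, hcw, hm⟩ := h.surj u (hD.lt u huD) hcu (hD.sink u huD)
      refine Finset.mem_image.2 ⟨w, Finset.mem_filter.2 ⟨?_, hm ▸ hu⟩, hm⟩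
      exact hmem w hw hcw u huD (hm ▸ (h.typed w hw hcw).2.1)
    exact (Finset.card_le_card this).trans Finset.card_image_le
  have hdisj : Disjoint P T := by
    rw [Finset.disjoint_left]
    intro w hw hw'
    simp only [hP, hD0, hT, Finset.mem_filter] at hw hw'
    omega
  have hWcard : Wc.card = D0.card + (cut n E c D).card := hD.card_free
  have hsub : P ∪ T ⊆ Wc := Finset.union_subset (Finset.filter_subset _ _) hTW
  have hPT : P.card + T.card ≤ Wc.card := by
    rw [← Finset.card_union_of_disjoint hdisj]
    exact Finset.card_le_card hsub
  have hTc : T.card = lam := h.card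
  refine ⟨by omega, fun hle w hw hc hwD => ?_⟩
  have heq : P ∪ T = Wc := Finset.eq_of_subset_of_card_le hsub (by
    rw [Finset.card_union_of_disjoint hdisj]; omega)
  have hwW : w ∈ Wc := by
    simp only [hWc, Finset.mem_filter, Finset.mem_range]
    exact ⟨hw, hc, hwD⟩
  rw [← heq, Finset.mem_union] at hwW
  rcases hwW with h1 | h1
  · exact (Finset.mem_filter.1 (Finset.mem_filter.1 h1).2).1
  · simp only [hT, Finset.mem_filter, Finset.mem_range] at h1
    exact hD.source _ (h.typed w hw hc).1 h1.2.2

theorem MateGood.lb {c mate : ℕ → ℕ} {lam : ℕ}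
    (h : MateGood n E c mate lam) : LB n E c lam := fun _ hD => (h.weak_duality hD).1

/-- The left copies reached by a search. -/
def reached (n : ℕ) (lm : ℕ → ℕ) : Finset ℕ := (Finset.range n).filter fun u => lm u ≠ 0

theorem mem_reached {lm : ℕ → ℕ} : u ∈ reached n lm ↔ u < n ∧ lm u ≠ 0 := by
  simp [reached]

section Searched

variable {c mate par lm pos : ℕ → ℕ} {found lam : ℕ}

/-- The reached left copies form the least set that contains the sources and is closed under
alternating steps. -/
theorem Searched.least (h : Searched n E c mate par lm found pos) {Q : ℕ → Prop}
    (hsrc : ∀ x < n, c x = 1 → Q x)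
    (hcl : ∀ u < n, Q u → ∀ w < n, w = u ∨ E u w → c w = 0 → Q (mate w)) :
    ∀ u < n, lm u ≠ 0 → Q u := by
  intro u
  induction hp : pos u using Nat.strong_induction_on generalizing u with
  | _ N ih =>
  intro hu hl
  rcases h.left u hu hl with h0 | h1
  · obtain ⟨h2, h3, h4, h5, h6⟩ := h.lm_spec u hu hl h0
    obtain ⟨h7, h8, h9⟩ := h.par_spec _ h2 h5
    have := hcl _ h7 (ih _ (hp ▸ h6) _ rfl h7 h8) _ h2 h9 h3
    rwa [h4] at this
  · exact hsrc u hu h1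

theorem Searched.valid (hE : IsGraphOn n E) (h : Searched n E c mate par lm found pos)
    (h0 : found = 0) : Valid n E c (reached n lm) where
  lt _ hv := (mem_reached.1 hv).1
  status _ hv := h.left _ (mem_reached.1 hv).1 (mem_reached.1 hv).2
  source v hv hc := mem_reached.2 ⟨hv, h.source v hv hc⟩
  sink u hu w huw := h.sink h0 w (hE.right_lt huw)
    (h.expand u (mem_reached.1 hu).1 (mem_reached.1 hu).2 w (hE.right_lt huw) (.inr huw))

theorem Searched.mem_cut (h : Searched n E c mate par lm found pos) :
    w ∈ cut n E c (reached n lm) ↔ w < n ∧ c w = 0 ∧ par w ≠ 0 ∧ lm w = 0 := by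
  rw [_root_.mem_cut]
  constructor
  · rintro ⟨⟨h1, h2, u, hu, huw⟩, h3⟩
    refine ⟨h1, h3, h.expand u (mem_reached.1 hu).1 (mem_reached.1 hu).2 w h1 (.inr huw), ?_⟩
    by_contra h4
    exact h2 (mem_reached.2 ⟨h1, h4⟩)
  · rintro ⟨h1, h2, h3, h4⟩
    obtain ⟨h5, h6, h7⟩ := h.par_spec w h1 h3
    refine ⟨⟨h1, fun hr => (mem_reached.1 hr).2 h4, _, mem_reached.2 ⟨h5, h6⟩, ?_⟩, h2⟩
    refine h7.resolve_left fun h8 => h6 ?_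
    rw [← h8, h4]

/-- A failed search exhibits a cut whose size is that of the matching. -/
theorem Searched.card_cut (hE : IsGraphOn n E) (h : Searched n E c mate par lm found pos)
    (h0 : found = 0) (hm : MateGood n E c mate lam) :
    (cut n E c (reached n lm)).card = lam := by
  classical
  have hV := h.valid hE h0
  refine le_antisymm ?_ (hm.lb _ hV)
  set L := reached n lm with hL
  set D0 := L.filter fun w => c w = 0 with hD0
  set Wc := (Finset.range n).filter fun w => c w = 0 ∧ (w ∈ L ∨ w ∈ cut n E c L) with hWc
  set T := (Finset.range n).filter fun w => c w = 0 ∧ c (mate w) = 1 with hT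
  have hWcard : Wc.card = D0.card + (cut n E c L).card := hV.card_free
  have hmem : ∀ w ∈ Wc \ T, w < n ∧ c w = 0 ∧ (w ∈ L ∨ w ∈ cut n E c L) ∧ ¬ c (mate w) = 1 := by
    intro w hw
    obtain ⟨hw, hnT⟩ := Finset.mem_sdiff.1 hw
    obtain ⟨hw, hc, hwL⟩ := Finset.mem_filter.1 hw
    exact ⟨Finset.mem_range.1 hw, hc, hwL, fun h3 => hnT (Finset.mem_filter.2 ⟨hw, hc, h3⟩)⟩
  have hle : (Wc \ T).card ≤ D0.card := by
    refine Finset.card_le_card_of_injOn mate ?_ ?_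
    · intro w hw
      obtain ⟨hw, hc, hwL, hnT⟩ := hmem w (Finset.mem_coe.1 hw)
      have hpar : par w ≠ 0 := by
        rcases hwL with h1 | h1
        · exact h.expand w hw (mem_reached.1 h1).2 w hw (.inl rfl)
        · exact ((h.mem_cut).1 h1).2.2.1
      obtain ⟨h1, -, h2⟩ := hm.typed w hw hc
      exact Finset.mem_coe.2 (Finset.mem_filter.2
        ⟨mem_reached.2 ⟨h1, h.back w hw hpar hc⟩, h2.resolve_right hnT⟩)
    · intro w hw w' hw' heq
      obtain ⟨hw, hc, -, hnT⟩ := hmem w (Finset.mem_coe.1 hw)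
      obtain ⟨hw', hc', -, -⟩ := hmem w' (Finset.mem_coe.1 hw')
      exact hm.inj w hw w' hw' hc hc' heq ((hm.typed w hw hc).2.2.resolve_right hnT)
  have hTc : T.card = lam := hm.card
  have := Finset.le_card_sdiff T Wc
  omega

/-- The cut found by a failed search is the one closest to the sources among the smallest ones. -/
theorem Searched.reached_subset (h : Searched n E c mate par lm found pos)
    (hm : MateGood n E c mate lam) (hD : Valid n E c D) (hcard : (cut n E c D).card ≤ lam) :
    reached n lm ⊆ D := by
  intro u hu
  refine h.least (Q := (· ∈ D)) hD.source ?_ u (mem_reached.1 hu).1 (mem_reached.1 hu).2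
  intro u hu huD w hw huw hc
  refine (hm.weak_duality hD).2 hcard w hw hc ?_
  by_cases hwD : w ∈ D
  · exact .inl hwD
  · rcases huw with rfl | huw
    · exact .inl huD
    · exact .inr (_root_.mem_cut.2 ⟨⟨hw, hwD, u, huD, huw⟩, hc⟩)

end Searched

/-! ### Branching -/

/-- `S` is a solution that the branching rooted at the statuses `c` has to find: it agrees with the
decisions recorded in `c`, and it is closest to the set of sources. -/
structure Target (n : ℕ) (E : ℕ → ℕ → Prop) (s t k : ℕ) (c : ℕ → ℕ) (S : Finset ℕ) : Prop where
  minSep : MinSep n E s t S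
  card_le : S.card ≤ k
  source : ∀ v < n, c v = 1 → v ∈ reach n E S s
  sink : ∀ v < n, c v = 2 → v ∉ reach n E S s ∧ v ∉ S
  chosen : ∀ v < n, c v = 3 → v ∈ S
  closest : ∀ D ⊆ reach n E S s, (∀ v < n, c v = 1 → v ∈ D) → (nb n E D).card ≤ S.card →
    D = reach n E S s

/-- The statuses `c` form an item of the branching: `s` is a source, `t` is a sink, and at most `k`
vertices are chosen. -/
structure ItemOK (n s t k : ℕ) (c : ℕ → ℕ) : Prop where
  le_three : ∀ v < n, c v ≤ 3
  left : c s = 1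
  right : c t = 2
  card_chosen : (chosen n c).card ≤ k

variable {c : ℕ → ℕ} {k lam : ℕ}

theorem Target.valid (hc : ∀ v < n, c v ≤ 3) (hE : IsGraphOn n E)
    (h : Target n E s t k c S) : Valid n E c (reach n E S s) where
  lt v hv := (mem_reach.1 hv).1
  status v hv := by
    have hv' := (mem_reach.1 hv).1
    have h1 := hc v hv'
    have h2 : c v ≠ 2 := fun h2 => (h.sink v hv' h2).1 hv
    have h3 : c v ≠ 3 := fun h3 =>
      not_mem_of_mem_reach h.minSep.left_not_mem hv (h.chosen v hv' h3)
    omega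
  source := h.source
  sink u hu w huw hw := by
    have hwn := hE.right_lt huw
    have h1 := h.sink w hwn hw
    exact h1.1 (reach_step hE hu huw h1.2)

theorem card_chosen_add_card_cut (hE : IsGraphOn n E) (hc : ∀ v < n, c v ≤ 3)
    (h : Target n E s t k c S) : (chosen n c).card + (cut n E c (reach n E S s)).card = S.card := by
  classical
  rw [← Finset.card_union_of_disjoint]
  · congr 1
    ext w
    simp only [Finset.mem_union, mem_chosen, cut, Finset.mem_filter]
    rw [h.minSep.nb_left hE]
    constructor
    · rintro (⟨h1, h2⟩ | ⟨h1, -⟩)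
      · exact h.chosen w h1 h2
      · exact h1
    · intro hw
      have h1 := (h.valid hc hE).nb_status hc (h.minSep.full_left hw)
      have h2 := Finset.mem_range.1 (h.minSep.subset_range hw)
      tauto
  · rw [Finset.disjoint_left]
    intro w hw hw'
    have := (mem_chosen.1 hw).2
    have := (mem_cut.1 hw').2
    omega

/-- Too large a lower bound leaves nothing to be found. -/
theorem Target.false_of_lb (hE : IsGraphOn n E) (hc : ∀ v < n, c v ≤ 3)
    (hlb : LB n E c lam) (hk : k < (_root_.chosen n c).card + lam) :
    ¬ Target n E s t k c S := by
  intro h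
  have h1 := hlb _ (h.valid hc hE)
  have h2 := card_chosen_add_card_cut hE hc h
  have := h.card_le
  omega

/-- If the chosen vertices already separate, then they are the only solution. -/
theorem Target.eq_chosen (hE : IsGraphOn n E) (hs : s < n) (ht : t < n) (hc : ItemOK n s t k c)
    (hD : Valid n E c D) (hcut : cut n E c D = ∅) (h : Target n E s t k c S) :
    S = _root_.chosen n c := by
  have hnb : nb n E D ⊆ _root_.chosen n c := by
    intro w hw
    have h1 : c w ≠ 0 := fun h1 => by
      have : w ∈ cut n E c D := Finset.mem_filter.2 ⟨hw, h1⟩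
      simp [hcut] at this
    have := hD.nb_status hc.le_three hw
    exact mem_chosen.2 ⟨(mem_nb.1 hw).1, by omega⟩
  have hZS : _root_.chosen n c ⊆ S := fun w hw =>
    h.chosen w (mem_chosen.1 hw).1 (mem_chosen.1 hw).2
  have hsD : s ∈ D := hD.source s hs hc.left
  have htD : t ∉ D := fun h1 => by
    have := hD.status t h1
    have := hc.right
    omega
  refine Finset.Subset.antisymm (fun z hz => ?_) hZS
  obtain ⟨hzn, -, u, hu, huz⟩ := mem_nb.1 (h.minSep.full_right hz)
  obtain ⟨-, -, a, ha, haz⟩ := mem_nb.1 (h.minSep.full_left hz)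
  have huD : u ∉ D := by
    refine reach_induction (P := (· ∉ D)) htD ?_ hE ht u hu
    intro x hx hxD w hw hxw hwS hwD
    have : x ∈ nb n E D := mem_nb.2 ⟨hE.right_lt (hE.symm hxw), hxD, w, hwD, hE.symm hxw⟩
    exact not_mem_of_mem_reach h.minSep.right_not_mem hx (hZS (hnb this))
  have haD : a ∈ D := reach_subset_of_nb_subset hE hsD (hnb.trans hZS) ha
  by_contra hzZ
  have hzD : z ∈ D := by
    by_contra hzD
    exact hzZ (hnb (mem_nb.2 ⟨hzn, hzD, a, haD, haz⟩))
  have : u ∈ nb n E D :=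
    mem_nb.2 ⟨hE.right_lt (hE.symm huz), huD, z, hzD, hE.symm huz⟩
  exact not_mem_of_mem_reach h.minSep.right_not_mem hu (hZS (hnb this))

/-- The `s`-side of a solution lies within the source side of any smallest cut: by submodularity
the intersection of the two has a boundary that is not larger than the solution. -/
theorem Target.subset_of_card_cut (hE : IsGraphOn n E) (hc : ItemOK n s t k c)
    (hD : Valid n E c D) (hcut : LB n E c (cut n E c D).card) (h : Target n E s t k c S) :
    reach n E S s ⊆ D := by
  classical
  set A := reach n E S s with hA
  have hAV : Valid n E c A := h.valid hc.le_three hE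
  have hUV : Valid n E c (A ∪ D) := by
    refine ⟨fun v hv => ?_, fun v hv => ?_, fun v hv h1 => ?_, fun u hu => ?_⟩
    · exact (Finset.mem_union.1 hv).elim (hAV.lt v) (hD.lt v)
    · exact (Finset.mem_union.1 hv).elim (hAV.status v) (hD.status v)
    · exact Finset.mem_union_left _ (hAV.source v hv h1)
    · exact (Finset.mem_union.1 hu).elim (hAV.sink u) (hD.sink u)
  have hsplit : ∀ B, Valid n E c B →
      (nb n E B).card = (cut n E c B).card + ((nb n E B).filter fun w => c w = 3).card := by
    intro B hB
    rw [cut, ← Finset.card_union_of_disjoint]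
    · congr 1
      ext w
      simp only [Finset.mem_union, Finset.mem_filter]
      have := hB.nb_status hc.le_three (w := w)
      tauto
    · rw [Finset.disjoint_left]
      intro w hw hw'
      have := (Finset.mem_filter.1 hw).2
      have := (Finset.mem_filter.1 hw').2
      omega
  have h3 : ((nb n E D).filter fun w => c w = 3).card ≤
      ((nb n E (A ∪ D)).filter fun w => c w = 3).card := by
    refine Finset.card_le_card fun w hw => ?_
    obtain ⟨h1, h2⟩ := Finset.mem_filter.1 hw
    obtain ⟨h4, -, u, hu, huw⟩ := mem_nb.1 h1
    refine Finset.mem_filter.2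
      ⟨mem_nb.2 ⟨h4, fun h5 => ?_, u, Finset.mem_union_right _ hu, huw⟩, h2⟩
    have := hUV.status w h5
    omega
  have h4 := hcut _ hUV
  have h5 := card_nb_inter_add_card_nb_union (n := n) (E := E) A D
  have h6 := hsplit D hD
  have h7 := hsplit _ hUV
  have h8 : (nb n E A).card = S.card := by rw [h.minSep.nb_left hE]
  have h9 := h.closest (A ∩ D) Finset.inter_subset_left
    (fun v hv h1 => Finset.mem_inter.2 ⟨hAV.source v hv h1, hD.source v hv h1⟩) (by omega)
  exact Finset.inter_eq_left.1 h9

/-- Every solution survives in one of the two branches. -/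
theorem Target.branch (hE : IsGraphOn n E) (hc : ItemOK n s t k c)
    (hD : Valid n E c D) (hcut : LB n E c (cut n E c D).card) (hv : v ∈ cut n E c D)
    (h : Target n E s t k c S) :
    Target n E s t k (Function.update c v 2) S ∨ Target n E s t k (Function.update c v 3) S := by
  obtain ⟨⟨-, hvD, -⟩, hv0⟩ := mem_cut.1 hv
  have hsub := h.subset_of_card_cut hE hc hD hcut
  have h1 : ∀ x i, i ≠ 1 → (Function.update c v i x = 1 ↔ c x = 1) := by
    intro x i hi
    by_cases hx : x = v
    · subst hx
      simp [hi, hv0]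
    · simp [hx]
  by_cases hvS : v ∈ S
  · right
    refine ⟨h.minSep, h.card_le, fun x hx hx1 => ?_, fun x hx hx1 => ?_, fun x hx hx1 => ?_,
      fun D' h2 h3 => h.closest D' h2 fun x hx hx1 => h3 x hx ?_⟩
    · exact h.source x hx ((h1 x 3 (by omega)).1 hx1)
    · by_cases hxv : x = v
      · simp [hxv] at hx1
      · exact h.sink x hx (by simpa [hxv] using hx1)
    · by_cases hxv : x = v
      · exact hxv ▸ hvS
      · exact h.chosen x hx (by simpa [hxv] using hx1)
    · exact (h1 x 3 (by omega)).2 hx1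
  · left
    refine ⟨h.minSep, h.card_le, fun x hx hx1 => ?_, fun x hx hx1 => ?_, fun x hx hx1 => ?_,
      fun D' h2 h3 => h.closest D' h2 fun x hx hx1 => h3 x hx ?_⟩
    · exact h.source x hx ((h1 x 2 (by omega)).1 hx1)
    · by_cases hxv : x = v
      · exact hxv ▸ ⟨fun h4 => hvD (hsub h4), hvS⟩
      · exact h.sink x hx (by simpa [hxv] using hx1)
    · by_cases hxv : x = v
      · simp [hxv] at hx1
      · exact h.chosen x hx (by simpa [hxv] using hx1)
    · exact (h1 x 2 (by omega)).2 hx1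

theorem Valid.of_update {i : ℕ} (hi : i = 2 ∨ i = 3) (hv0 : c v = 0)
    (h : Valid n E (Function.update c v i) D) : Valid n E c D ∧ v ∉ D := by
  have hvD : v ∉ D := fun hvD => by
    have := h.status v hvD
    simp at this
    omega
  refine ⟨⟨h.lt, fun x hx => ?_, fun x hx hx1 => h.source x hx ?_, fun u hu w huw hw =>
    h.sink u hu w huw ?_⟩, hvD⟩
  · have := h.status x hx
    rwa [Function.update_of_ne (by rintro rfl; exact hvD hx)] at this
  · rwa [Function.update_of_ne (by rintro rfl; omega)]
  · rwa [Function.update_of_ne (by rintro rfl; omega)]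

/-- Making a vertex of the closest smallest cut a sink increases the minimum. -/
theorem lb_update_sink {mate par lm pos : ℕ → ℕ}
    (h : Searched n E c mate par lm 0 pos) (hm : MateGood n E c mate lam)
    (hv : v ∈ cut n E c (reached n lm)) : LB n E (Function.update c v 2) (lam + 1) := by
  intro D hD
  obtain ⟨⟨hvn, -, u, hu, huv⟩, hv0⟩ := mem_cut.1 hv
  obtain ⟨hD', hvD⟩ := hD.of_update (.inl rfl) hv0
  have hnot : ∀ u ∈ D, ¬ E u v := fun u hu huv => hD.sink u hu v huv (by simp)
  have heq : cut n E (Function.update c v 2) D = cut n E c D := by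
    ext w
    simp only [mem_cut]
    refine and_congr_right fun ⟨h1, h2, u, hu, huw⟩ => ?_
    rw [Function.update_of_ne]
    rintro rfl
    exact hnot u hu huw
  rw [heq]
  by_contra hlt
  exact hnot u (h.reached_subset hm hD' (by omega) hu) huv

theorem lb_update_chosen (hv0 : c v = 0) (hlb : LB n E c lam) :
    LB n E (Function.update c v 3) (lam - 1) := by
  classical
  intro D hD
  obtain ⟨hD', hvD⟩ := hD.of_update (.inr rfl) hv0
  have h1 := hlb D hD'
  have h2 : cut n E c D ⊆ insert v (cut n E (Function.update c v 3) D) := by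
    intro w hw
    by_cases hwv : w = v
    · simp [hwv]
    · refine Finset.mem_insert_of_mem (mem_cut.2 ⟨(mem_cut.1 hw).1, ?_⟩)
      rw [Function.update_of_ne hwv]
      exact (mem_cut.1 hw).2
  have := (Finset.card_le_card h2).trans (Finset.card_insert_le _ _)
  omega

theorem chosen_update_sink (hv0 : c v = 0) : chosen n (Function.update c v 2) = chosen n c := by
  ext w
  simp only [mem_chosen, Function.update_apply]
  split_ifs with h
  · subst h; simp [hv0]
  · rfl

theorem card_chosen_update (hv0 : c v = 0) (hvn : v < n) :
    (chosen n (Function.update c v 3)).card = (chosen n c).card + 1 := by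
  classical
  rw [← Finset.card_insert_of_notMem (s := chosen n c) (a := v) (by simp [mem_chosen, hv0])]
  congr 1
  ext w
  simp only [mem_chosen, Function.update_apply, Finset.mem_insert]
  split_ifs with h
  · subst h; simp [hvn]
  · simp [h]

theorem ItemOK.update (hc : ItemOK n s t k c) (hv0 : c v = 0) (hvn : v < n) {i : ℕ}
    (hi : i = 2 ∨ i = 3 ∧ (chosen n c).card < k) : ItemOK n s t k (Function.update c v i) := by
  have h1 := hc.left
  have h2 := hc.right
  refine ⟨fun x hx => ?_, ?_, ?_, ?_⟩
  · rw [Function.update_apply]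
    split_ifs
    · omega
    · exact hc.le_three x hx
  · rwa [Function.update_of_ne (by rintro rfl; omega)]
  · rwa [Function.update_of_ne (by rintro rfl; omega)]
  · rcases hi with rfl | ⟨rfl, hk⟩
    · rw [chosen_update_sink hv0]
      exact hc.card_chosen
    · rw [card_chosen_update hv0 hvn]
      exact hk

end

/-! ### Reasoning about programs -/

/- Expressions and programs are written in the usual notation; numerals stand for constants. -/
instance : Add RamExpr := ⟨.plus⟩
instance : Sub RamExpr := ⟨.minus⟩
instance (k : ℕ) : OfNat RamExpr k := ⟨.lit k⟩

infixr:30 " ;; " => RamProg.seq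
infix:40 " ::= " => RamProg.assign

@[simp] theorem RamExpr.eval_add (σ : RamState) (e₁ e₂ : RamExpr) :
    (e₁ + e₂).eval σ = e₁.eval σ + e₂.eval σ := rfl
@[simp] theorem RamExpr.eval_sub (σ : RamState) (e₁ e₂ : RamExpr) :
    (e₁ - e₂).eval σ = e₁.eval σ - e₂.eval σ := rfl
@[simp] theorem RamExpr.eval_ofNat (σ : RamState) (k : ℕ) :
    (no_index (OfNat.ofNat k) : RamExpr).eval σ = k := rfl
@[simp] theorem RamExpr.eval_reg (σ : RamState) (x : ℕ) : (RamExpr.reg x).eval σ = σ.regs x := rfl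
@[simp] theorem RamExpr.eval_get (σ : RamState) (a : ℕ) (i : RamExpr) :
    (RamExpr.get a i).eval σ = σ.arrs a (i.eval σ) := rfl
@[simp] theorem RamExpr.cost_add (e₁ e₂ : RamExpr) : (e₁ + e₂).cost = e₁.cost + e₂.cost + 1 := rfl
@[simp] theorem RamExpr.cost_sub (e₁ e₂ : RamExpr) : (e₁ - e₂).cost = e₁.cost + e₂.cost + 1 := rfl
@[simp] theorem RamExpr.cost_ofNat (k : ℕ) : (no_index (OfNat.ofNat k) : RamExpr).cost = 1 := rfl
@[simp] theorem RamExpr.cost_reg (x : ℕ) : (RamExpr.reg x).cost = 1 := rfl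
@[simp] theorem RamExpr.cost_get (a : ℕ) (i : RamExpr) : (RamExpr.get a i).cost = i.cost + 1 := rfl

/-- Whether the program contains an assignment to register `x`. -/
def RamProg.modR : RamProg → ℕ → Bool
  | .skip, _ => false
  | .assign y _, x => x == y
  | .store _ _ _, _ => false
  | .emit _, _ => false
  | .flush, _ => false
  | .seq p q, x => p.modR x || q.modR x
  | .cond _ p q, x => p.modR x || q.modR x
  | .loop _ p, x => p.modR x

/-- Whether the program contains an assignment to an entry of array `a`. -/
def RamProg.modA : RamProg → ℕ → Bool
  | .skip, _ => false
  | .assign _ _, _ => false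
  | .store b _ _, a => a == b
  | .emit _, _ => false
  | .flush, _ => false
  | .seq p q, a => p.modA a || q.modA a
  | .cond _ p q, a => p.modA a || q.modA a
  | .loop _ p, a => p.modA a

/-- The memory that the program does not mention as a target is the same in both states. -/
structure Frame (p : RamProg) (σ σ' : RamState) : Prop where
  regs : ∀ x, p.modR x = false → σ'.regs x = σ.regs x
  arrs : ∀ a, p.modA a = false → σ'.arrs a = σ.arrs a

theorem Frame.refl (p : RamProg) (σ : RamState) : Frame p σ σ := ⟨fun _ _ => rfl, fun _ _ => rfl⟩

theorem Frame.trans {p : RamProg} {σ₁ σ₂ σ₃ : RamState} (h₁ : Frame p σ₁ σ₂)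
    (h₂ : Frame p σ₂ σ₃) : Frame p σ₁ σ₃ :=
  ⟨fun x hx => (h₂.regs x hx).trans (h₁.regs x hx), fun a ha => (h₂.arrs a ha).trans (h₁.arrs a ha)⟩

theorem Frame.mono {p q : RamProg} {σ σ' : RamState} (h : Frame p σ σ')
    (hR : ∀ x, q.modR x = false → p.modR x = false)
    (hA : ∀ a, q.modA a = false → p.modA a = false) : Frame q σ σ' :=
  ⟨fun x hx => h.regs x (hR x hx), fun a ha => h.arrs a (hA a ha)⟩

/-- Programs change only what they assign to. For a concrete program the hypotheses of `Frame.regs`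
and `Frame.arrs` hold by evaluation. -/
theorem Exec.frame {p : RamProg} {σ σ' : RamState} {tr : List RamEvent} (h : Exec p σ tr σ') :
    Frame p σ σ' := by
  induction h with
  | skip | emit | flush | loop_false => exact Frame.refl _ _
  | assign x e σ =>
    refine ⟨fun y hy => ?_, fun a _ => rfl⟩
    simp only [RamProg.modR, beq_eq_false_iff_ne] at hy
    simp [hy]
  | store a i e σ =>
    refine ⟨fun y _ => rfl, fun b hb => ?_⟩
    simp only [RamProg.modA, beq_eq_false_iff_ne] at hb
    simp [hb]
  | seq _ _ h1 h2 =>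
    exact (h1.mono (by simp +contextual [RamProg.modR]) (by simp +contextual [RamProg.modA])).trans
      (h2.mono (by simp +contextual [RamProg.modR]) (by simp +contextual [RamProg.modA]))
  | cond_true _ _ _ h1 | cond_false _ _ _ h1 =>
    exact h1.mono (by simp +contextual [RamProg.modR]) (by simp +contextual [RamProg.modA])
  | loop_true _ _ _ h1 h2 =>
    exact (h1.mono (by simp [RamProg.modR]) (by simp [RamProg.modA])).trans h2

/-- Started in `σ`, the program `p` halts after at most `N` internal steps and no others, in a state
that satisfies `Q`. -/
def Run (p : RamProg) (σ : RamState) (N : ℕ) (Q : RamState → Prop) : Prop :=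
  ∃ r σ', Exec p σ (ticks r) σ' ∧ r ≤ N ∧ Q σ'

theorem ticks_append (a b : ℕ) : ticks a ++ ticks b = ticks (a + b) := by
  simp [ticks]

section Run

variable {p q : RamProg} {σ : RamState} {N M : ℕ} {Q R : RamState → Prop}

theorem Run.mono (h : Run p σ N Q) (hN : N ≤ M) (hQ : ∀ σ', Frame p σ σ' → Q σ' → R σ') :
    Run p σ M R := by
  obtain ⟨r, σ', h1, h2, h3⟩ := h
  exact ⟨r, σ', h1, h2.trans hN, hQ _ h1.frame h3⟩

theorem Run.seq (h : Run p σ N R) (h' : ∀ σ', Frame p σ σ' → R σ' → Run q σ' M Q) :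
    Run (p ;; q) σ (N + M) Q := by
  obtain ⟨r, σ', h1, h2, h3⟩ := h
  obtain ⟨r', σ'', h4, h5, h6⟩ := h' σ' h1.frame h3
  exact ⟨r + r', σ'', ticks_append r r' ▸ Exec.seq h1 h4, by omega, h6⟩

theorem Run.step (h : Run p σ N R) (hN : N ≤ M)
    (h' : ∀ σ', Frame p σ σ' → R σ' → Run q σ' (M - N) Q) : Run (p ;; q) σ M Q :=
  (h.seq h').mono (by omega) fun _ _ h => h

theorem Run.cond {e : RamExpr} (hp : e.eval σ ≠ 0 → Run p σ N Q) (hq : e.eval σ = 0 → Run q σ N Q) :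
    Run (.cond e p q) σ (e.cost + N) Q := by
  by_cases h : e.eval σ = 0
  · obtain ⟨r, σ', h1, h2, h3⟩ := hq h
    exact ⟨e.cost + r, σ', ticks_append _ r ▸ Exec.cond_false _ h h1, by omega, h3⟩
  · obtain ⟨r, σ', h1, h2, h3⟩ := hp h
    exact ⟨e.cost + r, σ', ticks_append _ r ▸ Exec.cond_true _ h h1, by omega, h3⟩

/-- Loops, with a potential `φ` that pays for the guard and the body of each round. -/
theorem Run.loop {e : RamExpr} (I : ℕ → RamState → Prop) (hc : 0 < e.cost)
    (step : ∀ φ σ', Frame (.loop e p) σ σ' → I φ σ' → e.eval σ' ≠ 0 →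
      ∃ N, Run p σ' N fun σ'' => ∃ φ', I φ' σ'' ∧ φ' + N + e.cost ≤ φ)
    {φ : ℕ} (h0 : I φ σ) :
    Run (.loop e p) σ (φ + e.cost) fun σ' => (∃ φ', I φ' σ') ∧ e.eval σ' = 0 := by
  have key : ∀ φ σ', Frame (.loop e p) σ σ' → I φ σ' →
      Run (.loop e p) σ' (φ + e.cost) fun σ' => (∃ φ', I φ' σ') ∧ e.eval σ' = 0 := by
    intro φ
    induction φ using Nat.strong_induction_on with
    | _ φ ih =>
    intro σ' hF hI
    by_cases h : e.eval σ' = 0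
    · exact ⟨e.cost, σ', Exec.loop_false _ h, by omega, ⟨φ, hI⟩, h⟩
    · obtain ⟨N, r, σ2, h1, h2, φ', h3, h4⟩ := step φ σ' hF hI h
      have hF2 : Frame (.loop e p) σ σ2 :=
        hF.trans (h1.frame.mono (by simp [RamProg.modR]) (by simp [RamProg.modA]))
      obtain ⟨r', σ3, h5, h6, h7⟩ := ih φ' (by omega) σ2 hF2 h3
      refine ⟨e.cost + r + r', σ3, ?_, by omega, h7⟩
      rw [← ticks_append, ← ticks_append]
      exact Exec.loop_true h h1 h5
  exact key φ σ (Frame.refl _ _) h0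

/-- Programs without loops and output. -/
def RamProg.simple : RamProg → Bool
  | .skip => true
  | .assign _ _ => true
  | .store _ _ _ => true
  | .emit _ => false
  | .flush => false
  | .seq p q => p.simple && q.simple
  | .cond _ p q => p.simple && q.simple
  | .loop _ _ => false

/-- The effect of a program without loops. -/
def RamProg.run : RamProg → RamState → RamState
  | .skip, σ => σ
  | .assign x e, σ => ⟨Function.update σ.regs x (e.eval σ), σ.arrs⟩
  | .store a i e, σ =>
      ⟨σ.regs, Function.update σ.arrs a (Function.update (σ.arrs a) (i.eval σ) (e.eval σ))⟩
  | .emit _, σ => σ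
  | .flush, σ => σ
  | .seq p q, σ => q.run (p.run σ)
  | .cond e p q, σ => if e.eval σ ≠ 0 then p.run σ else q.run σ
  | .loop _ _, σ => σ

/-- An upper bound on the running time of a program without loops. -/
def RamProg.bound : RamProg → ℕ
  | .skip => 1
  | .assign _ e => e.cost + 1
  | .store _ i e => i.cost + e.cost + 1
  | .emit e => e.cost + 1
  | .flush => 1
  | .seq p q => p.bound + q.bound
  | .cond e p q => e.cost + (p.bound + q.bound)
  | .loop _ _ => 0

theorem Run.of_simple (p : RamProg) (hp : p.simple = true) (σ : RamState) :
    Run p σ p.bound fun σ' => σ' = p.run σ := by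
  induction p generalizing σ with
  | skip => exact ⟨1, _, .skip σ, le_rfl, rfl⟩
  | assign x e => exact ⟨_, _, .assign x e σ, le_rfl, rfl⟩
  | store a i e => exact ⟨_, _, .store a i e σ, le_rfl, rfl⟩
  | emit | flush | loop => simp [RamProg.simple] at hp
  | seq p q ihp ihq =>
    simp only [RamProg.simple, Bool.and_eq_true] at hp
    refine (ihp hp.1 σ).seq fun σ' _ h => ?_
    subst h
    exact ihq hp.2 _
  | cond e p q ihp ihq =>
    simp only [RamProg.simple, Bool.and_eq_true] at hp
    refine Run.cond (fun h => ?_) (fun h => ?_)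
    · exact (ihp hp.1 σ).mono (by omega) fun σ' _ h' => by simp [RamProg.run, h, h']
    · exact (ihq hp.2 σ).mono (by omega) fun σ' _ h' => by simp [RamProg.run, h, h']

/-- Programs without loops are verified by evaluating them symbolically. -/
theorem Run.simple (hp : p.simple = true) (h : Frame p σ (p.run σ) → Q (p.run σ)) :
    Run p σ p.bound Q :=
  (Run.of_simple p hp σ).mono le_rfl fun σ' hF h' => by subst h'; exact h hF

/-- Run `body` with register `i` counting from its current value up to the value of register `hi`,
exclusively. -/
def countTo (i hi : ℕ) (body : RamProg) : RamProg :=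
  .loop (.reg hi - .reg i) (body ;; i ::= .reg i + 1)

/-- An invariant `I v` of the state in which the counter is `v`, and a bound `B` for the time of one
round, prove a counting loop correct. -/
theorem run_countTo {i hi : ℕ} {body : RamProg} (hne : hi ≠ i) (hi1 : body.modR i = false)
    (hi2 : body.modR hi = false) (I : ℕ → RamState → Prop) (B : ℕ)
    (hle : σ.regs i ≤ σ.regs hi) (h0 : I (σ.regs i) σ)
    (step : ∀ v, σ.regs i ≤ v → v < σ.regs hi → ∀ σ', Frame (countTo i hi body) σ σ' →
      σ'.regs i = v → I v σ' →
      Run body σ' B fun σ'' => I (v + 1) ⟨Function.update σ''.regs i (v + 1), σ''.arrs⟩) :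
    Run (countTo i hi body) σ ((σ.regs hi - σ.regs i) * (B + 7) + 3) fun σ' =>
      I (σ.regs hi) σ' ∧ σ'.regs i = σ.regs hi := by
  have hcost : (RamExpr.reg hi - RamExpr.reg i : RamExpr).cost = 3 := rfl
  have hmod : (countTo i hi body).modR hi = false := by
    simp [countTo, RamProg.modR, hi2, hne]
  refine (Run.loop (σ := σ) (p := body ;; i ::= .reg i + 1) (e := .reg hi - .reg i)
    (fun φ σ' => σ.regs i ≤ σ'.regs i ∧ σ'.regs i ≤ σ.regs hi ∧ I (σ'.regs i) σ' ∧
      φ = (σ.regs hi - σ'.regs i) * (B + 7)) (by simp [hcost]) ?_ ⟨le_rfl, hle, h0, rfl⟩).mono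
      (by rw [hcost]) ?_
  · rintro φ σ' hF ⟨h1, h2, h3, h4⟩ hg
    have hhi : σ'.regs hi = σ.regs hi := hF.regs hi hmod
    simp only [RamExpr.eval_sub, RamExpr.eval_reg, hhi] at hg
    refine ⟨B + 4, (step _ h1 (by omega) σ' hF rfl h3).seq fun σ2 hF2 h5 =>
      Run.simple rfl fun _ => ?_⟩
    have hii : σ2.regs i = σ'.regs i := hF2.regs i hi1
    refine ⟨_, ⟨?_, ?_, ?_, rfl⟩, ?_⟩
    · simp [RamProg.run, hii]; omega
    · simp [RamProg.run, hii]; omega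
    · simpa [RamProg.run, hii] using h5
    · simp only [RamProg.run, RamExpr.eval_add, RamExpr.eval_reg, hii, RamExpr.eval_ofNat,
        Function.update_self, h4, hcost]
      obtain ⟨d, hd⟩ : ∃ d, σ.regs hi - σ'.regs i = d + 1 :=
        ⟨_, (Nat.sub_add_cancel (by omega)).symm⟩
      rw [hd, show σ.regs hi - (σ'.regs i + 1) = d by omega]
      ring_nf
      omega
  · rintro σ' hF ⟨⟨φ, h1, h2, h3, h4⟩, hg⟩
    have hhi : σ'.regs hi = σ.regs hi := hF.regs hi hmod
    simp only [RamExpr.eval_sub, RamExpr.eval_reg, hhi] at hg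
    have : σ'.regs i = σ.regs hi := by omega
    exact ⟨this ▸ h3, this⟩

/-- Run `body` with register `i` counting through the vertices; register `0` holds their number. -/
def forN (i : ℕ) (body : RamProg) : RamProg := i ::= 0 ;; countTo i 0 body

theorem run_forN {i : ℕ} {body : RamProg} (hne : 0 ≠ i) (hi1 : body.modR i = false)
    (hi2 : body.modR 0 = false) (I : ℕ → RamState → Prop) (B : ℕ)
    (h0 : I 0 ⟨Function.update σ.regs i 0, σ.arrs⟩)
    (step : ∀ v, v < σ.regs 0 → ∀ σ', Frame (forN i body) σ σ' → σ'.regs i = v → I v σ' →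
      Run body σ' B fun σ'' => I (v + 1) ⟨Function.update σ''.regs i (v + 1), σ''.arrs⟩) :
    Run (forN i body) σ (σ.regs 0 * (B + 7) + 5) (I (σ.regs 0)) := by
  have hrun : Run (i ::= 0) σ 2 (fun σ' => σ' = ⟨Function.update σ.regs i 0, σ.arrs⟩) :=
    Run.simple rfl fun _ => rfl
  refine (hrun.seq (M := σ.regs 0 * (B + 7) + 3) fun σ1 hF1 h1 => ?_).mono (by omega)
    fun _ _ h => h
  have h10 : σ1.regs 0 = σ.regs 0 := by simp [h1, hne]
  have h1i : σ1.regs i = 0 := by simp [h1]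
  refine (run_countTo hne hi1 hi2 I B (by omega) (by rw [h1i, h1]; exact h0)
    fun v _ hv σ' hF' hσ' hI => step v (by omega) σ' ?_ hσ' hI).mono
    (by rw [h10, h1i, Nat.sub_zero]) fun σ' _ h => h10 ▸ h.1
  exact (hF1.mono (by simp +contextual [forN, RamProg.modR])
    (by simp +contextual [forN, RamProg.modA])).trans
    (hF'.mono (by simp +contextual [forN, RamProg.modR])
    (by simp +contextual [forN, RamProg.modA]))

end Run

/-! ### Breadth-first search along alternating paths -/

/- The registers and arrays used, apart from the register `0` with the number of vertices and the
registers `1`, `2`, `3` with `s`, `t` and `k`. -/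
notation "rV" => 4
notation "rJ" => 5
notation "rEnd" => 6
notation "rU" => 7
notation "rW" => 8
notation "rX" => 9
notation "rHead" => 10
notation "rTail" => 11
notation "rFound" => 12
notation "rLam" => 13
notation "rBudget" => 14
notation "rPick" => 15
notation "rTop" => 16
notation "rOut" => 17
notation "rNext" => 18
notation "rKey" => 19
notation "rCount" => 20
notation "rI" => 21
notation "rRoot" => 22
notation "aOff" => 0
notation "aTgt" => 1
notation "aStat" => 2
notation "aMate" => 3
notation "aPar" => 4
notation "aLm" => 5
notation "aQueue" => 6
notation "aStack" => 7
notation "aFound" => 8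
notation "aDict" => 9
notation "aPow" => 10

/-- The arrays `off`, `tgt` hold adjacency lists of the graph `E`, of total length at most `M`. -/
structure AdjArrays (n : ℕ) (E : ℕ → ℕ → Prop) (M : ℕ) (off tgt : ℕ → ℕ) : Prop where
  edge : ∀ u < n, ∀ w, E u w ↔ ∃ j, off u ≤ j ∧ j < off (u + 1) ∧ tgt j = w
  mono : ∀ u < n, off u ≤ off (u + 1)
  total : ∑ u ∈ Finset.range n, (off (u + 1) - off u) ≤ M

/-- The memory holds the graph, with number of vertices and adjacency lists. -/
structure HoldsGraph (n : ℕ) (E : ℕ → ℕ → Prop) (M : ℕ) (σ : RamState) : Prop where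
  size : σ.regs 0 = n
  adj : AdjArrays n E M (σ.arrs aOff) (σ.arrs aTgt)

theorem HoldsGraph.of_eq {n : ℕ} {E : ℕ → ℕ → Prop} {M : ℕ} {σ σ' : RamState}
    (h : HoldsGraph n E M σ) (h1 : σ'.regs 0 = σ.regs 0) (h2 : σ'.arrs aOff = σ.arrs aOff)
    (h3 : σ'.arrs aTgt = σ.arrs aTgt) : HoldsGraph n E M σ' :=
  ⟨h1.trans h.size, by rw [h2, h3]; exact h.adj⟩

/-- Process the step from the left copy `rU` to the right copy `rW`: if `rW` is new, record that it
was reached from `rU`. If it is a sink, the search has succeeded; if it is free, continue to its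
partner. -/
def visit : RamProg :=
  .cond (.get aPar (.reg rW)) .skip (
    .store aPar (.reg rW) (.reg rU + 1) ;;
    .cond (.get aStat (.reg rW))
      (.cond (.get aStat (.reg rW) - 2) .skip
        (.cond (.get aStat (.reg rW) - 1) (rFound ::= .reg rU + 1) .skip))
      (rX ::= .get aMate (.reg rW) ;;
        .cond (.get aLm (.reg rX)) .skip (
          .store aLm (.reg rX) (.reg rW + 1) ;;
          .store aQueue (.reg rTail) (.reg rX) ;;
          rTail ::= .reg rTail + 1)))

/-- Take the next left copy from the queue and visit all right copies adjacent to it. -/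
def expandHead : RamProg :=
  (rU ::= .get aQueue (.reg rHead) ;; rHead ::= .reg rHead + 1 ;; rW ::= .reg rU) ;;
  visit ;;
  (rJ ::= .get aOff (.reg rU) ;; rEnd ::= .get aOff (.reg rU + 1)) ;;
  countTo rJ rEnd (rW ::= .get aTgt (.reg rJ) ;; visit)

/-- Search for alternating paths from the sources. -/
def search : RamProg :=
  forN rV (.store aPar (.reg rV) 0 ;; .store aLm (.reg rV) 0) ;;
  (rTail ::= 0 ;; rHead ::= 0 ;; rFound ::= 0) ;;
  forN rV (.cond (.get aStat (.reg rV)) (.cond (.get aStat (.reg rV) - 1) .skip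
    (.store aLm (.reg rV) 1 ;; .store aQueue (.reg rTail) (.reg rV) ;; rTail ::= .reg rTail + 1))
    .skip) ;;
  .loop (.reg rTail - .reg rHead) expandHead

/-- The state of a search: the first `qt` entries of `queue` are the left copies reached so far, the
first `h` of them have been processed completely, and the first `qh` at least in part. Vertices
below `m` have been considered as sources, and `pos u` is the position of `u` in the queue. -/
structure Searching (n : ℕ) (E : ℕ → ℕ → Prop) (c mate : ℕ → ℕ) (m h qh : ℕ)
    (par lm queue : ℕ → ℕ) (qt found : ℕ) (pos : ℕ → ℕ) : Prop where
  source : ∀ x < m, c x = 1 → lm x ≠ 0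
  queued : ∀ u < n, lm u ≠ 0 → pos u < qt ∧ queue (pos u) = u ∧ (c u = 0 ∨ c u = 1)
  queue_spec : ∀ i < qt, queue i < n ∧ lm (queue i) ≠ 0 ∧ pos (queue i) = i
  expand : ∀ u < n, lm u ≠ 0 → pos u < h → ∀ w < n, w = u ∨ E u w → par w ≠ 0
  back : ∀ w < n, par w ≠ 0 → c w = 0 → lm (mate w) ≠ 0
  sink : found = 0 → ∀ w < n, par w ≠ 0 → c w ≠ 2
  found_spec : found ≠ 0 → found - 1 < n ∧ lm (found - 1) ≠ 0 ∧ ∃ y, E (found - 1) y ∧ c y = 2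
  par_spec : ∀ w < n, par w ≠ 0 → par w - 1 < n ∧ lm (par w - 1) ≠ 0 ∧
    (w = par w - 1 ∨ E (par w - 1) w) ∧ pos (par w - 1) < qh
  lm_spec : ∀ u < n, lm u ≠ 0 → c u = 0 → lm u - 1 < n ∧ c (lm u - 1) = 0 ∧
    mate (lm u - 1) = u ∧ par (lm u - 1) ≠ 0 ∧ pos (par (lm u - 1) - 1) < pos u
  head_le : qh ≤ qt

section

variable {n : ℕ} {E : ℕ → ℕ → Prop} {c mate par lm queue pos : ℕ → ℕ} {m h qh qt found u w : ℕ}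

/-- The queue holds every vertex at most once. -/
theorem Searching.sum_queue_le
    (H : Searching n E c mate m h qh par lm queue qt found pos) (d : ℕ → ℕ) :
    ∑ i ∈ Finset.range qt, d (queue i) ≤ ∑ u ∈ Finset.range n, d u := by
  rw [← Finset.sum_image (f := d) (g := queue)]
  · refine Finset.sum_le_sum_of_subset fun u hu => ?_
    obtain ⟨i, hi, rfl⟩ := Finset.mem_image.1 hu
    exact Finset.mem_range.2 (H.queue_spec i (Finset.mem_range.1 hi)).1
  · intro i hi j hj hij
    have h1 := (H.queue_spec i (Finset.mem_range.1 hi)).2.2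
    have h2 := (H.queue_spec j (Finset.mem_range.1 hj)).2.2
    rw [← h1, ← h2, hij]

theorem Searching.tail_le (H : Searching n E c mate m h qh par lm queue qt found pos) : qt ≤ n := by
  simpa using H.sum_queue_le fun _ => 1

theorem Searching.searched (H : Searching n E c mate n h qt par lm queue qt found pos)
    (hh : h = qt) : Searched n E c mate par lm found pos where
  source := H.source
  left u hu hl := (H.queued u hu hl).2.2
  expand u hu hl := H.expand u hu hl (hh ▸ (H.queued u hu hl).1)
  back := H.back
  sink := H.sink
  found_spec := H.found_spec
  par_spec w hw hp := ⟨(H.par_spec w hw hp).1, (H.par_spec w hw hp).2.1, (H.par_spec w hw hp).2.2.1⟩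
  lm_spec := H.lm_spec
  pos_lt u hu hl := (H.queued u hu hl).1.trans_le H.tail_le

/-- Visiting a right copy that leads to no new left copy. -/
theorem Searching.mark (H : Searching n E c mate m h qh par lm queue qt found pos)
    (hu : u < n) (hlu : lm u ≠ 0) (hpu : pos u < qh) (huw : w = u ∨ E u w)
    (hpar : par w = 0) (hb : c w = 0 → lm (mate w) ≠ 0)
    {found' : ℕ} (hf : found' = found ∧ c w ≠ 2 ∨ found' = u + 1 ∧ E u w ∧ c w = 2) :
    Searching n E c mate m h qh (Function.update par w (u + 1)) lm queue qt found' pos where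
  source := H.source
  queued := H.queued
  queue_spec := H.queue_spec
  expand x hx hl hp y hy hxy := by
    have := H.expand x hx hl hp y hy hxy
    rw [Function.update_apply]
    split_ifs <;> omega
  back y hy hp hc := by
    rw [Function.update_apply] at hp
    split_ifs at hp with hyw
    · subst hyw
      exact hb hc
    · exact H.back y hy hp hc
  sink h0 y hy hp := by
    rcases hf with ⟨hf, hc⟩ | ⟨hf, -, -⟩
    · rw [Function.update_apply] at hp
      split_ifs at hp with hyw
      · subst hyw
        exact hc
      · exact H.sink (hf ▸ h0) y hy hp
    · omega
  found_spec h0 := by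
    rcases hf with ⟨hf, hc⟩ | ⟨hf, h1, h2⟩
    · rw [hf] at h0 ⊢
      exact H.found_spec h0
    · rw [hf]
      exact ⟨hu, hlu, w, h1, h2⟩
  par_spec y hy hp := by
    by_cases hyw : y = w
    · subst hyw
      simp [hu, hlu, huw, hpu]
    · rw [Function.update_of_ne hyw] at hp ⊢
      exact H.par_spec y hy hp
  lm_spec x hx hl hc := by
    obtain ⟨h1, h2, h3, h4, h5⟩ := H.lm_spec x hx hl hc
    have hne : lm x - 1 ≠ w := fun h6 => h4 (h6 ▸ hpar)
    rw [Function.update_of_ne hne]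
    exact ⟨h1, h2, h3, h4, h5⟩
  head_le := H.head_le

/-- Visiting a right copy whose partner has not been reached before. -/
theorem Searching.push (H : Searching n E c mate m h qh par lm queue qt found pos)
    (hle : h ≤ qh) (hty : MateTyped n E c mate)
    (hu : u < n) (hlu : lm u ≠ 0) (hpu : pos u < qh) (hw : w < n) (huw : w = u ∨ E u w)
    (hpar : par w = 0) (hc : c w = 0) (hlm : lm (mate w) = 0) :
    Searching n E c mate m h qh (Function.update par w (u + 1))
      (Function.update lm (mate w) (w + 1)) (Function.update queue qt (mate w)) (qt + 1) found
      (Function.update pos (mate w) qt) := by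
  obtain ⟨hx, -, hcx⟩ := hty w hw hc
  have hql := H.head_le
  have hne : ∀ y, lm y ≠ 0 → y ≠ mate w := fun y hy h1 => hy (h1 ▸ hlm)
  refine ⟨fun y hy h1 => ?_, fun y hy h1 => ?_, fun i hi => ?_, fun y hy h1 h2 z hz h3 => ?_,
    fun y hy h1 h2 => ?_, fun h0 y hy h1 => ?_, fun h0 => ?_, fun y hy h1 => ?_,
    fun y hy h1 h2 => ?_, by omega⟩
  · rw [Function.update_apply]
    split_ifs
    · omega
    · exact H.source y hy h1
  · by_cases hy' : y = mate w
    · subst hy'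
      simp [hcx]
    · rw [Function.update_of_ne hy'] at h1
      obtain ⟨h3, h4, h5⟩ := H.queued y hy h1
      rw [Function.update_of_ne hy', Function.update_of_ne (by omega)]
      exact ⟨by omega, h4, h5⟩
  · by_cases hi' : i = qt
    · subst hi'
      simp [hx]
    · rw [Function.update_of_ne hi']
      obtain ⟨h3, h4, h5⟩ := H.queue_spec i (by omega)
      rw [Function.update_of_ne (hne _ h4), Function.update_of_ne (hne _ h4)]
      exact ⟨h3, h4, h5⟩
  · have hym : y ≠ mate w := by
      rintro rfl
      simp at h2
      omega
    rw [Function.update_of_ne hym] at h1 h2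
    have := H.expand y hy h1 h2 z hz h3
    rw [Function.update_apply]
    split_ifs <;> omega
  · by_cases hyw : y = w
    · subst hyw
      simp
    · rw [Function.update_of_ne hyw] at h1
      rw [Function.update_of_ne (hne _ (H.back y hy h1 h2))]
      exact H.back y hy h1 h2
  · by_cases hyw : y = w
    · subst hyw
      omega
    · rw [Function.update_of_ne hyw] at h1
      exact H.sink h0 y hy h1
  · obtain ⟨h1, h2, h3⟩ := H.found_spec h0
    rw [Function.update_of_ne (hne _ h2)]
    exact ⟨h1, h2, h3⟩
  · by_cases hyw : y = w
    · subst hyw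
      rw [Function.update_self, Nat.add_sub_cancel, Function.update_of_ne (hne _ hlu),
        Function.update_of_ne (hne _ hlu)]
      exact ⟨hu, hlu, huw, hpu⟩
    · rw [Function.update_of_ne hyw] at h1 ⊢
      obtain ⟨h3, h4, h5, h6⟩ := H.par_spec y hy h1
      rw [Function.update_of_ne (hne _ h4), Function.update_of_ne (hne _ h4)]
      exact ⟨h3, h4, h5, h6⟩
  · by_cases hy' : y = mate w
    · subst hy'
      simp only [Function.update_self, Nat.add_sub_cancel, Function.update_of_ne (hne _ hlu)]
      exact ⟨hw, hc, trivial, by omega, by omega⟩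
    · rw [Function.update_of_ne hy'] at h1 ⊢
      obtain ⟨h3, h4, h5, h6, h7⟩ := H.lm_spec y hy h1 h2
      have hne2 : lm y - 1 ≠ w := fun h6' => h6 (h6' ▸ hpar)
      rw [Function.update_of_ne hne2, Function.update_of_ne hy',
        Function.update_of_ne (hne _ (H.par_spec _ h3 h6).2.1)]
      exact ⟨h3, h4, h5, h6, h7⟩

end

/-- The state of the search as stored in memory. -/
def SearchingAt (n : ℕ) (E : ℕ → ℕ → Prop) (m h qh : ℕ) (σ : RamState) : Prop :=
  ∃ pos, Searching n E (σ.arrs aStat) (σ.arrs aMate) m h qh (σ.arrs aPar) (σ.arrs aLm)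
    (σ.arrs aQueue) (σ.regs rTail) (σ.regs rFound) pos

section

variable {n M : ℕ} {E : ℕ → ℕ → Prop} {σ : RamState} {m h : ℕ}

theorem run_visit (hty : MateTyped n E (σ.arrs aStat) (σ.arrs aMate))
    (H : SearchingAt n E m h (h + 1) σ)
    (hq : σ.arrs aQueue h = σ.regs rU) (hw : σ.regs rW < n)
    (huw : σ.regs rW = σ.regs rU ∨ E (σ.regs rU) (σ.regs rW)) :
    Run visit σ visit.bound fun σ' => SearchingAt n E m h (h + 1) σ' ∧
      (∀ i ≤ h, σ'.arrs aQueue i = σ.arrs aQueue i) ∧ σ'.arrs aPar (σ.regs rW) ≠ 0 ∧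
      ∀ w, σ.arrs aPar w ≠ 0 → σ'.arrs aPar w ≠ 0 := by
  obtain ⟨pos, H⟩ := H
  obtain ⟨hun, hlu, hpu⟩ := H.queue_spec h H.head_le
  rw [hq] at hun hlu hpu
  have hql := H.head_le
  have hmono : ∀ w, σ.arrs aPar w ≠ 0 →
      Function.update (σ.arrs aPar) (σ.regs rW) (σ.regs rU + 1) w ≠ 0 := by
    intro w hw
    rw [Function.update_apply]
    split_ifs <;> omega
  refine Run.simple rfl fun _ => ?_
  by_cases hpar : σ.arrs aPar (σ.regs rW) = 0
  · by_cases hc : σ.arrs aStat (σ.regs rW) = 0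
    · by_cases hl : σ.arrs aLm (σ.arrs aMate (σ.regs rW)) = 0
      · have H' := H.push (by omega) hty hun hlu (by omega) hw huw hpar hc hl
        simp [visit, RamProg.run, hpar, hc, hl, SearchingAt]
        refine ⟨⟨_, H'⟩, fun i hi => ?_, hmono⟩
        rw [Function.update_of_ne (by omega)]
      · have H' := H.mark hun hlu (by omega) huw hpar (fun _ => hl) (found' := σ.regs rFound)
          (.inl ⟨rfl, by omega⟩)
        simp [visit, RamProg.run, hpar, hc, hl, SearchingAt]
        exact ⟨⟨_, H'⟩, hmono⟩
    · by_cases h2 : σ.arrs aStat (σ.regs rW) = 2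
      · have hE : E (σ.regs rU) (σ.regs rW) := huw.resolve_left fun h1 => by
          have := (H.queued _ hun hlu).2.2
          rw [h1] at h2
          omega
        have H' := H.mark hun hlu (by omega) huw hpar (fun h1 => absurd h1 hc)
          (.inr ⟨rfl, hE, h2⟩)
        simp [visit, RamProg.run, hpar, h2, SearchingAt]
        exact ⟨⟨_, H'⟩, hmono⟩
      · have H' := H.mark hun hlu (by omega) huw hpar (fun h1 => absurd h1 hc)
          (found' := σ.regs rFound) (.inl ⟨rfl, h2⟩)
        have hif : ¬ (σ.arrs aStat (σ.regs rW) - 2 = 0 ∧ ¬ σ.arrs aStat (σ.regs rW) - 1 = 0) := by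
          omega
        by_cases h3 : σ.arrs aStat (σ.regs rW) - 2 = 0
        · have h4 : σ.arrs aStat (σ.regs rW) - 1 = 0 := by omega
          simp [visit, RamProg.run, hpar, hc, h3, h4, SearchingAt]
          exact ⟨⟨_, H'⟩, hmono⟩
        · simp [visit, RamProg.run, hpar, hc, h3, SearchingAt]
          exact ⟨⟨_, H'⟩, hmono⟩
  · simp [visit, RamProg.run, hpar]
    exact ⟨pos, H⟩

theorem run_expandHead (hE : IsGraphOn n E) (hG : HoldsGraph n E M σ)
    (hty : MateTyped n E (σ.arrs aStat) (σ.arrs aMate))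
    (H : SearchingAt n E m (σ.regs rHead) (σ.regs rHead) σ)
    (hlt : σ.regs rHead < σ.regs rTail) :
    Run expandHead σ (80 + 60 * (σ.arrs aOff (σ.arrs aQueue (σ.regs rHead) + 1) -
        σ.arrs aOff (σ.arrs aQueue (σ.regs rHead))))
      fun σ' => SearchingAt n E m (σ'.regs rHead) (σ'.regs rHead) σ' ∧
        σ'.regs rHead = σ.regs rHead + 1 ∧
        ∀ i ≤ σ.regs rHead, σ'.arrs aQueue i = σ.arrs aQueue i := by
  set h := σ.regs rHead with hh
  set u := σ.arrs aQueue h with hu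
  obtain ⟨pos, H⟩ := H
  obtain ⟨hun, hlu, hpu⟩ := H.queue_spec h hlt
  rw [← hu] at hun hlu hpu
  have H1 : Searching n E (σ.arrs aStat) (σ.arrs aMate) m h (h + 1) (σ.arrs aPar) (σ.arrs aLm)
    (σ.arrs aQueue) (σ.regs rTail) (σ.regs rFound) pos :=
    { H with
      par_spec := fun w hw hp => by
        obtain ⟨h1, h2, h3, h4⟩ := H.par_spec w hw hp
        exact ⟨h1, h2, h3, by omega⟩
      head_le := hlt }
  have hstart : Run (rU ::= .get aQueue (.reg rHead) ;; rHead ::= .reg rHead + 1 ;;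
      rW ::= .reg rU) σ 9
      (fun σ1 => σ1.arrs = σ.arrs ∧ σ1.regs rU = u ∧ σ1.regs rHead = h + 1 ∧ σ1.regs rW = u) :=
    Run.simple rfl fun _ => by simp [RamProg.run, hu, hh]
  refine hstart.step (by omega) fun σ3 hF3 ⟨ha, hu3, hh3, hw3⟩ => ?_
  have ht : σ3.regs rTail = σ.regs rTail := hF3.regs rTail rfl
  have hf : σ3.regs rFound = σ.regs rFound := hF3.regs rFound rfl
  have H3 : SearchingAt n E m h (h + 1) σ3 := ⟨pos, by rw [ha, ht, hf]; exact H1⟩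
  refine (run_visit (by rw [ha]; exact hty) H3 (by rw [ha, hu3]) (by rw [hw3]; exact hun)
    (.inl (by rw [hw3, hu3]))).step
    (by rw [show visit.bound = 42 by rfl]; omega) fun σ4 hF4 ⟨H4, hq4, hp4, _⟩ => ?_
  have hu4 : σ4.regs rU = u := (hF4.regs rU rfl).trans hu3
  have hG4 : ∀ a, visit.modA a = false → σ4.arrs a = σ.arrs a := fun a h' =>
    (hF4.arrs a h').trans (by rw [ha])
  have hs5 : Run (rJ ::= .get aOff (.reg rU) ;; rEnd ::= .get aOff (.reg rU + 1)) σ4 8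
      (fun σ5 => σ5.arrs = σ4.arrs ∧ σ5.regs rJ = σ.arrs aOff u ∧
        σ5.regs rEnd = σ.arrs aOff (u + 1)) :=
    Run.simple rfl fun _ => by simp [RamProg.run, hu4, hG4 aOff rfl]
  refine hs5.step (by rw [show visit.bound = 42 by rfl]; omega) fun σ6 hF6 ⟨ha6, hj6, he6⟩ => ?_
  have hu6 : σ6.regs rU = u := (hF6.regs rU rfl).trans hu4
  have hh6 : σ6.regs rHead = h + 1 :=
    (hF6.regs rHead rfl).trans ((hF4.regs rHead rfl).trans hh3)
  have hq6 : ∀ i ≤ h, σ6.arrs aQueue i = σ.arrs aQueue i := fun i hi => by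
    rw [ha6, hq4 i hi, ha]
  refine (run_countTo (by decide) rfl rfl (fun j τ => SearchingAt n E m h (h + 1) τ ∧
    (∀ i ≤ h, τ.arrs aQueue i = σ.arrs aQueue i) ∧ τ.arrs aPar u ≠ 0 ∧
    ∀ i, σ.arrs aOff u ≤ i → i < j → τ.arrs aPar (σ.arrs aTgt i) ≠ 0) 50
    (by rw [hj6, he6]; exact hG.adj.mono u hun) ⟨?_, hq6, ?_, ?_⟩ ?_).mono ?_ ?_
  · obtain ⟨pos4, H4⟩ := H4
    refine ⟨pos4, ?_⟩
    rw [ha6, hF6.regs rTail rfl, hF6.regs rFound rfl]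
    exact H4
  · rw [ha6, ← hw3]
    exact hp4
  · intro i h1 h2
    omega
  · rintro j h1 h2 τ hFτ hjτ ⟨⟨posτ, Hτ⟩, hqτ, hpuτ, hpτ⟩
    have huτ : τ.regs rU = u := (hFτ.regs rU rfl).trans hu6
    have haτ : ∀ a, visit.modA a = false → τ.arrs a = σ.arrs a := fun a h' => by
      rw [hFτ.arrs a (by simpa [countTo, RamProg.modA] using h'), ha6, hG4 a h']
    rw [hj6] at h1
    rw [he6] at h2
    have hEj : E u (σ.arrs aTgt j) := (hG.adj.edge u hun _).2 ⟨j, h1, h2, rfl⟩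
    have hb : Run (rW ::= .get aTgt (.reg rJ)) τ 3 (fun τ1 => τ1.arrs = τ.arrs ∧
        τ1.regs rW = σ.arrs aTgt j) :=
      Run.simple rfl fun _ => by simp [RamProg.run, hjτ, haτ aTgt rfl]
    refine (hb.seq fun τ1 hF1 ⟨haτ1, hwτ1⟩ => (run_visit (n := n) (E := E) (m := m) (h := h)
      ?_ ?_ ?_ ?_ ?_).mono (M := 47) (by decide) ?_)
    · rw [haτ1, haτ aStat rfl, haτ aMate rfl]
      exact hty
    · refine ⟨posτ, ?_⟩
      rw [haτ1, hF1.regs rTail rfl, hF1.regs rFound rfl]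
      exact Hτ
    · rw [haτ1, hqτ h le_rfl, hF1.regs rU rfl, huτ]
    · rw [hwτ1]
      exact hE.right_lt hEj
    · rw [hwτ1, hF1.regs rU rfl, huτ]
      exact .inr hEj
    · rintro τ2 hF2' ⟨⟨pos2, H2⟩, hq2, hp2, hm2⟩
      rw [hwτ1] at hp2
      rw [haτ1] at hq2 hm2
      refine ⟨⟨pos2, H2⟩, fun i hi => (hq2 i hi).trans (hqτ i hi), hm2 _ hpuτ,
        fun i hi1 hi2 => ?_⟩
      by_cases hij : i = j
      · exact hij ▸ hp2
      · exact hm2 _ (hpτ i hi1 (by omega))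
  · rw [hj6, he6, show visit.bound = 42 by rfl]
    omega
  · rintro τ hFτ ⟨⟨⟨posτ, Hτ⟩, hqτ, hpuτ, hpτ⟩, -⟩
    have hhτ : τ.regs rHead = h + 1 := by
      rw [hFτ.regs rHead rfl, hh6]
    rw [hhτ]
    refine ⟨⟨posτ, { Hτ with expand := fun x hx hl hp y hy hxy => ?_ }⟩, rfl, hqτ⟩
    by_cases hph : posτ x < h
    · exact Hτ.expand x hx hl hph y hy hxy
    · have hxu : x = u := by
        have := (Hτ.queued x hx hl).2.1
        rw [show posτ x = h by omega, hqτ h le_rfl] at this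
        exact this.symm
      subst hxu
      rcases hxy with rfl | hxy
      · exact hpuτ
      · obtain ⟨j, h1, h2, rfl⟩ := (hG.adj.edge _ hun _).1 hxy
        exact hpτ j h1 (by rw [he6]; exact h2)

/-- The search runs in linear time. -/
theorem run_search (hE : IsGraphOn n E) (hG : HoldsGraph n E M σ)
    (hty : MateTyped n E (σ.arrs aStat) (σ.arrs aMate)) :
    Run search σ (200 * (n + M) + 200) fun σ' =>
      ∃ pos, Searched n E (σ.arrs aStat) (σ.arrs aMate) (σ'.arrs aPar) (σ'.arrs aLm)
        (σ'.regs rFound) pos := by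
  have hn : σ.regs 0 = n := hG.size
  refine (run_forN (by decide) rfl rfl
    (fun j τ => ∀ v < j, τ.arrs aPar v = 0 ∧ τ.arrs aLm v = 0) 6 (by simp) ?_).step
    (by rw [hn]; omega) fun σ1 hF1 h1 => ?_
  · intro v hv τ hF hv1 hI
    refine Run.simple rfl fun _ => ?_
    intro x hx
    by_cases hxv : x = v
    · simp [RamProg.run, hv1, hxv]
    · simpa [RamProg.run, hv1, hxv] using hI x (by omega)
  rw [hn] at h1 ⊢
  have hs2 : Run (rTail ::= 0 ;; rHead ::= 0 ;; rFound ::= 0) σ1 6 (fun τ => τ.arrs = σ1.arrs ∧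
      τ.regs rTail = 0 ∧ τ.regs rHead = 0 ∧ τ.regs rFound = 0) :=
    Run.simple rfl fun _ => by simp [RamProg.run]
  refine hs2.step (by omega) fun σ2 hF2 ⟨ha2, ht2, hh2, hf2⟩ => ?_
  have hn2 : σ2.regs 0 = n := by rw [hF2.regs 0 rfl, hF1.regs 0 rfl, hn]
  have hst2 : σ2.arrs aStat = σ.arrs aStat := by rw [ha2, hF1.arrs aStat rfl]
  refine (run_forN (by decide) rfl rfl
    (fun j τ => τ.regs rHead = 0 ∧ SearchingAt n E j 0 0 τ ∧ (∀ v < n, τ.arrs aPar v = 0) ∧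
      τ.regs rFound = 0 ∧ ∀ v < n, j ≤ v → τ.arrs aLm v = 0) 18 ?_ ?_).step
    (by rw [hn2]; omega) fun σ3 hF3 h3 => ?_
  · have h1p : ∀ v < n, σ2.arrs aPar v = 0 := fun v hv => by rw [ha2]; exact (h1 v hv).1
    have h1l : ∀ v < n, σ2.arrs aLm v = 0 := fun v hv => by rw [ha2]; exact (h1 v hv).2
    refine ⟨by simp [hh2], ⟨id, ?_⟩, by simpa using h1p, by simp [hf2], by simpa using h1l⟩
    constructor <;> simp +contextual [h1p, h1l, ht2, hf2]
  · rintro v hv τ hF hv1 ⟨hh, ⟨pos, H⟩, hp, hf, hl⟩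
    rw [hn2] at hv
    have hstτ : τ.arrs aStat = σ.arrs aStat := by rw [hF.arrs aStat rfl, hst2]
    refine Run.simple rfl fun _ => ?_
    by_cases hc : τ.arrs aStat v = 1
    · have hne : ∀ y, τ.arrs aLm y ≠ 0 → y ≠ v := fun y hy h1 => hy (h1 ▸ hl v hv le_rfl)
      simp [RamProg.run, hv1, hc, SearchingAt, hh, hf]
      refine ⟨⟨Function.update pos v (τ.regs rTail), ?_⟩, hp, fun x hx hvx => ?_⟩
      · refine ⟨fun y hy h1 => ?_, fun y hy h1 => ?_, fun i hi => ?_, by simp,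
          by simp +contextual [hp], by simp +contextual [hp], by simp,
          by simp +contextual [hp], fun y hy h1 h2 => ?_, by simp⟩
        · by_cases hyv : y = v
          · simp [hyv]
          · simpa [hyv] using H.source y (by omega) h1
        · by_cases hyv : y = v
          · subst hyv
            simp [hc]
          · rw [Function.update_of_ne hyv] at h1
            obtain ⟨h3, h4, h5⟩ := H.queued y hy h1
            rw [Function.update_of_ne hyv, Function.update_of_ne (by omega)]
            exact ⟨by omega, h4, h5⟩
        · by_cases hi' : i = τ.regs rTail
          · simp [hi', hv]
          · rw [Function.update_of_ne hi']
            obtain ⟨h3, h4, h5⟩ := H.queue_spec i (by omega)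
            rw [Function.update_of_ne (hne _ h4), Function.update_of_ne (hne _ h4)]
            exact ⟨h3, h4, h5⟩
        · by_cases hyv : y = v
          · subst hyv
            omega
          · rw [Function.update_of_ne hyv] at h1
            obtain ⟨h3, h4, h5, h6, h7⟩ := H.lm_spec y hy h1 h2
            exact absurd (hp _ h3) h6
      · rw [Function.update_of_ne (by omega)]
        exact hl x hx (by omega)
    · have hrun : SearchingAt n E (v + 1) 0 0 τ := by
        refine ⟨pos, { H with source := fun x hx hx1 => ?_ }⟩
        by_cases hxv : x = v
        · exact absurd (hxv ▸ hx1) hc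
        · exact H.source x (by omega) hx1
      have hgoal : (τ.regs rHead = 0 ∧ SearchingAt n E (v + 1) 0 0 τ ∧
          (∀ v < n, τ.arrs aPar v = 0) ∧ τ.regs rFound = 0 ∧
          ∀ x < n, v + 1 ≤ x → τ.arrs aLm x = 0) :=
        ⟨hh, hrun, hp, hf, fun x hx hvx => hl x hx (by omega)⟩
      by_cases h0 : τ.arrs aStat v = 0
      · simpa [RamProg.run, hv1, h0, SearchingAt] using hgoal
      · have h2 : ¬ τ.arrs aStat v - 1 = 0 := by omega
        simpa [RamProg.run, hv1, h0, h2, SearchingAt] using hgoal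
  obtain ⟨hh3, H3, -, hf3, -⟩ := h3
  rw [hn2] at H3 ⊢
  have hG3 : HoldsGraph n E M σ3 := hG.of_eq
    (by rw [hF3.regs 0 rfl, hF2.regs 0 rfl, hF1.regs 0 rfl])
    (by rw [hF3.arrs aOff rfl, hF2.arrs aOff rfl, hF1.arrs aOff rfl])
    (by rw [hF3.arrs aTgt rfl, hF2.arrs aTgt rfl, hF1.arrs aTgt rfl])
  have hst3 : σ3.arrs aStat = σ.arrs aStat := by rw [hF3.arrs aStat rfl, hst2]
  have hmt3 : σ3.arrs aMate = σ.arrs aMate := by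
    rw [hF3.arrs aMate rfl, hF2.arrs aMate rfl, hF1.arrs aMate rfl]
  set d : ℕ → ℕ := fun u => σ.arrs aOff (u + 1) - σ.arrs aOff u with hd
  -- a round costs a constant and a multiple of the degree of the vertex at the head of the queue;
  -- vertices do not enter the queue twice, so the degrees add up to at most `M`
  refine (Run.loop (fun φ τ => SearchingAt n E n (τ.regs rHead) (τ.regs rHead) τ ∧
    φ = (n - τ.regs rHead) * 83 +
      60 * (M - ∑ i ∈ Finset.range (τ.regs rHead), d (τ.arrs aQueue i))) (by decide) ?_
    (φ := n * 83 + 60 * M) ⟨by rw [hh3]; exact H3, by simp [hh3]⟩).mono ?_ ?_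
  · rintro φ τ hF ⟨H, hφ⟩ hg
    have hlt : τ.regs rHead < τ.regs rTail := by
      simp at hg
      omega
    have hoffτ : τ.arrs aOff = σ.arrs aOff := by
      rw [hF.arrs aOff rfl, hF3.arrs aOff rfl, hF2.arrs aOff rfl, hF1.arrs aOff rfl]
    have hGτ : HoldsGraph n E M τ :=
      hG3.of_eq (hF.regs 0 rfl) (hF.arrs aOff rfl) (hF.arrs aTgt rfl)
    refine ⟨_, (run_expandHead hE hGτ ?_ H hlt).mono le_rfl ?_⟩
    · rw [hF.arrs aStat rfl, hF.arrs aMate rfl, hst3, hmt3]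
      exact hty
    · rintro τ' hF' ⟨H', hh', hq'⟩
      refine ⟨_, ⟨H', rfl⟩, ?_⟩
      obtain ⟨pos', H'⟩ := H'
      have hle := H'.head_le
      have hsum : ∀ d' : ℕ → ℕ, ∑ i ∈ Finset.range (τ'.regs rHead), d' (τ'.arrs aQueue i) ≤
          ∑ u ∈ Finset.range n, d' u := fun d' =>
        (Finset.sum_le_sum_of_subset (Finset.range_mono hle)).trans (H'.sum_queue_le d')
      have h1 := (hsum d).trans (hoffτ ▸ hGτ.adj.total)
      have h2 := hsum fun _ => 1
      have heq : ∑ i ∈ Finset.range (τ'.regs rHead), d (τ'.arrs aQueue i) =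
          ∑ i ∈ Finset.range (τ.regs rHead), d (τ.arrs aQueue i) +
            d (τ.arrs aQueue (τ.regs rHead)) := by
        rw [hh', Finset.sum_range_succ, hq' _ le_rfl]
        congr 1
        refine Finset.sum_congr rfl fun i hi => ?_
        rw [hq' i (Finset.mem_range.1 hi).le]
      simp only [Finset.sum_const, Finset.card_range, smul_eq_mul, mul_one] at h2
      have hcost : (RamExpr.reg rTail - RamExpr.reg rHead : RamExpr).cost = 3 := rfl
      rw [hφ, hcost, hoffτ]
      change _ + (80 + 60 * d (τ.arrs aQueue (τ.regs rHead))) + 3 ≤ _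
      rw [heq] at h1 ⊢
      omega
  · have hcost : (RamExpr.reg rTail - RamExpr.reg rHead : RamExpr).cost = 3 := rfl
    rw [hcost]
    omega
  · rintro τ hF ⟨⟨φ, ⟨pos, H⟩, -⟩, hg⟩
    have hle := H.head_le
    have heq : τ.regs rHead = τ.regs rTail := by
      simp at hg
      omega
    refine ⟨pos, ?_⟩
    rw [hF.arrs aStat rfl, hF.arrs aMate rfl, hst3, hmt3] at H
    exact Searching.searched (heq ▸ H) rfl

end

/-! ### Augmentation and minimum cuts -/

/-- Switch the alternating path that ends in the left copy `rFound - 1`. -/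
def augment : RamProg :=
  rU ::= .reg rFound - 1 ;;
  .loop (1 - .get aStat (.reg rU))
    (rW ::= .get aLm (.reg rU) - 1 ;; rX ::= .get aPar (.reg rW) - 1 ;;
      .store aMate (.reg rW) (.reg rX) ;; rU ::= .reg rX)

/-- Augment the matching until it is maximum or exceeds the budget. The guard is the minimum of
`rFound` and `rBudget + 1 - rLam`, so the loop ends when one of the two is zero. -/
def flow : RamProg :=
  rLam ::= 0 ;; search ;;
  .loop (.reg rFound - (.reg rFound - (.reg rBudget + 1 - .reg rLam)))
    (augment ;; rLam ::= .reg rLam + 1 ;; search)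

/-- A matching in the course of an augmentation: it is good if the pair of the right copy `w` and
its partner, the free left copy `u`, is left out. -/
structure Hole (n : ℕ) (E : ℕ → ℕ → Prop) (c mate : ℕ → ℕ) (lam w u : ℕ) : Prop where
  typed : MateTyped n E c mate
  right : w < n ∧ c w = 0
  left : u < n ∧ c u = 0
  mate_eq : mate w = u
  inj : ∀ a < n, ∀ b < n, a ≠ w → b ≠ w → c a = 0 → c b = 0 → mate a = mate b →
    c (mate a) = 0 → a = b
  surj : ∀ x < n, c x = 0 → (∀ y, E x y → c y ≠ 2) → ∃ a < n, a ≠ w ∧ c a = 0 ∧ mate a = x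
  card : ((Finset.range n).filter fun a => c a = 0 ∧ c (mate a) = 1).card = lam

section

variable {n M : ℕ} {E : ℕ → ℕ → Prop} {σ : RamState} {c mate par lm pos : ℕ → ℕ}
  {found lam u w p y : ℕ}

/-- The alternating path ends in the left copy `u`, which sees a sink and can do without a
partner. -/
theorem MateGood.hole (h : MateGood n E c mate lam) (hw : w < n) (hcw : c w = 0) (hu : u < n)
    (hcu : c u = 0) (hm : mate w = u) (hy : E u y) (hcy : c y = 2) : Hole n E c mate lam w u where
  typed := h.typed
  right := ⟨hw, hcw⟩
  left := ⟨hu, hcu⟩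
  mate_eq := hm
  inj a ha b hb _ _ := h.inj a ha b hb
  surj x hx hcx hnx := by
    obtain ⟨a, ha, hca, hma⟩ := h.surj x hx hcx hnx
    refine ⟨a, ha, ?_, hca, hma⟩
    rintro rfl
    exact hnx y (by rwa [← hma, hm]) hcy
  card := h.card

theorem MateTyped.update (h : MateTyped n E c mate) (hp : p < n) (hpw : w = p ∨ E p w)
    (hcp : c p = 0 ∨ c p = 1) : MateTyped n E c (Function.update mate w p) := by
  intro a ha hca
  rw [Function.update_apply]
  split_ifs with haw
  · subst haw
    exact ⟨hp, hpw.imp_left Eq.symm, hcp⟩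
  · exact h a ha hca

/-- Matching `w` with a source completes the augmentation. -/
theorem Hole.close (h : Hole n E c mate lam w u) (hp : p < n) (hpw : w = p ∨ E p w)
    (hcp : c p = 1) : MateGood n E c (Function.update mate w p) (lam + 1) where
  typed := h.typed.update hp hpw (.inr hcp)
  inj a ha b hb hca hcb hab hc := by
    have ha' : a ≠ w := by
      rintro rfl
      simp [hcp] at hc
    have hb' : b ≠ w := by
      rintro rfl
      rw [hab] at hc
      simp [hcp] at hc
    rw [Function.update_of_ne ha'] at hab hc
    rw [Function.update_of_ne hb'] at hab
    exact h.inj a ha b hb ha' hb' hca hcb hab hc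
  surj x hx hcx hnx := by
    obtain ⟨a, ha, haw, hca, hma⟩ := h.surj x hx hcx hnx
    exact ⟨a, ha, hca, by rwa [Function.update_of_ne haw]⟩
  card := by
    have hnot : w ∉ (Finset.range n).filter fun a => c a = 0 ∧ c (mate a) = 1 := by
      simp [h.mate_eq, h.left.2]
    rw [← h.card, ← Finset.card_insert_of_notMem hnot]
    congr 1
    ext a
    by_cases haw : a = w
    · subst haw
      simp [h.right, hcp]
    · simp [haw]

/-- Matching `w` with a free left copy `p` moves the gap to the former partner of `p`. -/
theorem Hole.move {w' : ℕ} (h : Hole n E c mate lam w u) (hp : p < n) (hpw : w = p ∨ E p w)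
    (hcp : c p = 0) (hpu : p ≠ u) (hw' : w' < n) (hcw' : c w' = 0) (hm : mate w' = p) :
    Hole n E c (Function.update mate w p) lam w' p := by
  have hne : w' ≠ w := by
    rintro rfl
    exact hpu (hm ▸ h.mate_eq)
  refine ⟨h.typed.update hp hpw (.inl hcp), ⟨hw', hcw'⟩, ⟨hp, hcp⟩,
    by rwa [Function.update_of_ne hne], fun a ha b hb haw hbw hca hcb hab hc => ?_,
    fun x hx hcx hnx => ?_, ?_⟩
  · by_cases ha' : a = w
    · by_cases hb' : b = w
      · rw [ha', hb']
      · subst ha'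
        rw [Function.update_self, Function.update_of_ne hb'] at hab
        exact absurd (h.inj w' hw' b hb hne hb' hcw' hcb (hm.trans hab) (hm ▸ hcp)).symm hbw
    · rw [Function.update_of_ne ha'] at hab hc
      by_cases hb' : b = w
      · subst hb'
        rw [Function.update_self] at hab
        exact absurd (h.inj a ha w' hw' ha' hne hca hcw' (hab.trans hm.symm) hc) haw
      · rw [Function.update_of_ne hb'] at hab
        exact h.inj a ha b hb ha' hb' hca hcb hab hc
  · obtain ⟨a, ha, haw, hca, hma⟩ := h.surj x hx hcx hnx
    by_cases haw' : a = w'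
    · refine ⟨w, h.right.1, hne.symm, h.right.2, ?_⟩
      rw [Function.update_self, ← hm, ← haw', hma]
    · exact ⟨a, ha, haw', hca, by rwa [Function.update_of_ne haw]⟩
  · rw [← h.card]
    congr 1
    ext a
    by_cases haw : a = w
    · subst haw
      simp [hcp, h.mate_eq, h.left.2]
    · simp [haw]

/-- If a source is adjacent to a sink, augmentation only keeps the matching well-typed; otherwise it
increases the number of right copies matched with sources. -/
theorem run_augment
    (hS : Searched n E (σ.arrs aStat) (σ.arrs aMate) (σ.arrs aPar) (σ.arrs aLm) (σ.regs rFound) pos)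
    (hty : MateTyped n E (σ.arrs aStat) (σ.arrs aMate)) (hf : σ.regs rFound ≠ 0) :
    Run augment σ (19 * n + 10) fun σ' => MateTyped n E (σ.arrs aStat) (σ'.arrs aMate) ∧
      ∀ lam, (∀ u < n, σ.arrs aStat u = 1 → ∀ y, E u y → σ.arrs aStat y ≠ 2) →
        MateGood n E (σ.arrs aStat) (σ.arrs aMate) lam →
        MateGood n E (σ.arrs aStat) (σ'.arrs aMate) (lam + 1) := by
  obtain ⟨hu, hlu, y, hy, hcy⟩ := hS.found_spec hf
  set c := σ.arrs aStat with hc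
  have hs1 : Run (rU ::= .reg rFound - 1) σ 4 (fun τ => τ.arrs = σ.arrs ∧
      τ.regs rU = σ.regs rFound - 1) := Run.simple rfl fun _ => by simp [RamProg.run]
  refine hs1.step (by omega) fun σ1 hF1 ⟨ha1, hu1⟩ => ?_
  rw [← hu1] at hu hlu hy
  have hcost : (1 - RamExpr.get aStat (RamExpr.reg rU) : RamExpr).cost = 4 := rfl
  -- the position in the queue decreases along the path, so that it bounds the remaining length, and
  -- the pairs that are still to be switched are intact
  refine (Run.loop (fun φ τ => τ.regs rU < n ∧ σ.arrs aLm (τ.regs rU) ≠ 0 ∧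
    φ = pos (τ.regs rU) * 19 ∧ MateTyped n E c (τ.arrs aMate) ∧
    (∀ x < n, σ.arrs aLm x ≠ 0 → c x = 0 → pos x ≤ pos (τ.regs rU) →
      τ.arrs aMate (σ.arrs aLm x - 1) = x) ∧
    ∀ lam, (∀ u < n, c u = 1 → ∀ y, E u y → c y ≠ 2) → MateGood n E c (σ.arrs aMate) lam →
      (c (τ.regs rU) = 0 → Hole n E c (τ.arrs aMate) lam (σ.arrs aLm (τ.regs rU) - 1) (τ.regs rU)) ∧
      (c (τ.regs rU) = 1 → MateGood n E c (τ.arrs aMate) (lam + 1)))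
    (by rw [hcost]; omega) ?_ (φ := pos (σ1.regs rU) * 19) ?_).mono ?_ ?_
  · rintro φ τ hF ⟨hu, hlu, hφ, hty, hlm, hgood⟩ hg
    have haL : τ.arrs aLm = σ.arrs aLm := by rw [hF.arrs aLm rfl, ha1]
    have haP : τ.arrs aPar = σ.arrs aPar := by rw [hF.arrs aPar rfl, ha1]
    have haS : τ.arrs aStat = c := by rw [hF.arrs aStat rfl, ha1]
    set u := τ.regs rU with hu'
    have hcu : c u = 0 := by
      simp [haS, ← hu'] at hg
      omega
    obtain ⟨hw, hcw, -, hpar, hpos⟩ := hS.lm_spec u hu hlu hcu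
    set w := σ.arrs aLm u - 1 with hw'
    obtain ⟨hp, hlp, hpw⟩ := hS.par_spec w hw hpar
    set p := σ.arrs aPar w - 1 with hp'
    refine ⟨15, Run.simple rfl fun _ => ?_⟩
    have hpu : p ≠ u := by
      intro h
      rw [h] at hpos
      exact lt_irrefl _ hpos
    have hmw : τ.arrs aMate w = u := hlm u hu hlu hcu le_rfl
    refine ⟨pos p * 19, ⟨?_, ?_, ?_, ?_, ?_, ?_⟩, ?_⟩
    · simpa [RamProg.run, haL, haP, ← hu', ← hw', ← hp'] using hp
    · simpa [RamProg.run, haL, haP, ← hu', ← hw', ← hp'] using hlp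
    · simp [RamProg.run, haL, haP, ← hu', ← hw', ← hp']
    · simpa [RamProg.run, haL, haP, ← hu', ← hw', ← hp'] using hty.update hp hpw (hS.left p hp hlp)
    · simp only [RamProg.run, haL, haP, ← hu', ← hw', ← hp', RamExpr.eval_reg, RamExpr.eval_sub,
        RamExpr.eval_get, RamExpr.eval_ofNat, Function.update_self, ne_eq,
        not_false_eq_true, Function.update_of_ne, Nat.reduceEqDiff]
      intro x hx hlx hcx hpx
      have h1 := hlm x hx hlx hcx (by omega)
      rw [Function.update_of_ne]
      · exact h1
      · intro h2
        rw [h2, hmw] at h1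
        rw [← h1] at hpx
        omega
    · intro lam hXY hG
      have hH := (hgood lam hXY hG).1 hcu
      simp only [RamProg.run, haL, haP, ← hu', ← hw', ← hp', RamExpr.eval_reg, RamExpr.eval_sub,
        RamExpr.eval_get, RamExpr.eval_ofNat, Function.update_self, ne_eq,
        not_false_eq_true, Function.update_of_ne, Nat.reduceEqDiff]
      refine ⟨fun hcp => ?_, fun hcp => hH.close hp hpw hcp⟩
      obtain ⟨h1, h2, -⟩ := hS.lm_spec p hp hlp hcp
      exact hH.move hp hpw hcp hpu h1 h2 (hlm p hp hlp hcp hpos.le)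
    · rw [hφ, hcost]
      omega
  · refine ⟨hu, hlu, rfl, ?_, ?_, ?_⟩
    · rw [ha1]
      exact hty
    · intro x hx hlx hcx _
      rw [ha1]
      exact (hS.lm_spec x hx hlx hcx).2.2.1
    · intro lam hXY hG
      rw [ha1]
      refine ⟨fun hcu => ?_, fun hcu => absurd hcy (hXY _ hu hcu y hy)⟩
      obtain ⟨h1, h2, h3, -⟩ := hS.lm_spec _ hu hlu hcu
      exact hG.hole h1 h2 hu hcu h3 hy hcy
  · have := hS.pos_lt _ hu hlu
    rw [hcost]
    omega
  · rintro τ hF ⟨⟨φ, hu, hlu, -, hty, -, hgood⟩, hg⟩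
    refine ⟨hty, fun lam hXY hG => (hgood lam hXY hG).2 ?_⟩
    have haS : τ.arrs aStat = c := by rw [hF.arrs aStat rfl, ha1]
    simp [haS] at hg
    have := hS.left _ hu hlu
    omega

/-- The identity encodes the empty system of paths. -/
theorem mateGood_id (h : ∀ w < n, mate w = w) : MateGood n E c mate 0 where
  typed w hw hc := by simp [h w hw, hw, hc]
  inj w hw w' hw' _ _ hww' _ := by rwa [h w hw, h w' hw'] at hww'
  surj u hu hc _ := ⟨u, hu, hc, h u hu⟩
  card := by
    rw [Finset.card_eq_zero, Finset.filter_eq_empty_iff]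
    intro w hw
    rw [h w (Finset.mem_range.1 hw)]
    omega

/-- Either the minimum cut exceeds the budget, or a maximum matching and the outcome of the last,
failed, search are in memory. -/
theorem run_flow (hE : IsGraphOn n E) (hG : HoldsGraph n E M σ)
    (hid : ∀ w < n, σ.arrs aMate w = w) :
    Run flow σ ((σ.regs rBudget + 2) * (250 * (n + M) + 250)) fun σ' =>
      (σ.regs rBudget < σ'.regs rLam ∧ LB n E (σ.arrs aStat) (σ.regs rBudget + 1)) ∨
      (σ'.regs rLam ≤ σ.regs rBudget ∧ ∃ pos,
        Searched n E (σ.arrs aStat) (σ'.arrs aMate) (σ'.arrs aPar) (σ'.arrs aLm) 0 pos ∧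
        MateGood n E (σ.arrs aStat) (σ'.arrs aMate) (σ'.regs rLam)) := by
  set c := σ.arrs aStat with hc
  set b := σ.regs rBudget with hb
  have hM0 : (b + 2) * (250 * (n + M) + 250) =
      (b + 1) * (250 * (n + M) + 250) + (250 * (n + M) + 250) := by ring
  have hs1 : Run (rLam ::= 0) σ 2 (fun τ => τ.arrs = σ.arrs ∧ τ.regs rLam = 0) :=
    Run.simple rfl fun _ => by simp [RamProg.run]
  refine hs1.step (by omega) fun σ1 hF1 ⟨ha1, hl1⟩ => ?_
  have hG1 : HoldsGraph n E M σ1 := hG.of_eq (hF1.regs 0 rfl) (by rw [ha1]) (by rw [ha1])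
  have hgood := mateGood_id (c := c) (E := E) hid
  refine (run_search hE hG1 (by rw [ha1]; exact hgood.typed)).step (by omega)
    fun σ2 hF2 ⟨pos2, hS2⟩ => ?_
  have hG2 : HoldsGraph n E M σ2 :=
    hG1.of_eq (hF2.regs 0 rfl) (hF2.arrs aOff rfl) (hF2.arrs aTgt rfl)
  have hm2 : σ2.arrs aMate = σ.arrs aMate := by rw [hF2.arrs aMate rfl, ha1]
  have hc2 : σ2.arrs aStat = c := by rw [hF2.arrs aStat rfl, ha1]
  have hb2 : σ2.regs rBudget = b := by rw [hF2.regs rBudget rfl, hF1.regs rBudget rfl]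
  have hcost : (.reg rFound - (.reg rFound - (.reg rBudget + 1 - .reg rLam)) : RamExpr).cost = 9 :=
    rfl
  refine (Run.loop (fun φ τ => τ.regs rLam ≤ b + 1 ∧
    φ = (b + 1 - τ.regs rLam) * (250 * (n + M) + 250) ∧
    MateTyped n E c (τ.arrs aMate) ∧
    (∃ pos, Searched n E c (τ.arrs aMate) (τ.arrs aPar) (τ.arrs aLm) (τ.regs rFound) pos) ∧
    ((∀ u < n, c u = 1 → ∀ y, E u y → c y ≠ 2) →
      MateGood n E c (τ.arrs aMate) (τ.regs rLam))) (by rw [hcost]; omega) ?_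
    (φ := (b + 1) * (250 * (n + M) + 250)) ?_).mono ?_ ?_
  · rintro φ τ hF ⟨hl, hφ, hty, ⟨pos, hS⟩, hgood⟩ hg
    have hcτ : τ.arrs aStat = c := by rw [hF.arrs aStat rfl, hc2]
    have hbτ : τ.regs rBudget = b := by rw [hF.regs rBudget rfl, hb2]
    simp only [RamExpr.eval_sub, RamExpr.eval_add, RamExpr.eval_reg, hbτ, RamExpr.eval_ofNat] at hg
    refine ⟨19 * n + 10 + (4 + (200 * (n + M) + 200)),
      (run_augment (n := n) (E := E) (pos := pos) (by rw [hcτ]; exact hS) (by rw [hcτ]; exact hty)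
      (by omega)).seq fun τ1 hF1 ⟨hty1, hgood1⟩ => ?_⟩
    rw [hcτ] at hty1 hgood1
    have hs : Run (rLam ::= .reg rLam + 1) τ1 4 (fun τ' => τ'.arrs = τ1.arrs ∧
        τ'.regs rLam = τ.regs rLam + 1) :=
      Run.simple rfl fun _ => by simp [RamProg.run, hF1.regs rLam rfl]
    refine hs.seq fun τ2 hF2 ⟨ha2, hl2⟩ => ?_
    have hGτ : HoldsGraph n E M τ2 := hG2.of_eq
      (by rw [hF2.regs 0 rfl, hF1.regs 0 rfl, hF.regs 0 rfl])
      (by rw [ha2, hF1.arrs aOff rfl, hF.arrs aOff rfl])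
      (by rw [ha2, hF1.arrs aTgt rfl, hF.arrs aTgt rfl])
    have hcτ2 : τ2.arrs aStat = c := by rw [ha2, hF1.arrs aStat rfl, hcτ]
    refine (run_search hE hGτ (by rw [hcτ2, ha2]; exact hty1)).mono le_rfl ?_
    rintro τ3 hF3 ⟨pos3, hS3⟩
    rw [hcτ2] at hS3
    have hm3 : τ3.arrs aMate = τ1.arrs aMate := by rw [hF3.arrs aMate rfl, ha2]
    have hl3 : τ3.regs rLam = τ.regs rLam + 1 := by rw [hF3.regs rLam rfl, hl2]
    refine ⟨_, ⟨by omega, rfl, by rw [hm3]; exact hty1, ⟨pos3, ?_⟩, fun hXY => ?_⟩, ?_⟩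
    · rw [hm3, ← ha2]
      exact hS3
    · rw [hm3, hl3]
      exact hgood1 _ hXY (hgood hXY)
    · obtain ⟨d, hd⟩ : ∃ d, b + 1 - τ.regs rLam = d + 1 :=
        ⟨_, (Nat.sub_add_cancel (by omega)).symm⟩
      rw [hφ, hcost, hl3, hd, show b + 1 - (τ.regs rLam + 1) = d by omega, Nat.succ_mul d]
      omega
  · have hl2 : σ2.regs rLam = 0 := by rw [hF2.regs rLam rfl, hl1]
    rw [hm2, hl2]
    rw [ha1] at hS2
    exact ⟨by omega, rfl, hgood.typed, ⟨pos2, hS2⟩, fun _ => hgood⟩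
  · rw [hcost]
    omega
  · rintro τ hF ⟨⟨φ, hl, -, hty, ⟨pos, hS⟩, hgood⟩, hg⟩
    have hbτ : τ.regs rBudget = b := by rw [hF.regs rBudget rfl, hb2]
    simp only [RamExpr.eval_sub, RamExpr.eval_add, RamExpr.eval_reg, hbτ, RamExpr.eval_ofNat] at hg
    rcases Nat.lt_or_ge b (τ.regs rLam) with h | h
    · -- a source adjacent to a sink rules out valid sets altogether
      refine .inl ⟨h, fun D hD => ?_⟩
      rw [show b + 1 = τ.regs rLam by omega]
      exact (hgood fun u hu hcu y hy => hD.sink u (hD.source u hu hcu) y hy).lb D hD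
    · have h0 : τ.regs rFound = 0 := by omega
      rw [h0] at hS
      refine .inr ⟨h, pos, hS, hgood fun u hu hcu y hy => ?_⟩
      exact (hS.valid hE rfl).sink u (mem_reached.2 ⟨hu, hS.source u hu hcu⟩) y hy

end

/-! ### Minimalization and the list of separators found so far -/

/-- Replace the set of vertices of status `3` by the boundary of the component of `rRoot` in its
complement. -/
def shrink : RamProg :=
  forN rV (.cond (.get aStat (.reg rV) - 2) .skip (.store aStat (.reg rV) 0) ;;
    .store aMate (.reg rV) (.reg rV)) ;;
  .store aStat (.reg rRoot) 1 ;;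
  search ;;
  forN rV (.cond (.get aStat (.reg rV) - 2)
    (.cond (.get aPar (.reg rV)) .skip (.store aStat (.reg rV) 0))
    (.store aStat (.reg rV) 0))

/-- Append the vertices of status `3` to the list of separators, unless they are there already. -/
def record : RamProg :=
  rKey ::= 0 ;;
  forN rV (.cond (.get aStat (.reg rV)) (rKey ::= .reg rKey + .get aPow (.reg rV)) .skip) ;;
  .cond (.get aDict (.reg rKey)) .skip (
    .store aDict (.reg rKey) 1 ;;
    forN rV (.store aFound (.reg rOut + .reg rV) (.get aStat (.reg rV))) ;;
    rOut ::= .reg rOut + .reg 0)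

/-- Turn the vertices of status `3` into a minimal separator and record it. -/
def leaf : RamProg :=
  rRoot ::= .reg 2 ;; shrink ;; rRoot ::= .reg 1 ;; shrink ;; record

/-- The index of a vertex set in the dictionary. -/
def key (S : Finset ℕ) : ℕ := ∑ v ∈ S, 2 ^ v

/-- The memory holds the list `F` of distinct minimal separators of size at most `k`: the rows of
one array are their characteristic vectors, and a dictionary marks their keys. -/
structure Listed (n : ℕ) (E : ℕ → ℕ → Prop) (s t k : ℕ) (σ : RamState) (F : List (Finset ℕ)) :
    Prop where
  out : σ.regs rOut = n * F.length
  row : ∀ i S, F[i]? = some S → ∀ v < n, σ.arrs aFound (n * i + v) = if v ∈ S then 3 else 0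
  dict : ∀ S ⊆ Finset.range n, σ.arrs aDict (key S) ≠ 0 ↔ S ∈ F
  nodup : F.Nodup
  good : ∀ S ∈ F, MinSep n E s t S ∧ S.card ≤ k

/-- The part of the memory that is constant in the course of the main computation: the input and a
table of powers of two. -/
structure Setup (n : ℕ) (E : ℕ → ℕ → Prop) (M s t k : ℕ) (σ : RamState) : Prop where
  graph : HoldsGraph n E M σ
  left : σ.regs 1 = s
  right : σ.regs 2 = t
  bound : σ.regs 3 = k
  pow : ∀ v < n, σ.arrs aPow v = 2 ^ v

section

variable {n M : ℕ} {E : ℕ → ℕ → Prop} {σ σ' : RamState} {s t k r : ℕ} {F : List (Finset ℕ)}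

theorem Listed.of_eq (h : Listed n E s t k σ F) (h1 : σ'.regs rOut = σ.regs rOut)
    (h2 : σ'.arrs aFound = σ.arrs aFound) (h3 : σ'.arrs aDict = σ.arrs aDict) :
    Listed n E s t k σ' F :=
  ⟨h1.trans h.out, by rw [h2]; exact h.row, by rw [h3]; exact h.dict, h.nodup, h.good⟩

theorem Setup.frame {p : RamProg} (h : Setup n E M s t k σ) (hF : Frame p σ σ')
    (hp : p.modR 0 = false ∧ p.modR 1 = false ∧ p.modR 2 = false ∧ p.modR 3 = false ∧
      p.modA aOff = false ∧ p.modA aTgt = false ∧ p.modA aPow = false) : Setup n E M s t k σ' :=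
  ⟨h.graph.of_eq (hF.regs _ hp.1) (hF.arrs _ hp.2.2.2.2.1) (hF.arrs _ hp.2.2.2.2.2.1),
    (hF.regs _ hp.2.1).trans h.left, (hF.regs _ hp.2.2.1).trans h.right,
    (hF.regs _ hp.2.2.2.1).trans h.bound, by rw [hF.arrs _ hp.2.2.2.2.2.2]; exact h.pow⟩

theorem key_injective : Function.Injective key := Finset.geomSum_injective le_rfl

/-- With only one source and the identity as matching, the search reaches exactly the component of
the source. -/
theorem run_shrink (hE : IsGraphOn n E) (hG : HoldsGraph n E M σ) (hr : σ.regs rRoot < n)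
    (hr3 : σ.regs rRoot ∉ chosen n (σ.arrs aStat)) (hle : ∀ v < n, σ.arrs aStat v ≤ 3) :
    Run shrink σ (250 * (n + M) + 250) fun σ' =>
      (∀ v < n, σ'.arrs aStat v = if v ∈ nb n E (reach n E (chosen n (σ.arrs aStat)) (σ.regs rRoot))
        then 3 else 0) ∧
      ∀ v < n, (σ'.arrs aLm v ≠ 0 ↔ v ∈ reach n E (chosen n (σ.arrs aStat)) (σ.regs rRoot)) := by
  set Z := chosen n (σ.arrs aStat) with hZ
  set r := σ.regs rRoot with hrr
  have hn : σ.regs 0 = n := hG.size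
  have hZmem : ∀ v < n, (v ∈ Z ↔ σ.arrs aStat v = 3) := fun v hv => by simp [hZ, mem_chosen, hv]
  refine (run_forN (by decide) rfl rfl
    (fun j τ => (∀ v < n, τ.arrs aStat v = if v < j then (if v ∈ Z then 3 else 0)
      else σ.arrs aStat v) ∧ ∀ v < j, τ.arrs aMate v = v) 11 (by simp) ?_).step
    (by rw [hn]; omega) fun σ1 hF1 ⟨hs1, hm1⟩ => ?_
  · rintro v hv τ hF hv1 ⟨hs, hm⟩
    rw [hn] at hv
    have h1 : τ.arrs aStat v = σ.arrs aStat v := by simpa using hs v hv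
    have h2 := hle v hv
    refine Run.simple rfl fun _ => ⟨fun x hx => ?_, fun x hx => ?_⟩
    · by_cases h3 : σ.arrs aStat v = 3
      · have h4 : v ∈ Z := (hZmem v hv).2 h3
        simp [RamProg.run, hv1, h1, h3, hs x hx]
        by_cases hxv : x = v
        · subst hxv
          simp [h4, h3]
        · exact if_congr (by omega) rfl rfl
      · have h4 : v ∉ Z := fun h => h3 ((hZmem v hv).1 h)
        have h5 : σ.arrs aStat v - 2 = 0 := by omega
        by_cases hxv : x = v
        · subst hxv
          simp [RamProg.run, hv1, h1, h5, h4]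
        · simp [RamProg.run, hv1, h1, h5, hs x hx, hxv]
          exact if_congr (by omega) rfl rfl
    · by_cases h5 : σ.arrs aStat v - 2 = 0
      all_goals
        by_cases hxv : x = v
        · simp [RamProg.run, hv1, h1, h5, hxv]
        · simp [RamProg.run, hv1, h1, h5, hxv, hm x (by omega)]
  rw [hn] at hs1 hm1 ⊢
  have hr1 : σ1.regs rRoot = r := hF1.regs rRoot rfl
  have hn1 : σ1.regs 0 = n := (hF1.regs 0 rfl).trans hn
  have hs2 : Run (.store aStat (.reg rRoot) 1) σ1 3 (fun τ => τ.regs = σ1.regs ∧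
      τ.arrs aMate = σ1.arrs aMate ∧
      ∀ v < n, τ.arrs aStat v = if v = r then 1 else if v ∈ Z then 3 else 0) := by
    refine Run.simple rfl fun _ => ⟨rfl, by simp [RamProg.run], fun v hv => ?_⟩
    simp only [RamProg.run, RamExpr.eval_reg, hr1, RamExpr.eval_ofNat, Function.update_self,
      Function.update_apply, hs1 v hv, if_pos hv]
  refine hs2.step (by omega) fun σ2 hF2 ⟨hr2, hm2, hc2⟩ => ?_
  have hG2 : HoldsGraph n E M σ2 := hG.of_eq (by rw [hF2.regs 0 rfl, hF1.regs 0 rfl])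
    (by rw [hF2.arrs aOff rfl, hF1.arrs aOff rfl]) (by rw [hF2.arrs aTgt rfl, hF1.arrs aTgt rfl])
  have hid : ∀ v < n, σ2.arrs aMate v = v := fun v hv => by rw [hm2]; exact hm1 v hv
  refine (run_search hE hG2 (mateGood_id hid).typed).step (by omega)
    fun σ3 hF3 ⟨pos, hS⟩ => ?_
  have hc3 : σ3.arrs aStat = σ2.arrs aStat := hF3.arrs aStat rfl
  set c := σ2.arrs aStat with hc
  have hc1 : ∀ v < n, c v = 1 ↔ v = r := fun v hv => by
    rw [hc2 v hv]
    split_ifs <;> simp_all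
  have hc0 : ∀ v < n, c v = 0 ↔ v ≠ r ∧ v ∉ Z := fun v hv => by
    rw [hc2 v hv]
    split_ifs <;> simp_all
  have hL : ∀ v < n, σ3.arrs aLm v ≠ 0 ↔ v ∈ reach n E Z r := by
    intro v hv
    constructor
    · revert v
      refine hS.least (fun x hx h1 => ?_) fun u hu hur w hw huw hcw => ?_
      · rw [(hc1 x hx).1 h1]
        exact self_mem_reach hr
      · rw [hid w hw]
        rcases huw with rfl | huw
        · exact hur
        · exact reach_step hE hur huw ((hc0 w hw).1 hcw).2
    · intro hvr
      refine reach_induction (P := fun v => σ3.arrs aLm v ≠ 0)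
        (hS.source r hr ((hc1 r hr).2 rfl)) ?_ hE hr v hvr
      intro u hu hlu w hw huw hwZ
      by_cases hwr : w = r
      · rw [hwr]
        exact hS.source r hr ((hc1 r hr).2 rfl)
      · have := hS.back w hw (hS.expand u (mem_reach.1 hu).1 hlu w hw (.inr huw))
          ((hc0 w hw).2 ⟨hwr, hwZ⟩)
        rwa [hid w hw] at this
  have hP : ∀ v < n, v ∈ Z → (σ3.arrs aPar v ≠ 0 ↔ v ∈ nb n E (reach n E Z r)) := by
    intro v hv hvZ
    have hvn : v ∉ reach n E Z r := fun h => not_mem_of_mem_reach hr3 h hvZ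
    constructor
    · intro hp
      obtain ⟨h1, h2, h3⟩ := hS.par_spec v hv hp
      have h4 := (hL _ h1).1 h2
      refine mem_nb.2 ⟨hv, hvn, _, h4, h3.resolve_left fun h => hvn (h ▸ h4)⟩
    · intro h
      obtain ⟨-, -, u, hu, huv⟩ := mem_nb.1 h
      have hun := (mem_reach.1 hu).1
      exact hS.expand u hun ((hL u hun).2 hu) v hv (.inr huv)
  have hn3 : σ3.regs 0 = n := by rw [hF3.regs 0 rfl, hr2, hn1]
  refine (run_forN (by decide) rfl rfl
    (fun j τ => ∀ v < n, τ.arrs aStat v = if v < j then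
      (if v ∈ nb n E (reach n E Z r) then 3 else 0) else c v) 13 (by simp [hc3]) ?_).mono
    (by rw [hn3]; omega) ?_
  · intro v hv τ hF hv1 hI
    rw [hn3] at hv
    have h1 : τ.arrs aStat v = c v := by simpa using hI v hv
    have h2 : τ.arrs aPar v = σ3.arrs aPar v := by rw [hF.arrs aPar rfl]
    have hrest : ∀ x < n, x ≠ v → τ.arrs aStat x = if x < v + 1 then
        (if x ∈ nb n E (reach n E Z r) then 3 else 0) else c x := by
      intro x hx hxv
      rw [hI x hx]
      exact if_congr (by omega) rfl rfl
    have hnbZ : v ∈ nb n E (reach n E Z r) → v ∈ Z := fun h => nb_reach_subset hE h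
    refine Run.simple rfl fun _ x hx => ?_
    by_cases hvZ : v ∈ Z
    · have hc3 : c v = 3 := by
        rw [hc2 v hv, if_neg (by rintro rfl; exact hr3 hvZ), if_pos hvZ]
      by_cases hvp : σ3.arrs aPar v = 0
      · have h4 : v ∉ nb n E (reach n E Z r) := fun h => (hP v hv hvZ).2 h hvp
        by_cases hxv : x = v
        · subst hxv
          simp [RamProg.run, hv1, h1, h2, hc3, hvp, h4]
        · simpa [RamProg.run, hv1, h1, h2, hc3, hvp, hxv] using hrest x hx hxv
      · have h4 := (hP v hv hvZ).1 hvp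
        by_cases hxv : x = v
        · subst hxv
          simp [RamProg.run, hv1, h1, h2, hc3, hvp, h4]
        · simpa [RamProg.run, hv1, h1, h2, hc3, hvp, hxv] using hrest x hx hxv
    · have h3 : c v - 2 = 0 := by
        rw [hc2 v hv, if_neg hvZ]
        split_ifs <;> rfl
      have h4 := mt hnbZ hvZ
      by_cases hxv : x = v
      · subst hxv
        simp [RamProg.run, hv1, h1, h3, h4]
      · simpa [RamProg.run, hv1, h1, h3, hxv] using hrest x hx hxv
  · intro τ hF hI
    rw [hn3] at hI
    refine ⟨fun v hv => by simpa [hv] using hI v hv, fun v hv => ?_⟩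
    rw [hF.arrs aLm rfl]
    exact hL v hv

theorem run_record (hU : Setup n E M s t k σ) (hL : Listed n E s t k σ F) {S : Finset ℕ}
    (hS : ∀ v < n, σ.arrs aStat v = if v ∈ S then 3 else 0) (hm : MinSep n E s t S)
    (hk : S.card ≤ k) :
    Run record σ (40 * n + 40) fun σ' => ∃ F', Listed n E s t k σ' (F ++ F') ∧
      ∀ S', S' ∈ F ++ F' ↔ S' ∈ F ∨ S' = S := by
  have hn : σ.regs 0 = n := hU.graph.size
  have hs1 : Run (rKey ::= 0) σ 2 (fun τ => τ.arrs = σ.arrs ∧ τ.regs rKey = 0) :=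
    Run.simple rfl fun _ => by simp [RamProg.run]
  refine hs1.step (by omega) fun σ1 hF1 ⟨ha1, hk1⟩ => ?_
  have hn1 : σ1.regs 0 = n := (hF1.regs 0 rfl).trans hn
  refine (run_forN (by decide) rfl rfl
    (fun j τ => τ.regs rKey = ∑ v ∈ Finset.range j, if v ∈ S then 2 ^ v else 0) 8
    (by simp [hk1]) ?_).step (by rw [hn1]; omega) fun σ2 hF2 h2 => ?_
  · intro v hv τ hF hv1 hI
    rw [hn1] at hv
    have h1 : τ.arrs aStat v = if v ∈ S then 3 else 0 := by
      rw [hF.arrs aStat rfl, ha1, hS v hv]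
    have h2 : τ.arrs aPow v = 2 ^ v := by rw [hF.arrs aPow rfl, ha1, hU.pow v hv]
    refine Run.simple rfl fun _ => ?_
    rw [Finset.sum_range_succ, ← hI]
    by_cases hvS : v ∈ S
    · simp [RamProg.run, hv1, h1, h2, hvS]
    · simp [RamProg.run, hv1, h1, hvS]
  have hSn := hm.subset_range
  have hkey : σ2.regs rKey = key S := by
    rw [h2, hn1, Finset.sum_ite_mem, Finset.inter_eq_right.2 hSn]
    rfl
  have hF12 : ∀ a, σ2.arrs a = σ.arrs a := fun a => by rw [hF2.arrs a rfl, ha1]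
  have hout2 : σ2.regs rOut = σ.regs rOut := by rw [hF2.regs rOut rfl, hF1.regs rOut rfl]
  have hL2 : Listed n E s t k σ2 F := hL.of_eq hout2 (hF12 _) (hF12 _)
  rw [hn1]
  refine (Run.cond (N := 25 * n + 20) (fun h => ?_) (fun h => ?_)).mono
    (by simp; omega) fun _ _ h => h
  · have hmem : S ∈ F := (hL2.dict S hSn).1 (by simpa [hkey] using h)
    refine (Run.of_simple .skip rfl σ2).mono (by simp [RamProg.bound]) ?_
    rintro σ' - rfl
    refine ⟨[], by simpa [RamProg.run] using hL2, fun S' => ?_⟩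
    simp only [List.append_nil]
    refine ⟨.inl, ?_⟩
    rintro (h | rfl)
    · exact h
    · exact hmem
  · have hmem : S ∉ F := fun hc => (hL2.dict S hSn).2 hc (by simpa [hkey] using h)
    have hs3 : Run (.store aDict (.reg rKey) 1) σ2 3 (fun τ => τ.regs = σ2.regs ∧
        τ.arrs = Function.update σ2.arrs aDict (Function.update (σ2.arrs aDict) (key S) 1)) :=
      Run.simple rfl fun _ => by simp [RamProg.run, hkey]
    refine hs3.step (by omega) fun σ3 hF3 ⟨hr3, ha3⟩ => ?_
    have hn3 : σ3.regs 0 = n := by rw [hr3, hF2.regs 0 rfl, hn1]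
    have hrow3 : ∀ i, σ3.arrs aFound i = σ2.arrs aFound i := fun i => by rw [ha3]; simp
    refine (run_forN (by decide) rfl rfl
      (fun j τ => (∀ i < n * F.length, τ.arrs aFound i = σ2.arrs aFound i) ∧
        ∀ v < j, τ.arrs aFound (n * F.length + v) = if v ∈ S then 3 else 0) 6
      (by simp [hrow3]) ?_).step (by rw [hn3]; omega) fun σ4 hF4 ⟨h4, h4'⟩ => ?_
    · rintro v hv τ hF hv1 ⟨h5, h6⟩
      rw [hn3] at hv
      have h7 : τ.regs rOut = n * F.length := by rw [hF.regs rOut rfl, hr3, hL2.out]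
      have h8 : τ.arrs aStat v = if v ∈ S then 3 else 0 := by
        rw [hF.arrs aStat rfl, hF3.arrs aStat rfl, hF12, hS v hv]
      refine Run.simple rfl fun _ => ⟨fun i hi => ?_, fun x hx => ?_⟩
      · simp only [RamProg.run, RamExpr.eval_add, RamExpr.eval_reg, hv1, h7, Function.update_self]
        rw [Function.update_of_ne (by omega)]
        exact h5 i hi
      · simp only [RamProg.run, RamExpr.eval_add, RamExpr.eval_reg, hv1, h7, Function.update_self,
          RamExpr.eval_get, h8]
        by_cases hxv : x = v
        · subst hxv
          simp
        · rw [Function.update_of_ne (by omega)]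
          exact h6 x (by omega)
    rw [hn3] at h4' ⊢
    have hout4 : σ4.regs rOut = n * F.length := by rw [hF4.regs rOut rfl, hr3, hL2.out]
    have hn4 : σ4.regs 0 = n := by rw [hF4.regs 0 rfl, hn3]
    refine (Run.of_simple (rOut ::= .reg rOut + .reg 0) rfl σ4).mono ?_ ?_
    · change 4 ≤ _
      omega
    rintro σ' - rfl
    refine ⟨[S], ⟨?_, fun i S' hi v hv => ?_, fun S' hS' => ?_, ?_, ?_⟩, by simp⟩
    · simp [RamProg.run, hout4, hn4, Nat.mul_add]
    · change σ4.arrs aFound (n * i + v) = _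
      rcases Nat.lt_or_ge i F.length with hlt | hge
      · rw [List.getElem?_append_left hlt] at hi
        rw [h4, hL2.row i S' hi v hv]
        calc n * i + v < n * i + n := by omega
          _ = n * (i + 1) := by ring
          _ ≤ n * F.length := Nat.mul_le_mul_left _ hlt
      · have hlen : i < (F ++ [S]).length := (List.getElem?_eq_some_iff.1 hi).1
        have hieq : i = F.length := by
          simp at hlen
          omega
        subst hieq
        simp at hi
        subst hi
        exact h4' v hv
    · change σ4.arrs aDict (key S') ≠ 0 ↔ _
      rw [hF4.arrs aDict rfl, ha3, Function.update_self]
      by_cases hSS : S' = S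
      · subst hSS
        simp
      · rw [Function.update_of_ne (fun h => hSS (key_injective h)), hL2.dict S' hS']
        simp [hSS]
    · exact List.nodup_append.2 ⟨hL.nodup, by simp, by
        intro a ha b hb
        rw [List.mem_singleton.1 hb]
        rintro rfl
        exact hmem ha⟩
    · intro S' hS'
      rcases List.mem_append.1 hS' with h | h
      · exact hL.good S' h
      · rw [List.mem_singleton.1 h]
        exact ⟨hm, hk⟩

/-- The minimal separator that is recorded for the separating set `Z`. -/
noncomputable def shrunk (n : ℕ) (E : ℕ → ℕ → Prop) (s t : ℕ) (Z : Finset ℕ) : Finset ℕ :=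
  nb n E (reach n E (nb n E (reach n E Z t)) s)

theorem MinSep.shrunk_eq (hE : IsGraphOn n E) {S : Finset ℕ} (h : MinSep n E s t S) :
    shrunk n E s t S = S := by
  rw [shrunk, h.nb_right hE, h.nb_left hE]

theorem chosen_eq_of_ite {c : ℕ → ℕ} {S : Finset ℕ} (hS : S ⊆ Finset.range n)
    (h : ∀ v < n, c v = if v ∈ S then 3 else 0) : chosen n c = S := by
  ext v
  rw [mem_chosen]
  constructor
  · rintro ⟨hv, hc⟩
    rw [h v hv] at hc
    by_contra hvS
    simp [hvS] at hc
  · intro hv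
    have hvn := Finset.mem_range.1 (hS hv)
    exact ⟨hvn, by rw [h v hvn, if_pos hv]⟩

theorem run_leaf (hE : IsGraphOn n E) (hs : s < n) (ht : t < n) (hU : Setup n E M s t k σ)
    (hL : Listed n E s t k σ F) (hc : ItemOK n s t k (σ.arrs aStat))
    (hst : t ∉ reach n E (chosen n (σ.arrs aStat)) s) :
    Run leaf σ (600 * (n + M) + 600) fun σ' => ∃ F', Listed n E s t k σ' (F ++ F') ∧
      ∀ S', S' ∈ F ++ F' ↔ S' ∈ F ∨ S' = shrunk n E s t (chosen n (σ.arrs aStat)) := by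
  set Z := chosen n (σ.arrs aStat) with hZ
  have hsZ : s ∉ Z := fun h => by
    have := (mem_chosen.1 h).2
    have := hc.left
    omega
  have htZ : t ∉ Z := fun h => by
    have := (mem_chosen.1 h).2
    have := hc.right
    omega
  obtain ⟨hmin, hsub, -, -⟩ := minSep_shrink hE hs ht hsZ htZ hst
  have hs1 : Run (rRoot ::= .reg 2) σ 2 (fun τ => τ.arrs = σ.arrs ∧ τ.regs rRoot = t) :=
    Run.simple rfl fun _ => by simp [RamProg.run, hU.right]
  refine hs1.step (by omega) fun σ1 hF1 ⟨ha1, hr1⟩ => ?_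
  have hU1 : Setup n E M s t k σ1 := hU.frame hF1 (by decide)
  refine (run_shrink hE hU1.graph (by rw [hr1]; exact ht) (by rw [hr1, ha1]; exact htZ)
    (by rw [ha1]; exact hc.le_three)).step (by omega) fun σ2 hF2 ⟨h2, _⟩ => ?_
  have hU2 : Setup n E M s t k σ2 := hU1.frame hF2 (by decide)
  rw [hr1, ha1] at h2
  have hch2 : chosen n (σ2.arrs aStat) = nb n E (reach n E Z t) :=
    chosen_eq_of_ite (fun v hv => Finset.mem_range.2 (mem_nb.1 hv).1) h2
  have hs3 : Run (rRoot ::= .reg 1) σ2 2 (fun τ => τ.arrs = σ2.arrs ∧ τ.regs rRoot = s) :=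
    Run.simple rfl fun _ => by simp [RamProg.run, hU2.left]
  refine hs3.step (by omega) fun σ3 hF3 ⟨ha3, hr3⟩ => ?_
  have hU3 : Setup n E M s t k σ3 := hU2.frame hF3 (by decide)
  refine (run_shrink hE hU3.graph (by rw [hr3]; exact hs) ?_ ?_).step (by omega)
    fun σ4 hF4 ⟨h4, _⟩ => ?_
  · rw [hr3, ha3, hch2]
    exact fun h => hsZ (nb_reach_subset hE h)
  · intro v hv
    rw [ha3, h2 v hv]
    split_ifs <;> omega
  have hU4 : Setup n E M s t k σ4 := hU3.frame hF4 (by decide)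
  rw [hr3, ha3, hch2] at h4
  refine (run_record hU4 (hL.of_eq ?_ ?_ ?_) h4 hmin
    ((Finset.card_le_card hsub).trans hc.card_chosen)).mono (by omega) fun σ' _ h => h
  · rw [hF4.regs rOut rfl, hF3.regs rOut rfl, hF2.regs rOut rfl, hF1.regs rOut rfl]
  · rw [hF4.arrs aFound rfl, ha3, hF2.arrs aFound rfl, ha1]
  · rw [hF4.arrs aDict rfl, ha3, hF2.arrs aDict rfl, ha1]

end

/-! ### The branching algorithm -/

/-- Push the current statuses onto the stack. -/
def pushItem : RamProg :=
  forN rI (.store aStack (.reg rTop + .reg rI) (.get aStat (.reg rI))) ;;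
  rTop ::= .reg rTop + .reg 0

/-- Choose a vertex of the cut found by the last search, that is, a free vertex whose right copy was
reached and whose left copy was not, and push the two resulting items. -/
def branch : RamProg :=
  forN rV (.cond (.get aStat (.reg rV)) .skip
    (.cond (.get aPar (.reg rV)) (.cond (.get aLm (.reg rV)) .skip (rPick ::= .reg rV)) .skip)) ;;
  .store aStat (.reg rPick) 2 ;; pushItem ;; .store aStat (.reg rPick) 3 ;; pushItem

/-- Take an item from the stack, compute its minimum cut, and drop it, branch, or record the
separator that has been completed. -/
def process : RamProg :=
  (rTop ::= .reg rTop - .reg 0 ;; rCount ::= 0) ;;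
  forN rV (.store aStat (.reg rV) (.get aStack (.reg rTop + .reg rV)) ;;
    .store aMate (.reg rV) (.reg rV) ;;
    .cond (.get aStat (.reg rV) - 2) (rCount ::= .reg rCount + 1) .skip) ;;
  rBudget ::= .reg 3 - .reg rCount ;;
  flow ;;
  .cond (.reg rBudget + 1 - .reg rLam) (.cond (.reg rLam) branch leaf) .skip

/-- Process items until the stack is empty. -/
def processAll : RamProg := .loop (.reg rTop) process

/-- `a` bounds the number of items that descend from an item with statuses `c`, itself included:
with `b` vertices still to be chosen and a minimum cut of at least `lam` it is
`2 ^ (2 * b + 2 - lam) - 1`, since in both branches `2 * b - lam` drops. For `lam = b + 1` the item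
is dropped, so larger bounds are not needed. -/
def Weight (n : ℕ) (E : ℕ → ℕ → Prop) (k : ℕ) (c : ℕ → ℕ) (a : ℕ) : Prop :=
  ∃ lam, LB n E c lam ∧ lam ≤ k - (chosen n c).card + 1 ∧
    a + 1 = 2 ^ (2 * (k - (chosen n c).card) + 2 - lam)

/-- The rows of the array `arr` hold a stack of well-formed items of total weight `φ`, the top of
the stack being the head of the list. -/
def StackRep (n : ℕ) (E : ℕ → ℕ → Prop) (s t k : ℕ) (arr : ℕ → ℕ) : List (ℕ → ℕ) → ℕ → Prop
  | [], φ => φ = 0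
  | c :: l, φ => (∀ v < n, arr (n * l.length + v) = c v) ∧ ItemOK n s t k c ∧
      ∃ a b, Weight n E k c a ∧ StackRep n E s t k arr l b ∧ φ = a + b

/-- The state between two rounds of the branching algorithm. -/
structure Branching (n : ℕ) (E : ℕ → ℕ → Prop) (M s t k : ℕ) (items : List (ℕ → ℕ))
    (F : List (Finset ℕ)) (φ : ℕ) (σ : RamState) : Prop where
  setup : Setup n E M s t k σ
  top : σ.regs rTop = n * items.length
  stack : StackRep n E s t k (σ.arrs aStack) items φ
  listed : Listed n E s t k σ F

section

variable {n M : ℕ} {E : ℕ → ℕ → Prop} {σ σ' : RamState} {s t k φ : ℕ} {F : List (Finset ℕ)}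
  {c c' : ℕ → ℕ} {l : List (ℕ → ℕ)} {arr arr' : ℕ → ℕ}

theorem chosen_congr (h : ∀ v < n, c v = c' v) : chosen n c = chosen n c' := by
  ext v
  simp only [mem_chosen]
  exact and_congr_right fun hv => by rw [h v hv]

theorem ItemOK.congr (hs : s < n) (ht : t < n) (h : ∀ v < n, c v = c' v)
    (hc : ItemOK n s t k c) : ItemOK n s t k c' :=
  ⟨fun v hv => h v hv ▸ hc.le_three v hv, h s hs ▸ hc.left, h t ht ▸ hc.right,
    chosen_congr h ▸ hc.card_chosen⟩

theorem LB.congr (hE : IsGraphOn n E) {lam : ℕ} (h : ∀ v < n, c v = c' v) (hc : LB n E c lam) :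
    LB n E c' lam := by
  intro D hD
  have hV : Valid n E c D := ⟨hD.lt, fun v hv => by rw [h v (hD.lt v hv)]; exact hD.status v hv,
    fun v hv h1 => hD.source v hv (h v hv ▸ h1),
    fun u hu w huw h2 => hD.sink u hu w huw (h w (hE.right_lt huw) ▸ h2)⟩
  have : cut n E c D = cut n E c' D := by
    ext w
    simp only [mem_cut]
    exact and_congr_right fun hw => by rw [h w hw.1]
  exact this ▸ hc D hV

theorem Target.congr {S : Finset ℕ} (h : ∀ v < n, c v = c' v) (hT : Target n E s t k c S) :
    Target n E s t k c' S :=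
  ⟨hT.minSep, hT.card_le, fun v hv h1 => hT.source v hv ((h v hv).trans h1),
    fun v hv h1 => hT.sink v hv ((h v hv).trans h1),
    fun v hv h1 => hT.chosen v hv ((h v hv).trans h1),
    fun D hD h1 => hT.closest D hD fun v hv h2 => h1 v hv ((h v hv).symm.trans h2)⟩

theorem StackRep.of_eq (h : StackRep n E s t k arr l φ)
    (heq : ∀ i < n * l.length, arr' i = arr i) : StackRep n E s t k arr' l φ := by
  induction l generalizing φ with
  | nil => exact h
  | cons c l ih =>
    obtain ⟨h1, h2, a, b, h3, h4, h5⟩ := h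
    simp only [List.length_cons, Nat.mul_add, mul_one] at heq
    refine ⟨fun v hv => ?_, h2, a, b, h3, ih h4 fun i hi => heq i (by omega), h5⟩
    rw [heq _ (by omega)]
    exact h1 v hv

theorem run_pushItem (hn : σ.regs 0 = n) {len : ℕ} (htop : σ.regs rTop = n * len) :
    Run pushItem σ (13 * n + 9) fun σ' => σ'.regs rTop = n * (len + 1) ∧
      (∀ i < n * len, σ'.arrs aStack i = σ.arrs aStack i) ∧
      ∀ v < n, σ'.arrs aStack (n * len + v) = σ.arrs aStat v := by
  refine (run_forN (by decide) rfl rfl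
    (fun j τ => (∀ i < n * len, τ.arrs aStack i = σ.arrs aStack i) ∧
      ∀ v < j, τ.arrs aStack (n * len + v) = σ.arrs aStat v) 6
    (by simp) ?_).step (by rw [hn]; omega) fun σ1 hF1 ⟨h1, h2⟩ => ?_
  · rintro v hv τ hF hv1 ⟨h5, h6⟩
    have h7 : τ.regs rTop = n * len := by rw [hF.regs rTop rfl, htop]
    have h8 : τ.arrs aStat = σ.arrs aStat := by rw [hF.arrs aStat rfl]
    refine Run.simple rfl fun _ => ⟨fun i hi => ?_, fun x hx => ?_⟩
    · simp only [RamProg.run, RamExpr.eval_add, RamExpr.eval_reg, hv1, h7, Function.update_self]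
      rw [Function.update_of_ne (by omega)]
      exact h5 i hi
    · simp only [RamProg.run, RamExpr.eval_add, RamExpr.eval_reg, hv1, h7, Function.update_self,
        RamExpr.eval_get, h8]
      by_cases hxv : x = v
      · subst hxv
        simp
      · rw [Function.update_of_ne (by omega)]
        exact h6 x (by omega)
  · have hn1 : σ1.regs 0 = n := (hF1.regs 0 rfl).trans hn
    have ht1 : σ1.regs rTop = n * len := (hF1.regs rTop rfl).trans htop
    rw [hn] at h2 ⊢
    refine (Run.of_simple (rTop ::= .reg rTop + .reg 0) rfl σ1).mono ?_ ?_
    · change 4 ≤ _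
      omega
    · rintro σ' - rfl
      exact ⟨by simp [RamProg.run, hn1, ht1, Nat.mul_add], h1, h2⟩

theorem run_branch (hn : σ.regs 0 = n) {len : ℕ} (htop : σ.regs rTop = n * len)
    (hex : ∃ v < n, σ.arrs aStat v = 0 ∧ σ.arrs aPar v ≠ 0 ∧ σ.arrs aLm v = 0) :
    Run branch σ (60 * n + 60) fun σ' => ∃ p < n,
      (σ.arrs aStat p = 0 ∧ σ.arrs aPar p ≠ 0 ∧ σ.arrs aLm p = 0) ∧
      σ'.regs rTop = n * (len + 2) ∧ (∀ i < n * len, σ'.arrs aStack i = σ.arrs aStack i) ∧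
      (∀ v < n, σ'.arrs aStack (n * len + v) = Function.update (σ.arrs aStat) p 2 v) ∧
      ∀ v < n, σ'.arrs aStack (n * (len + 1) + v) = Function.update (σ.arrs aStat) p 3 v := by
  set good : ℕ → Prop := fun v =>
    σ.arrs aStat v = 0 ∧ σ.arrs aPar v ≠ 0 ∧ σ.arrs aLm v = 0 with hgood
  refine (run_forN (by decide) rfl rfl
    (fun j τ => (∃ v < j, good v) → τ.regs rPick < n ∧ good (τ.regs rPick)) 11
    (by simp) ?_).step (by rw [hn]; omega) fun σ1 hF1 h1 => ?_
  · intro v hv τ hF hv1 hI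
    rw [hn] at hv
    have h8 : τ.arrs aStat = σ.arrs aStat := hF.arrs aStat rfl
    have h9 : τ.arrs aPar = σ.arrs aPar := hF.arrs aPar rfl
    have h10 : τ.arrs aLm = σ.arrs aLm := hF.arrs aLm rfl
    have hold : ¬ good v → (∃ x < v + 1, good x) → τ.regs rPick < n ∧ good (τ.regs rPick) := by
      rintro hnot ⟨x, hx, hgx⟩
      have : x ≠ v := by
        rintro rfl
        exact hnot hgx
      exact hI ⟨x, by omega, hgx⟩
    refine Run.simple rfl fun _ => ?_
    by_cases h11 : σ.arrs aStat v = 0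
    · by_cases h12 : σ.arrs aPar v = 0
      · simpa [RamProg.run, hv1, h8, h9, h11, h12] using hold fun h => h.2.1 h12
      · by_cases h13 : σ.arrs aLm v = 0
        · have hgv : good v := ⟨h11, h12, h13⟩
          simp [RamProg.run, hv1, h8, h9, h10, h11, h12, h13, hv, hgv]
        · simpa [RamProg.run, hv1, h8, h9, h10, h11, h12, h13] using hold fun h => h13 h.2.2
    · simpa [RamProg.run, hv1, h8, h11] using hold fun h => h11 h.1
  rw [hn] at h1 ⊢
  obtain ⟨hpn, hgp⟩ := h1 hex
  set p := σ1.regs rPick with hp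
  have hstore : ∀ (τ : RamState) (i : ℕ), τ.regs rPick = p →
      Run (.store aStat (.reg rPick) (.lit i)) τ 3 (fun τ' => τ'.regs = τ.regs ∧
        τ'.arrs aStat = Function.update (τ.arrs aStat) p i ∧
        τ'.arrs aStack = τ.arrs aStack) := fun τ i h =>
    Run.simple rfl fun _ => by simp [RamProg.run, h, RamExpr.eval]
  have hn1 : σ1.regs 0 = n := (hF1.regs 0 rfl).trans hn
  have ht1 : σ1.regs rTop = n * len := (hF1.regs rTop rfl).trans htop
  refine (hstore σ1 2 rfl).step (by omega) fun σ2 hF2 ⟨hr2, hs2, hk2⟩ => ?_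
  refine (run_pushItem (n := n) (len := len) (by rw [hr2]; exact hn1) (by rw [hr2]; exact ht1)).step
    (by omega) fun σ3 hF3 ⟨ht3, hk3, hk3'⟩ => ?_
  refine (hstore σ3 3 (by rw [hF3.regs rPick rfl, hr2])).step (by omega)
    fun σ4 hF4 ⟨hr4, hs4, hk4⟩ => ?_
  refine (run_pushItem (n := n) (len := len + 1) (by rw [hr4, hF3.regs 0 rfl, hr2]; exact hn1)
    (by rw [hr4]; exact ht3)).mono (by omega) ?_
  rintro σ5 hF5 ⟨ht5, hk5, hk5'⟩
  have hst : σ2.arrs aStat = Function.update (σ.arrs aStat) p 2 := by rw [hs2, hF1.arrs aStat rfl]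
  have hmul : n * (len + 1) = n * len + n := by ring
  refine ⟨p, hpn, hgp, ht5, fun i hi => ?_, fun v hv => ?_, fun v hv => ?_⟩
  · rw [hk5 i (by omega), hk4, hk3 i hi, hk2, hF1.arrs aStack rfl]
  · rw [hk5 _ (by omega), hk4, hk3' v hv, hst]
  · rw [hk5' v hv, hs4, hF3.arrs aStat rfl, hst, Function.update_idem]

theorem Weight.pos {a : ℕ} (h : Weight n E k c a) : 1 ≤ a := by
  obtain ⟨lam, -, h2, h3⟩ := h
  have : 2 ^ 1 ≤ 2 ^ (2 * (k - (chosen n c).card) + 2 - lam) :=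
    Nat.pow_le_pow_right (by omega) (by omega)
  omega

/-- The weights of the two branches add up to less than the weight of the item. -/
theorem Weight.branch {mate par lm pos : ℕ → ℕ} {a lam v : ℕ} (hE : IsGraphOn n E)
    (h : Weight n E k c a) (hS : Searched n E c mate par lm 0 pos) (hm : MateGood n E c mate lam)
    (h0 : lam ≠ 0) (hle : lam ≤ k - (chosen n c).card) (hv : v ∈ cut n E c (reached n lm)) :
    ∃ a₁ a₂, Weight n E k (Function.update c v 2) a₁ ∧ Weight n E k (Function.update c v 3) a₂ ∧
      a₁ + a₂ + 1 ≤ a := by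
  obtain ⟨lam0, h1, h2, h3⟩ := h
  have h4 := h1 _ (hS.valid hE rfl)
  rw [hS.card_cut hE rfl hm] at h4
  have hv0 := (mem_cut.1 hv).2
  have hvn := (mem_cut.1 hv).1.1
  set b := k - (chosen n c).card with hb
  have hpos : 1 ≤ 2 ^ (2 * b + 1 - lam) := Nat.one_le_two_pow
  refine ⟨2 ^ (2 * b + 1 - lam) - 1, 2 ^ (2 * b + 1 - lam) - 1,
    ⟨lam + 1, lb_update_sink hS hm hv, ?_, ?_⟩,
    ⟨lam - 1, lb_update_chosen hv0 hm.lb, ?_, ?_⟩, ?_⟩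
  · rw [chosen_update_sink hv0]
    omega
  · rw [chosen_update_sink hv0, ← hb, Nat.sub_add_cancel hpos]
    congr 1
    omega
  · rw [card_chosen_update hv0 hvn]
    omega
  · rw [card_chosen_update hv0 hvn, Nat.sub_add_cancel hpos]
    congr 1
    omega
  · have h5 : 2 ^ (2 * b + 2 - lam) ≤ 2 ^ (2 * b + 2 - lam0) :=
      Nat.pow_le_pow_right (by omega) (by omega)
    rw [show 2 * b + 2 - lam = (2 * b + 1 - lam) + 1 by omega, pow_succ] at h5
    omega

/-- One round decreases the weight, and what the item was to find is found or left to other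
items. -/
theorem run_process (hE : IsGraphOn n E) (hs : s < n) (ht : t < n)
    (hB : Branching n E M s t k (c :: l) F φ σ) :
    Run process σ ((k + 2) * (700 * (n + M) + 700)) fun σ' => ∃ items F' φ',
      Branching n E M s t k items (F ++ F') φ' σ' ∧ φ' + 1 ≤ φ ∧ (∀ c' ∈ l, c' ∈ items) ∧
      ∀ S, Target n E s t k c S → S ∈ F ++ F' ∨ ∃ c' ∈ items, Target n E s t k c' S := by
  obtain ⟨hU, htop, ⟨hrow, hok, a, b, hwt, hst, hφ⟩, hL⟩ := hB
  have hn : σ.regs 0 = n := hU.graph.size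
  -- `W` bounds the time for the computation of the minimum cut
  obtain ⟨W, hW⟩ : ∃ W, W = (k + 2) * (250 * (n + M) + 250) := ⟨_, rfl⟩
  suffices h : Run process σ (W + (700 * (n + M) + 700)) fun σ' => ∃ items F' φ',
      Branching n E M s t k items (F ++ F') φ' σ' ∧ φ' + 1 ≤ φ ∧ (∀ c' ∈ l, c' ∈ items) ∧
      ∀ S, Target n E s t k c S → S ∈ F ++ F' ∨ ∃ c' ∈ items, Target n E s t k c' S from
    h.mono (by rw [hW]; nlinarith) fun _ _ h => h
  have hs1 : Run (rTop ::= .reg rTop - .reg 0 ;; rCount ::= 0) σ 6 (fun τ => τ.arrs = σ.arrs ∧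
      τ.regs rTop = n * l.length ∧ τ.regs rCount = 0) :=
    Run.simple rfl fun _ => by simp [RamProg.run, hn, htop, Nat.mul_add]
  refine hs1.step (by omega) fun σ1 hF1 ⟨ha1, ht1, hcnt1⟩ => ?_
  have hU1 : Setup n E M s t k σ1 := hU.frame hF1 (by decide)
  have hn1 : σ1.regs 0 = n := hU1.graph.size
  refine (run_forN (by decide) rfl rfl
    (fun j τ => (∀ v < j, τ.arrs aStat v = c v) ∧ (∀ v < j, τ.arrs aMate v = v) ∧
      τ.regs rCount = ((Finset.range j).filter fun v => c v = 3).card) 18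
    (by simp [hcnt1]) ?_).step (by rw [hn1]; omega) fun σ2 hF2 ⟨hst2, hid2, hcnt2⟩ => ?_
  · rintro v hv τ hF hv1 ⟨h1, h2, h3⟩
    rw [hn1] at hv
    have h4 : τ.arrs aStack (n * l.length + v) = c v := by
      rw [hF.arrs aStack rfl, ha1, hrow v hv]
    have h5 : τ.regs rTop = n * l.length := by rw [hF.regs rTop rfl, ht1]
    have h6 := hok.le_three v hv
    refine Run.simple rfl fun _ => ?_
    rw [Finset.range_add_one, Finset.filter_insert]
    by_cases h7 : c v = 3
    · rw [if_pos h7, Finset.card_insert_of_notMem (by simp)]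
      refine ⟨fun x hx => ?_, fun x hx => ?_, ?_⟩
      · by_cases hxv : x = v
        · subst hxv
          simp [RamProg.run, hv1, h5, h4, h7]
        · simp [RamProg.run, hv1, h5, h4, h7, hxv, h1 x (by omega)]
      · by_cases hxv : x = v
        · simp [RamProg.run, hv1, h5, h4, h7, hxv]
        · simp [RamProg.run, hv1, h5, h4, h7, hxv, h2 x (by omega)]
      · simp [RamProg.run, hv1, h5, h4, h7, h3]
    · have h8 : c v - 2 = 0 := by omega
      rw [if_neg h7]
      refine ⟨fun x hx => ?_, fun x hx => ?_, ?_⟩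
      · by_cases hxv : x = v
        · subst hxv
          simp [RamProg.run, hv1, h5, h4, h8]
        · simp [RamProg.run, hv1, h5, h4, h8, hxv, h1 x (by omega)]
      · by_cases hxv : x = v
        · simp [RamProg.run, hv1, h5, h4, h8, hxv]
        · simp [RamProg.run, hv1, h5, h4, h8, hxv, h2 x (by omega)]
      · simp [RamProg.run, hv1, h5, h4, h8, h3]
  rw [hn1] at hst2 hid2 hcnt2 ⊢
  have hU2 : Setup n E M s t k σ2 := hU1.frame hF2 (by decide)
  have hs3 : Run (rBudget ::= .reg 3 - .reg rCount) σ2 4 (fun τ => τ.arrs = σ2.arrs ∧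
      τ.regs rBudget = k - (chosen n c).card) :=
    Run.simple rfl fun _ => by simp [RamProg.run, hU2.bound, hcnt2, chosen]
  refine hs3.step (by omega) fun σ3 hF3 ⟨ha3, hb3⟩ => ?_
  have hU3 : Setup n E M s t k σ3 := hU2.frame hF3 (by decide)
  -- from here on the contents of the array replace the item that they agree with
  set c₂ := σ2.arrs aStat with hc₂
  have hcc : ∀ v < n, c v = c₂ v := fun v hv => (hst2 v hv).symm
  have hok2 : ItemOK n s t k c₂ := hok.congr hs ht hcc
  have hwt2 : Weight n E k c₂ a := by
    obtain ⟨lam, h1, h2, h3⟩ := hwt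
    rw [chosen_congr hcc] at h2 h3
    exact ⟨lam, h1.congr hE hcc, h2, h3⟩
  have hTT : ∀ S, Target n E s t k c S → Target n E s t k c₂ S := fun S h => h.congr hcc
  rw [chosen_congr hcc] at hb3
  have hc3 : σ3.arrs aStat = c₂ := by rw [ha3]
  have hkle : σ3.regs rBudget ≤ k := by omega
  refine ((run_flow hE hU3.graph (by rw [ha3]; exact hid2)).mono (M := W)
    (by rw [hW]; exact Nat.mul_le_mul_right _ (by omega)) fun _ _ h => h).step (by omega)
    fun σ4 hF4 h4 => ?_
  rw [hc3, hb3] at h4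
  have hU4 : Setup n E M s t k σ4 := hU3.frame hF4 (by decide)
  have hb4 : σ4.regs rBudget = k - (chosen n c₂).card := by rw [hF4.regs rBudget rfl, hb3]
  have hc4 : σ4.arrs aStat = c₂ := by rw [hF4.arrs aStat rfl, hc3]
  have ht4 : σ4.regs rTop = n * l.length := by
    rw [hF4.regs rTop rfl, hF3.regs rTop rfl, hF2.regs rTop rfl, ht1]
  have hsk4 : σ4.arrs aStack = σ.arrs aStack := by
    rw [hF4.arrs aStack rfl, ha3, hF2.arrs aStack rfl, ha1]
  have hL4 : Listed n E s t k σ4 F := hL.of_eq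
    (by rw [hF4.regs rOut rfl, hF3.regs rOut rfl, hF2.regs rOut rfl, hF1.regs rOut rfl])
    (by rw [hF4.arrs aFound rfl, ha3, hF2.arrs aFound rfl, ha1])
    (by rw [hF4.arrs aDict rfl, ha3, hF2.arrs aDict rfl, ha1])
  have hcard := hok2.card_chosen
  have hapos := hwt.pos
  refine (Run.cond (N := 600 * (n + M) + 610) (fun hg => ?_) (fun hg => ?_)).mono
    (by simp; omega) fun _ _ h => h
  · simp only [RamExpr.eval_sub, RamExpr.eval_add, RamExpr.eval_reg, RamExpr.eval_ofNat, hb4] at hg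
    rcases h4 with ⟨h4, -⟩ | ⟨hlam, pos, hS, hm⟩
    · omega
    refine (Run.cond (N := 600 * (n + M) + 600) (fun hg2 => ?_) (fun hg2 => ?_)).mono
      (by simp; omega) fun _ _ h => h
    · simp only [RamExpr.eval_reg] at hg2
      have hne : (cut n E c₂ (reached n (σ4.arrs aLm))).Nonempty := by
        rw [← Finset.card_pos, hS.card_cut hE rfl hm]
        omega
      obtain ⟨v, hv⟩ := hne
      obtain ⟨h5, h6, h7, h8⟩ := hS.mem_cut.1 hv
      refine (run_branch hU4.graph.size ht4 ⟨v, h5, by rw [hc4]; exact h6, h7, h8⟩).mono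
        (by omega) ?_
      rintro σ5 hF5 ⟨p, hpn, ⟨hp0, hp1, hp2⟩, ht5, hsk5, hr5, hr5'⟩
      rw [hc4] at hp0 hr5 hr5'
      have hpcut : p ∈ cut n E c₂ (reached n (σ4.arrs aLm)) := hS.mem_cut.2 ⟨hpn, hp0, hp1, hp2⟩
      obtain ⟨a₁, a₂, hw1, hw2, hsum⟩ := hwt2.branch hE hS hm hg2 hlam hpcut
      refine ⟨Function.update c₂ p 3 :: Function.update c₂ p 2 :: l, [], a₂ + (a₁ + b),
        ⟨hU4.frame hF5 (by decide), ht5, ?_, ?_⟩, by omega, by simp +contextual, ?_⟩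
      · refine ⟨hr5', hok2.update hp0 hpn (.inr ⟨rfl, by omega⟩), a₂, _, hw2, ⟨hr5,
          hok2.update hp0 hpn (.inl rfl), a₁, b, hw1, hst.of_eq fun i hi => ?_, rfl⟩, rfl⟩
        rw [hsk5 i hi, hsk4]
      · rw [List.append_nil]
        exact hL4.of_eq (hF5.regs rOut rfl) (hF5.arrs aFound rfl) (hF5.arrs aDict rfl)
      · intro S hT
        refine .inr ?_
        have := (hTT S hT).branch hE hok2 (hS.valid hE rfl)
          (by rw [hS.card_cut hE rfl hm]; exact hm.lb) hpcut
        simp only [List.mem_cons, exists_eq_or_imp]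
        tauto
    · have hlam0 : σ4.regs rLam = 0 := by simpa using hg2
      have hcut : cut n E c₂ (reached n (σ4.arrs aLm)) = ∅ := by
        rw [← Finset.card_eq_zero, hS.card_cut hE rfl hm, hlam0]
      have hV := hS.valid hE rfl
      have hnb : nb n E (reached n (σ4.arrs aLm)) ⊆ chosen n c₂ := by
        intro w hw
        have h1 := hV.nb_status hok2.le_three hw
        refine mem_chosen.2 ⟨(mem_nb.1 hw).1, h1.resolve_left fun h2 => ?_⟩
        have : w ∈ cut n E c₂ (reached n (σ4.arrs aLm)) := Finset.mem_filter.2 ⟨hw, h2⟩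
        simp [hcut] at this
      have hsep : t ∉ reach n E (chosen n c₂) s := fun h => by
        have h1 := hV.status t (reach_subset_of_nb_subset hE (hV.source s hs hok2.left) hnb h)
        have := hok2.right
        omega
      refine (run_leaf hE hs ht hU4 hL4 (by rw [hc4]; exact hok2) (by rw [hc4]; exact hsep)).mono
        (by omega) ?_
      rintro σ5 hF5 ⟨F', hL5, hmem⟩
      rw [hc4] at hmem
      refine ⟨l, F', b, ⟨hU4.frame hF5 (by decide), (hF5.regs rTop rfl).trans ht4, ?_, hL5⟩,
        by omega, fun _ h => h, fun S hT => .inl ((hmem S).2 (.inr ?_))⟩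
      · rw [hF5.arrs aStack rfl, hsk4]
        exact hst
      · have h1 := (hTT S hT).eq_chosen hE hs ht hok2 hV hcut
        rw [← h1, hT.minSep.shrunk_eq hE]
  · simp only [RamExpr.eval_sub, RamExpr.eval_add, RamExpr.eval_reg, RamExpr.eval_ofNat, hb4] at hg
    rcases h4 with ⟨-, h4⟩ | ⟨hlam, -⟩
    · refine (Run.of_simple .skip rfl σ4).mono (by change 1 ≤ _; omega) ?_
      intro σ' _ (h : σ' = σ4)
      subst h
      refine ⟨l, [], b, ⟨hU4, ht4, ?_, by simpa using hL4⟩, by omega,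
        fun _ h => h, fun S hT => ?_⟩
      · rw [hsk4]
        exact hst
      · exact absurd (hTT S hT) (Target.false_of_lb hE hok2.le_three h4 (by omega))
    · omega

theorem run_processAll (hE : IsGraphOn n E) (hs : s < n) (ht : t < n) {items : List (ℕ → ℕ)}
    (hB : Branching n E M s t k items F φ σ) :
    Run processAll σ (φ * ((k + 2) * (700 * (n + M) + 700) + 1) + 1) fun σ' => ∃ F',
      Branching n E M s t k [] (F ++ F') 0 σ' ∧
      ∀ c ∈ items, ∀ S, Target n E s t k c S → S ∈ F ++ F' := by
  set K := (k + 2) * (700 * (n + M) + 700) with hK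
  refine (Run.loop (fun ψ τ => ∃ items' F' φ', Branching n E M s t k items' (F ++ F') φ' τ ∧
    ψ = φ' * (K + 1) ∧ ∀ c ∈ items, ∀ S, Target n E s t k c S →
      S ∈ F ++ F' ∨ ∃ c' ∈ items', Target n E s t k c' S) (by decide) ?_ (φ := φ * (K + 1))
    ⟨items, [], φ, by simpa using hB, rfl, fun c hc S hT => .inr ⟨c, hc, hT⟩⟩).mono ?_ ?_
  · rintro ψ τ - ⟨items', F', φ', hB', rfl, hT⟩ hg
    cases items' with
    | nil =>
      have := hB'.top
      simp at this hg
      exact absurd this hg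
    | cons c l =>
      refine ⟨K, (run_process hE hs ht hB').mono le_rfl ?_⟩
      rintro τ' - ⟨items2, F2, φ2, hB2, hlt, hsub, hT2⟩
      refine ⟨_, ⟨items2, F' ++ F2, φ2, by rwa [← List.append_assoc], rfl, ?_⟩, ?_⟩
      · intro c0 hc0 S hS
        rw [← List.append_assoc]
        rcases hT c0 hc0 S hS with h | ⟨c', hc', hS'⟩
        · exact .inl (List.mem_append_left _ h)
        · rcases List.mem_cons.1 hc' with rfl | hc'
          · exact hT2 S hS'
          · exact .inr ⟨c', hsub c' hc', hS'⟩
      · simp only [RamExpr.cost_reg]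
        obtain ⟨d, rfl⟩ : ∃ d, φ' = φ2 + 1 + d := ⟨φ' - (φ2 + 1), by omega⟩
        nlinarith [Nat.zero_le (d * (K + 1))]
  · simp
  · rintro τ - ⟨⟨ψ, items', F', φ', hB', rfl, hT⟩, hg⟩
    have hnil : items' = [] := by
      have := hB'.top
      simp only [RamExpr.eval_reg] at hg
      rw [hg] at this
      rcases Nat.mul_eq_zero.1 this.symm with h | h
      · omega
      · exact List.length_eq_zero_iff.1 h
    subst hnil
    obtain rfl : φ' = 0 := hB'.stack
    refine ⟨F', hB', fun c hc S hS => ?_⟩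
    simpa using hT c hc S hS

end

/-! ### The enumeration -/

/-- For each vertex `v` of status `3` push the item whose sources are the vertices marked by the
last search and `v`. -/
def pushAll : RamProg :=
  forN rV (.cond (.get aStat (.reg rV))
    (forN rI (.cond (.get aLm (.reg rI)) (.store aStack (.reg rTop + .reg rI) 1)
        (.store aStack (.reg rTop + .reg rI) 0)) ;;
      .store aStack (.reg rTop + .reg rV) 1 ;;
      .store aStack (.reg rTop + .reg 2) 2 ;;
      rTop ::= .reg rTop + .reg 0)
    .skip)

/-- Find the separators closest to the enlarged sides of the current separator. As that separator is
minimal, `shrink` leaves it as it is and marks its side. -/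
def advance : RamProg :=
  (rNext ::= .reg rNext + .reg 0 ;; rRoot ::= .reg 1) ;; shrink ;; pushAll ;; processAll

/-- Load the next separator. -/
def loadNext : RamProg :=
  forN rV (.store aStat (.reg rV) (.get aFound (.reg rNext + .reg rV)))

/-- Write the vertices of status `3` to the output. -/
def emitAll : RamProg := forN rV (.cond (.get aStat (.reg rV)) (.emit (.reg rV)) .skip)

/-- Output all separators in the list, which grows in the process. -/
def outputLoop : RamProg :=
  .loop (.reg rOut - .reg rNext) (loadNext ;; emitAll ;; .flush ;; advance)

/-- Compute the powers of two and push the item with the single source `s`. -/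
def prepare : RamProg :=
  rKey ::= 1 ;;
  forN rV (.store aPow (.reg rV) (.reg rKey) ;; rKey ::= .reg rKey + .reg rKey) ;;
  (.store aStack (.reg 1) 1 ;; .store aStack (.reg 2) 2 ;; rTop ::= .reg 0)

/-- The enumeration of all minimal separators of size at most `k`. -/
def listSeparators : RamProg := prepare ;; processAll ;; outputLoop

open scoped Classical in
/-- The statuses with sources `X`, the sink `t`, and all other vertices free. -/
noncomputable def rootItem (t : ℕ) (X : Finset ℕ) : ℕ → ℕ := fun w =>
  if w = t then 2 else if w ∈ X then 1 else 0

section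

variable {n M : ℕ} {E : ℕ → ℕ → Prop} {σ σ' : RamState} {s t k φ : ℕ} {F : List (Finset ℕ)}
  {S X : Finset ℕ}

theorem chosen_rootItem : chosen n (rootItem t X) = ∅ := by
  ext w
  simp only [mem_chosen, rootItem, Finset.notMem_empty, iff_false, not_and]
  intro _
  split_ifs <;> simp

theorem itemOK_rootItem (hs : s ∈ X) (ht : t ∉ X) : ItemOK n s t k (rootItem t X) := by
  refine ⟨fun v _ => ?_, ?_, by simp [rootItem], by simp [chosen_rootItem]⟩
  · rw [rootItem]
    split_ifs <;> omega
  · rw [rootItem, if_neg (by rintro rfl; exact ht hs), if_pos hs]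

theorem weight_rootItem : Weight n E k (rootItem t X) (4 ^ (k + 1) - 1) := by
  refine ⟨0, fun _ _ => Nat.zero_le _, Nat.zero_le _, ?_⟩
  rw [Nat.sub_add_cancel (Nat.one_le_pow _ _ (by omega)), chosen_rootItem, Finset.card_empty,
    show 2 * (k - 0) + 2 - 0 = 2 * (k + 1) by omega, pow_mul]
  norm_num

theorem target_rootItem (ht : t ∉ X) (hX : ∀ v ∈ X, v < n) (hS : MinSep n E s t S)
    (hk : S.card ≤ k) (hc : Closest n E s X S) : Target n E s t k (rootItem t X) S := by
  have h1 : ∀ v, rootItem t X v = 1 ↔ v ∈ X := by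
    intro v
    rw [rootItem]
    split_ifs with h1 h2
    · subst h1
      simp [ht]
    · simp [h2]
    · simp [h2]
  refine ⟨hS, hk, fun v _ h => hc.1 ((h1 v).1 h), fun v _ h => ?_, fun v hv h => ?_,
    fun D hD hXD hcard => hc.2 D hD (fun v hv => hXD v (hX v hv) ((h1 v).2 hv)) hcard⟩
  · have : v = t := by
      rw [rootItem] at h
      split_ifs at h with h2 h2 <;> first | exact h2 | omega
    exact this ▸ ⟨hS.separates, hS.right_not_mem⟩
  · have : v ∈ chosen n (rootItem t X) := mem_chosen.2 ⟨hv, h⟩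
    simp [chosen_rootItem] at this

theorem run_pushAll (hs : s < n) (ht : t < n) (hU : Setup n E M s t k σ)
    (hS : MinSep n E s t S) (hst : ∀ v < n, σ.arrs aStat v = if v ∈ S then 3 else 0)
    (hlm : ∀ v < n, σ.arrs aLm v ≠ 0 ↔ v ∈ reach n E S s) (htop : σ.regs rTop = 0) :
    Run pushAll σ (n * (19 * n + 40) + 5) fun σ' => ∃ items φ,
      σ'.regs rTop = n * items.length ∧ StackRep n E s t k (σ'.arrs aStack) items φ ∧
      φ ≤ n * 4 ^ (k + 1) ∧ ∀ v ∈ S, rootItem t (insert v (reach n E S s)) ∈ items := by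
  have hn : σ.regs 0 = n := hU.graph.size
  refine (run_forN (by decide) rfl rfl (fun j τ => ∃ items, τ.regs rTop = n * items.length ∧
      StackRep n E s t k (τ.arrs aStack) items (items.length * (4 ^ (k + 1) - 1)) ∧
      items.length ≤ j ∧ ∀ v < j, v ∈ S → rootItem t (insert v (reach n E S s)) ∈ items)
    (19 * n + 33) ⟨[], by simp [htop], by simp [StackRep], by simp, by simp⟩ ?_).mono
    (by rw [hn]) ?_
  · rintro v hv τ hF hv1 ⟨items, h1, h2, h3, h4⟩
    rw [hn] at hv
    have hsv : τ.arrs aStat v = if v ∈ S then 3 else 0 := by rw [hF.arrs aStat rfl, hst v hv]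
    have hUτ : Setup n E M s t k τ := hU.frame hF (by decide)
    refine (Run.cond (N := 19 * n + 31) (fun hg => ?_) (fun hg => ?_)).mono
      (by simp; omega) fun _ _ h => h
    · have hvS : v ∈ S := by
        by_contra h
        simp [hv1, hsv, h] at hg
      have hvt : v ≠ t := by
        rintro rfl
        exact hS.right_not_mem hvS
      set b := n * items.length with hb
      refine (run_forN (by decide) rfl rfl
        (fun j τ' => (∀ i < b, τ'.arrs aStack i = τ.arrs aStack i) ∧
          ∀ w < j, τ'.arrs aStack (b + w) = if w ∈ reach n E S s then 1 else 0) 12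
        (by simp) ?_).step (by rw [hUτ.graph.size]; omega) fun τ1 hF1 ⟨h5, h6⟩ => ?_
      · rintro w hw τ' hF' hw1 ⟨h7, h8⟩
        rw [hUτ.graph.size] at hw
        have h9 : τ'.regs rTop = b := by rw [hF'.regs rTop rfl, h1]
        have h10 : τ'.arrs aLm w ≠ 0 ↔ w ∈ reach n E S s := by
          rw [hF'.arrs aLm rfl, hF.arrs aLm rfl, hlm w hw]
        refine Run.simple rfl fun _ => ?_
        by_cases h11 : w ∈ reach n E S s
        · have h12 := h10.2 h11
          refine ⟨fun i hi => ?_, fun x hx => ?_⟩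
          · have : i ≠ b + w := by omega
            simp [RamProg.run, hw1, h9, h12, this, h7 i hi]
          · by_cases hxw : x = w
            · subst hxw
              simp [RamProg.run, hw1, h9, h12, h11]
            · simp [RamProg.run, hw1, h9, h12, hxw, h8 x (by omega)]
        · have h12 : τ'.arrs aLm w = 0 := by
            by_contra h
            exact h11 (h10.1 h)
          refine ⟨fun i hi => ?_, fun x hx => ?_⟩
          · have : i ≠ b + w := by omega
            simp [RamProg.run, hw1, h9, h12, this, h7 i hi]
          · by_cases hxw : x = w
            · subst hxw
              simp [RamProg.run, hw1, h9, h12, h11]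
            · simp [RamProg.run, hw1, h9, h12, hxw, h8 x (by omega)]
      have hU1 : Setup n E M s t k τ1 := hUτ.frame hF1 (by decide)
      have hn1 := hU1.graph.size
      have ht1 := hU1.right
      have hv2 : τ1.regs rV = v := by rw [hF1.regs rV rfl, hv1]
      have htop1 : τ1.regs rTop = b := by rw [hF1.regs rTop rfl, h1]
      rw [hUτ.graph.size] at h6 ⊢
      refine (Run.of_simple (.store aStack (.reg rTop + .reg rV) 1 ;;
        .store aStack (.reg rTop + .reg 2) 2 ;; rTop ::= .reg rTop + .reg 0) rfl τ1).mono ?_ ?_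
      · change 14 ≤ _
        omega
      rintro τ2 - rfl
      refine ⟨rootItem t (insert v (reach n E S s)) :: items, ?_, ⟨?_, ?_, 4 ^ (k + 1) - 1, _,
        weight_rootItem, h2.of_eq ?_, ?_⟩, ?_, ?_⟩
      · simp [RamProg.run, htop1, hn1, hb, Nat.mul_add]
      · intro w hw
        simp only [RamProg.run, RamExpr.eval_add, RamExpr.eval_reg, RamExpr.eval_ofNat, htop1,
          hv2, ht1, Function.update_self, ← hb]
        by_cases hwt : w = t
        · subst hwt
          simp [rootItem]
        · rw [Function.update_of_ne (by omega)]
          by_cases hwv : w = v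
          · subst hwv
            simp [rootItem, hwt]
          · rw [Function.update_of_ne (by omega), h6 w hw]
            simp [rootItem, hwt, hwv]
      · refine itemOK_rootItem (Finset.mem_insert_of_mem (self_mem_reach hs)) fun h => ?_
        rcases Finset.mem_insert.1 h with h | h
        · exact hvt h.symm
        · exact hS.separates h
      · intro i hi
        simp only [RamProg.run, RamExpr.eval_add, RamExpr.eval_reg, RamExpr.eval_ofNat, htop1,
          hv2, ht1, Function.update_self]
        rw [Function.update_of_ne (by omega), Function.update_of_ne (by omega), h5 i hi]
      · rw [List.length_cons]
        ring
      · simp [h3]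
      · intro x hx hxS
        by_cases hxv : x = v
        · simp [hxv]
        · exact List.mem_cons_of_mem _ (h4 x (by omega) hxS)
    · have hvS : v ∉ S := fun h => by simp [hv1, hsv, h] at hg
      refine (Run.of_simple .skip rfl τ).mono (by change 1 ≤ _; omega) ?_
      intro τ2 _ (h : τ2 = τ)
      subst h
      refine ⟨items, h1, h2, by omega, fun x hx hxS => h4 x ?_ hxS⟩
      have : x ≠ v := fun h => hvS (h ▸ hxS)
      omega
  · rintro τ - ⟨items, h1, h2, h3, h4⟩
    rw [hn] at h3 h4
    refine ⟨items, _, h1, h2, Nat.mul_le_mul h3 (Nat.sub_le _ _), fun v hv => ?_⟩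
    exact h4 v (Finset.mem_range.1 (hS.subset_range hv)) hv

/-- A bound for the time between two outputs, apart from the time for writing them: up to `n` starts
of the branching, each with fewer than `4 ^ (k + 1)` rounds, and their preparation. -/
def pause (n M k : ℕ) : ℕ :=
  n * 4 ^ (k + 1) * ((k + 2) * (700 * (n + M) + 700) + 1) +
    (n * (19 * n + 40) + 250 * (n + M) + 300)

theorem run_advance (hE : IsGraphOn n E) (hs : s < n) (ht : t < n)
    (hB : Branching n E M s t k [] F 0 σ) (hS : MinSep n E s t S)
    (hst : ∀ v < n, σ.arrs aStat v = if v ∈ S then 3 else 0) :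
    Run advance σ (pause n M k) fun σ' => ∃ F', Branching n E M s t k [] (F ++ F') 0 σ' ∧
      σ'.regs rNext = σ.regs rNext + n ∧
      ∀ v ∈ S, ∀ S', MinSep n E s t S' → S'.card ≤ k →
        Closest n E s (insert v (reach n E S s)) S' → S' ∈ F ++ F' := by
  rw [pause]
  generalize hK : (k + 2) * (700 * (n + M) + 700) + 1 = K
  generalize hW : n * 4 ^ (k + 1) * K = W
  generalize hQ : n * (19 * n + 40) = Q
  obtain ⟨hU, htop, -, hL⟩ := hB
  have hs1 : Run (rNext ::= .reg rNext + .reg 0 ;; rRoot ::= .reg 1) σ 6 (fun τ =>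
      τ.arrs = σ.arrs ∧ τ.regs rNext = σ.regs rNext + n ∧ τ.regs rRoot = s) :=
    Run.simple rfl fun _ => by simp [RamProg.run, hU.graph.size, hU.left]
  refine hs1.step (by omega) fun σ1 hF1 ⟨ha1, hx1, hr1⟩ => ?_
  have hU1 : Setup n E M s t k σ1 := hU.frame hF1 (by decide)
  have hch : chosen n (σ1.arrs aStat) = S := by
    rw [ha1]
    exact chosen_eq_of_ite hS.subset_range hst
  refine (run_shrink hE hU1.graph (by rw [hr1]; exact hs)
    (by rw [hr1, hch]; exact hS.left_not_mem) ?_).step (by omega) fun σ2 hF2 ⟨h2, h3⟩ => ?_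
  · intro v hv
    rw [ha1, hst v hv]
    split_ifs <;> omega
  rw [hch, hr1, hS.nb_left hE] at h2
  rw [hch, hr1] at h3
  have hU2 : Setup n E M s t k σ2 := hU1.frame hF2 (by decide)
  have htop2 : σ2.regs rTop = 0 := by
    rw [hF2.regs rTop rfl, hF1.regs rTop rfl, htop]
    simp
  refine (run_pushAll hs ht hU2 hS h2 h3 htop2).step (by omega)
    fun σ3 hF3 ⟨items, φ, h4, h5, h6, h7⟩ => ?_
  have hU3 : Setup n E M s t k σ3 := hU2.frame hF3 (by decide)
  have hL3 : Listed n E s t k σ3 F := hL.of_eq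
    (by rw [hF3.regs rOut rfl, hF2.regs rOut rfl, hF1.regs rOut rfl])
    (by rw [hF3.arrs aFound rfl, hF2.arrs aFound rfl, ha1])
    (by rw [hF3.arrs aDict rfl, hF2.arrs aDict rfl, ha1])
  have hWle : φ * K ≤ W := hW ▸ Nat.mul_le_mul_right _ h6
  refine (run_processAll hE hs ht ⟨hU3, h4, h5, hL3⟩).mono (by rw [hK]; omega) ?_
  rintro σ4 hF4 ⟨F', hB', hT⟩
  refine ⟨F', hB', by rw [hF4.regs rNext rfl, hF3.regs rNext rfl, hF2.regs rNext rfl, hx1],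
    fun v hv S' hS' hk hc => ?_⟩
  refine hT _ (h7 v hv) S' (target_rootItem (fun h => ?_) (fun x hx => ?_) hS' hk hc)
  · rcases Finset.mem_insert.1 h with h | h
    · exact hS.right_not_mem (h ▸ hv)
    · exact hS.separates h
  · exact (mem_reach.1 (hc.1 hx)).1

theorem run_loadNext (hn : σ.regs 0 = n) (hL : Listed n E s t k σ F) {i : ℕ}
    (hi : F[i]? = some S) (hx : σ.regs rNext = n * i) :
    Run loadNext σ (13 * n + 5) fun σ' => ∀ v < n, σ'.arrs aStat v = if v ∈ S then 3 else 0 := by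
  refine (run_forN (by decide) rfl rfl
    (fun j τ => ∀ v < j, τ.arrs aStat v = if v ∈ S then 3 else 0) 6 (by simp) ?_).mono
    (by rw [hn]; omega) fun σ' _ h => by rwa [hn] at h
  intro v hv τ hF hv1 hI
  rw [hn] at hv
  have h1 : τ.arrs aFound (n * i + v) = if v ∈ S then 3 else 0 := by
    rw [hF.arrs aFound rfl, hL.row i S hi v hv]
  have h2 : τ.regs rNext = n * i := by rw [hF.regs rNext rfl, hx]
  refine Run.simple rfl fun _ x hxv => ?_
  by_cases hxv' : x = v
  · subst hxv'
    simp [RamProg.run, hv1, h1, h2]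
  · simp [RamProg.run, hv1, h1, h2, hxv', hI x (by omega)]

/-- The word that is written for the set `S`. -/
def wordOf (n : ℕ) (S : Finset ℕ) : List ℕ := (List.range n).filter (· ∈ S)

theorem emitted_append (a b : List RamEvent) : emitted (a ++ b) = emitted a ++ emitted b :=
  List.filterMap_append

theorem emitted_ticks (r : ℕ) : emitted (ticks r) = [] := by
  simp [emitted, ticks]

theorem not_flush_of_mem_ticks {r : ℕ} {e : RamEvent} (h : e ∈ ticks r) : e ≠ .flush := by
  rw [List.eq_of_mem_replicate h]
  simp

theorem exec_emitAll (hn : σ.regs 0 = n)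
    (hst : ∀ v < n, σ.arrs aStat v = if v ∈ S then 3 else 0) :
    ∃ tr σ', Exec emitAll σ tr σ' ∧ emitted tr = wordOf n S ∧ (∀ e ∈ tr, e ≠ .flush) ∧
      tr.length ≤ 11 * n + 5 := by
  have key : ∀ d j τ, j + d = n → τ.regs rV = j → τ.regs 0 = n →
      (∀ v < n, τ.arrs aStat v = if v ∈ S then 3 else 0) →
      ∃ tr τ', Exec (countTo rV 0 (.cond (.get aStat (.reg rV)) (.emit (.reg rV)) .skip)) τ tr τ' ∧
        emitted tr = (List.range' j d).filter (· ∈ S) ∧ (∀ e ∈ tr, e ≠ .flush) ∧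
        tr.length ≤ 11 * d + 3 := by
    intro d
    induction d with
    | zero =>
      intro j τ hj hv hn0 _
      refine ⟨ticks 3, τ, Exec.loop_false _ (by simp [hv, hn0]; omega), ?_, ?_, ?_⟩
      · simp [emitted_ticks]
      · exact fun e he => not_flush_of_mem_ticks he
      · simp [ticks]
    | succ d ih =>
      intro j τ hj hv hn0 hc
      have hguard : (RamExpr.reg 0 - RamExpr.reg rV : RamExpr).eval τ ≠ 0 := by
        simp [hv, hn0]
        omega
      have hcond : (RamExpr.get aStat (.reg rV)).eval τ = if j ∈ S then 3 else 0 := by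
        simp [hv, hc j (by omega)]
      obtain ⟨tr, τ', h1, h2, h3, h4⟩ := ih (j + 1)
        ⟨Function.update τ.regs rV (j + 1), τ.arrs⟩ (by omega) (by simp) (by simp [hn0]) hc
      have hinc : Exec (rV ::= .reg rV + 1) τ (ticks 4)
          ⟨Function.update τ.regs rV (j + 1), τ.arrs⟩ := by
        have := Exec.assign rV (.reg rV + 1) τ
        simpa [hv] using this
      by_cases hjS : j ∈ S
      · have hb : Exec (.cond (.get aStat (.reg rV)) (.emit (.reg rV)) .skip) τ
            (ticks 2 ++ (ticks 1 ++ [RamEvent.emit j])) τ := by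
          have := Exec.cond_true (e := .get aStat (.reg rV)) .skip
            (by rw [hcond, if_pos hjS]; omega) (Exec.emit (.reg rV) τ)
          simpa [hv] using this
        refine ⟨_, τ', Exec.loop_true hguard (hb.seq hinc) h1, ?_, ?_, ?_⟩
        · simp only [emitted_append, emitted_ticks, h2, List.range'_succ]
          simp [hjS, emitted]
        · intro e he
          simp only [List.mem_append, List.mem_singleton] at he
          rcases he with (he | (he | (he | rfl)) | he) | he
          · exact not_flush_of_mem_ticks he
          · exact not_flush_of_mem_ticks he
          · exact not_flush_of_mem_ticks he
          · simp
          · exact not_flush_of_mem_ticks he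
          · exact h3 e he
        · simp [ticks]
          omega
      · have hb : Exec (.cond (.get aStat (.reg rV)) (.emit (.reg rV)) .skip) τ
            (ticks 2 ++ ticks 1) τ :=
          Exec.cond_false (e := .get aStat (.reg rV)) _ (by rw [hcond, if_neg hjS]) (Exec.skip τ)
        refine ⟨_, τ', Exec.loop_true hguard (hb.seq hinc) h1, ?_, ?_, ?_⟩
        · simp only [emitted_append, emitted_ticks, h2, List.range'_succ]
          simp [hjS]
        · intro e he
          simp only [List.mem_append] at he
          rcases he with (he | (he | he) | he) | he
          · exact not_flush_of_mem_ticks he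
          · exact not_flush_of_mem_ticks he
          · exact not_flush_of_mem_ticks he
          · exact not_flush_of_mem_ticks he
          · exact h3 e he
        · simp [ticks]
          omega
  obtain ⟨tr, τ', h1, h2, h3, h4⟩ := key n 0 ⟨Function.update σ.regs rV 0, σ.arrs⟩ (by omega)
    (by simp) (by simp [hn]) hst
  have h0 : Exec (rV ::= 0) σ (ticks 2) ⟨Function.update σ.regs rV 0, σ.arrs⟩ :=
    Exec.assign rV 0 σ
  refine ⟨_, τ', h0.seq h1, ?_, ?_, ?_⟩
  · rw [emitted_append, emitted_ticks, h2, List.nil_append, wordOf, List.range_eq_range']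
  · intro e he
    rcases List.mem_append.1 he with he | he
    · exact not_flush_of_mem_ticks he
    · exact h3 e he
  · simp [ticks]
    omega

theorem blocks_of_not_flush {tr : List RamEvent} (h : ∀ e ∈ tr, e ≠ .flush) : blocks tr = [tr] := by
  refine List.splitOnP_eq_singleton fun e he => ?_
  cases e with
  | flush => exact absurd rfl (h _ he)
  | _ => rfl

theorem blocks_append_flush {a b : List RamEvent} (h : ∀ e ∈ a, e ≠ .flush) :
    blocks (a ++ .flush :: b) = a :: blocks b := by
  refine List.splitOnP_append_cons_of_forall_mem (fun e he => ?_) _ rfl _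
  cases e with
  | flush => exact absurd rfl (h _ he)
  | _ => rfl

/-- The output loop writes all separators in the list from position `i` on, and in the end the list
is complete. The first output takes place after `a` further steps that precede the loop. -/
theorem exec_outputLoop (hE : IsGraphOn n E) (hs : s < n) (ht : t < n) :
    ∀ (i : ℕ) (F : List (Finset ℕ)) (σ : RamState), i ≤ F.length →
      Branching n E M s t k [] F 0 σ → σ.regs rNext = n * i →
      (∀ S, MinSep n E s t S → S.card ≤ k → Closest n E s {s} S → S ∈ F) →
      (∀ j < i, ∀ S, F[j]? = some S → ∀ v ∈ S, ∀ S', MinSep n E s t S' → S'.card ≤ k →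
        Closest n E s (insert v (reach n E S s)) S' → S' ∈ F) →
      ∃ tr σ' F', Exec outputLoop σ tr σ' ∧
        (∀ S, S ∈ F ++ F' ↔ MinSep n E s t S ∧ S.card ≤ k) ∧ (F ++ F').Nodup ∧
        ∀ a ≤ pause n M k,
          (blocks (ticks a ++ tr)).map emitted = ((F ++ F').drop i).map (wordOf n) ++ [[]] ∧
          ∀ b ∈ blocks (ticks a ++ tr), b.length + 1 ≤ pause n M k + (24 * n + 20) := by
  intro i
  induction hd : 2 ^ n - i using Nat.strong_induction_on generalizing i with
  | _ d ih =>
  intro F σ hi hB hx hseed hcl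
  have hL := hB.listed
  have hn : σ.regs 0 = n := hB.setup.graph.size
  have hguard : (.reg rOut - .reg rNext : RamExpr).eval σ = n * F.length - n * i := by
    simp [hL.out, hx]
  rcases Nat.lt_or_ge i F.length with hlt | hge
  · have hcard : F.length ≤ 2 ^ n := by
      classical
      rw [← List.toFinset_card_of_nodup hL.nodup]
      calc F.toFinset.card ≤ (Finset.range n).powerset.card := Finset.card_le_card fun S hS =>
            Finset.mem_powerset.2 (hL.good S (List.mem_toFinset.1 hS)).1.subset_range
        _ = 2 ^ n := by rw [Finset.card_powerset, Finset.card_range]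
    obtain ⟨S, hS⟩ : ∃ S, F[i]? = some S := ⟨_, List.getElem?_eq_getElem hlt⟩
    have hSF : S ∈ F := List.mem_of_getElem? hS
    obtain ⟨hmin, -⟩ := hL.good S hSF
    obtain ⟨r1, σ1, he1, hr1, hst1⟩ := run_loadNext hn hL hS hx
    have hF1 := he1.frame
    have hn1 : σ1.regs 0 = n := (hF1.regs 0 rfl).trans hn
    obtain ⟨te, σ2, he2, hem, hnf, hlen⟩ := exec_emitAll hn1 hst1
    have hF2 := he2.frame
    have hB2 : Branching n E M s t k [] F 0 σ2 := by
      refine ⟨(hB.setup.frame hF1 (by decide)).frame hF2 (by decide), ?_, rfl, hL.of_eq ?_ ?_ ?_⟩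
      · rw [hF2.regs rTop rfl, hF1.regs rTop rfl, hB.top]
      · rw [hF2.regs rOut rfl, hF1.regs rOut rfl]
      · rw [hF2.arrs aFound rfl, hF1.arrs aFound rfl]
      · rw [hF2.arrs aDict rfl, hF1.arrs aDict rfl]
    obtain ⟨r3, σ3, he3, hr3, F1, hB3, hx3, hcl3⟩ := run_advance hE hs ht hB2 hmin
      (by rw [hF2.arrs aStat rfl]; exact hst1)
    have hx3' : σ3.regs rNext = n * (i + 1) := by
      rw [hx3, hF2.regs rNext rfl, hF1.regs rNext rfl, hx]
      ring
    have hcl' : ∀ j < i + 1, ∀ S', (F ++ F1)[j]? = some S' → ∀ v ∈ S', ∀ S'',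
        MinSep n E s t S'' → S''.card ≤ k →
        Closest n E s (insert v (reach n E S' s)) S'' → S'' ∈ F ++ F1 := by
      intro j hj S' hS' v hv S'' h1 h2 h3
      rcases Nat.lt_or_ge j i with hji | hji
      · rw [List.getElem?_append_left (by omega)] at hS'
        exact List.mem_append_left _ (hcl j hji S' hS' v hv S'' h1 h2 h3)
      · obtain rfl : j = i := by omega
        rw [List.getElem?_append_left hlt, hS] at hS'
        obtain rfl := Option.some.inj hS'
        exact hcl3 v hv S'' h1 h2 h3
    obtain ⟨tr, σ4, F2, he4, hmem, hnd, hout⟩ := ih (2 ^ n - (i + 1)) (by omega) (i + 1) rfl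
      (F ++ F1) σ3 (by rw [List.length_append]; omega) hB3 hx3'
      (fun S' h1 h2 h3 => List.mem_append_left _ (hseed S' h1 h2 h3)) hcl'
    obtain ⟨hwords, hdelay⟩ := hout r3 hr3
    have hne : (.reg rOut - .reg rNext : RamExpr).eval σ ≠ 0 := by
      rw [hguard]
      have := Nat.mul_lt_mul_of_pos_left hlt (show 0 < n by omega)
      omega
    have hexec : Exec outputLoop σ _ σ4 :=
      Exec.loop_true hne (he1.seq (he2.seq ((Exec.flush σ2).seq he3))) he4
    have hcost : (.reg rOut - .reg rNext : RamExpr).cost = 3 := rfl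
    rw [hcost] at hexec
    have hblocks : ∀ a, blocks (ticks a ++
        (ticks 3 ++ (ticks r1 ++ (te ++ ([RamEvent.flush] ++ ticks r3))) ++ tr)) =
        (ticks (a + 3 + r1) ++ te) :: blocks (ticks r3 ++ tr) := by
      intro a
      rw [← blocks_append_flush]
      · simp [← ticks_append]
      · intro e he
        rcases List.mem_append.1 he with he | he
        · exact not_flush_of_mem_ticks he
        · exact hnf e he
    refine ⟨_, σ4, F1 ++ F2, hexec, ?_, ?_, fun a ha => ⟨?_, fun b hb => ?_⟩⟩
    · rwa [← List.append_assoc]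
    · rwa [← List.append_assoc]
    · rw [hblocks, List.map_cons, hwords, emitted_append, emitted_ticks, hem, List.nil_append,
        ← List.append_assoc, List.drop_eq_getElem_cons (i := i) (by simp; omega), List.map_cons,
        List.cons_append]
      congr 2
      have : (F ++ F1 ++ F2)[i]? = some S := by
        rw [List.append_assoc, List.getElem?_append_left hlt, hS]
      exact (List.getElem?_eq_some_iff.1 this).2.symm
    · rw [hblocks] at hb
      rcases List.mem_cons.1 hb with rfl | hb
      · simp [ticks]
        omega
      · exact hdelay b hb
  · obtain rfl : i = F.length := by omega
    refine ⟨ticks 3, σ, [], Exec.loop_false _ (by rw [hguard]; omega), fun S => ?_, ?_, ?_⟩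
    · rw [List.append_nil]
      refine ⟨hL.good S, fun h => ?_⟩
      refine mem_of_closed hE hs ht (F := (· ∈ F)) hseed ?_ S h.1 h.2
      intro S hS _ v hv S' h1 h2 h3
      obtain ⟨j, hj⟩ := List.mem_iff_getElem?.1 hS
      exact hcl j (List.getElem?_eq_some_iff.1 hj).1 S hj v hv S' h1 h2 h3
    · simpa using hL.nodup
    · intro a ha
      rw [ticks_append, blocks_of_not_flush fun e he => not_flush_of_mem_ticks he]
      refine ⟨by simp [emitted_ticks], fun b hb => ?_⟩
      rw [List.mem_singleton.1 hb]
      simp [ticks]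
      omega

/-- After the preparation the stack holds one item, with `s` as its only source. -/
theorem run_prepare (hst : s ≠ t)
    (hG : HoldsGraph n E M σ) (h1 : σ.regs 1 = s) (h2 : σ.regs 2 = t) (h3 : σ.regs 3 = k)
    (h0 : ∀ i, σ.arrs aStack i = 0) (hd : ∀ i, σ.arrs aDict i = 0) (ho : σ.regs rOut = 0) :
    Run prepare σ (14 * n + 20) fun σ' =>
      Branching n E M s t k [rootItem t {s}] [] (4 ^ (k + 1) - 1) σ' := by
  have hs1 : Run (rKey ::= 1) σ 2 (fun τ => τ.arrs = σ.arrs ∧ τ.regs rKey = 1) :=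
    Run.simple rfl fun _ => by simp [RamProg.run]
  refine hs1.step (by omega) fun σ1 hF1 ⟨ha1, hk1⟩ => ?_
  have hn1 : σ1.regs 0 = n := (hF1.regs 0 rfl).trans hG.size
  refine (run_forN (by decide) rfl rfl
    (fun j τ => τ.regs rKey = 2 ^ j ∧ ∀ v < j, τ.arrs aPow v = 2 ^ v) 7 (by simp [hk1]) ?_).step
    (by rw [hn1]; omega) fun σ2 hF2 ⟨_, hp⟩ => ?_
  · rintro v hv τ hF hv1 ⟨h4, h5⟩
    refine Run.simple rfl fun _ => ⟨?_, fun x hx => ?_⟩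
    · simp [RamProg.run, h4, pow_succ, mul_two]
    · by_cases hxv : x = v
      · subst hxv
        simp [RamProg.run, hv1, h4]
      · simp [RamProg.run, hv1, hxv, h5 x (by omega)]
  rw [hn1] at hp ⊢
  have hr : ∀ x, x ≠ rKey → x ≠ rV → σ2.regs x = σ.regs x := fun x h4 h5 => by
    rw [hF2.regs x (by simp [forN, countTo, RamProg.modR, h4, h5]),
      hF1.regs x (by simp [RamProg.modR, h4])]
  have hst2 : σ2.arrs aStack = σ.arrs aStack := by rw [hF2.arrs aStack rfl, ha1]
  have hm : ∀ a, a ≠ aPow → σ2.arrs a = σ.arrs a := fun a h => by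
    rw [hF2.arrs a (by simp [forN, countTo, RamProg.modA, h]), ha1]
  refine (Run.of_simple (.store aStack (.reg 1) 1 ;; .store aStack (.reg 2) 2 ;;
    rTop ::= .reg 0) rfl σ2).mono (by change 8 ≤ _; omega) ?_
  intro σ3 hF3 hσ3
  have hG3 : HoldsGraph n E M σ3 := hG.of_eq (by rw [hF3.regs 0 rfl, hr 0 (by decide) (by decide)])
    (by rw [hF3.arrs aOff rfl, hm aOff (by decide)])
    (by rw [hF3.arrs aTgt rfl, hm aTgt (by decide)])
  refine ⟨⟨hG3, ?_, ?_, ?_, ?_⟩, ?_, ⟨?_, ?_, 4 ^ (k + 1) - 1, 0, weight_rootItem, rfl, rfl⟩, ?_⟩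
  · rw [hF3.regs 1 rfl, hr 1 (by decide) (by decide), h1]
  · rw [hF3.regs 2 rfl, hr 2 (by decide) (by decide), h2]
  · rw [hF3.regs 3 rfl, hr 3 (by decide) (by decide), h3]
  · rw [hF3.arrs aPow rfl]
    exact hp
  · simp [hσ3, RamProg.run, hr 0 (by decide) (by decide), hG.size]
  · intro v hv
    simp only [hσ3, RamProg.run, RamExpr.eval_reg, RamExpr.eval_ofNat, Function.update_self,
      hr 1 (by decide) (by decide), hr 2 (by decide) (by decide), h1, h2, hst2, rootItem,
      Function.update_apply, h0]
    simp
  · exact itemOK_rootItem (by simp) (by simpa using hst.symm)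
  · refine ⟨?_, by simp, fun S _ => ?_, by simp, by simp⟩
    · rw [hF3.regs rOut rfl, hr rOut (by decide) (by decide), ho]
      simp
    · rw [hF3.arrs aDict rfl, hm aDict (by decide), hd]
      simp

/-- The program outputs the minimal separators of size at most `k`, each exactly once. -/
theorem exec_listSeparators (hE : IsGraphOn n E) (hs : s < n) (ht : t < n) (hst : s ≠ t)
    (hG : HoldsGraph n E M σ) (h1 : σ.regs 1 = s) (h2 : σ.regs 2 = t) (h3 : σ.regs 3 = k)
    (h0 : ∀ i, σ.arrs aStack i = 0) (hd : ∀ i, σ.arrs aDict i = 0) (ho : σ.regs rOut = 0)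
    (hx : σ.regs rNext = 0) :
    ∃ (tr : List RamEvent) (σ' : RamState) (F : List (Finset ℕ)), Exec listSeparators σ tr σ' ∧
      (∀ S, S ∈ F ↔ MinSep n E s t S ∧ S.card ≤ k) ∧ F.Nodup ∧
      (blocks tr).map emitted = F.map (wordOf n) ++ [[]] ∧
      ∀ b ∈ blocks tr, b.length + 1 ≤ pause n M k + (24 * n + 20) := by
  obtain ⟨r1, σ1, he1, hr1, hB1⟩ := run_prepare hst hG h1 h2 h3 h0 hd ho
  obtain ⟨r2, σ2, he2, hr2, F, hB2, hT⟩ := run_processAll hE hs ht hB1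
  have hx2 : σ2.regs rNext = n * 0 := by
    rw [he2.frame.regs rNext rfl, he1.frame.regs rNext rfl, hx, mul_zero]
  rw [List.nil_append] at hB2 hT
  obtain ⟨tr, σ3, F', he3, hmem, hnd, hout⟩ := exec_outputLoop hE hs ht 0 F σ2 (Nat.zero_le _)
    hB2 hx2 (fun S hS hk hc => hT _ (List.mem_singleton_self _) S
      (target_rootItem (by simpa using hst.symm) (by simpa using hs) hS hk hc)) (by simp)
  have hle : r1 + r2 ≤ pause n M k := by
    rw [pause]
    generalize (k + 2) * (700 * (n + M) + 700) + 1 = K at *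
    have h4 : (4 ^ (k + 1) - 1) * K ≤ n * 4 ^ (k + 1) * K := by
      refine Nat.mul_le_mul_right _ ((Nat.sub_le _ _).trans ?_)
      exact Nat.le_mul_of_pos_left _ (by omega)
    generalize n * 4 ^ (k + 1) * K = W at *
    generalize (4 ^ (k + 1) - 1) * K = V at *
    generalize n * (19 * n + 40) = Q at *
    omega
  obtain ⟨hw, hdl⟩ := hout _ hle
  refine ⟨ticks (r1 + r2) ++ tr, σ3, F ++ F', ?_, hmem, hnd, hw, hdl⟩
  rw [← ticks_append, List.append_assoc]
  exact he1.seq (he2.seq he3)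

end

/-! ### From vertices to numbers -/

section

variable {n : ℕ} {G : SimpleGraph (Fin n)} {s t : Fin n} {S : Finset (Fin n)}
  {nbrs : Fin n → List (Fin n)}

/-- The adjacency relation of `G`, as a relation between natural numbers. -/
def valAdj (G : SimpleGraph (Fin n)) (u w : ℕ) : Prop :=
  ∃ (hu : u < n) (hw : w < n), G.Adj ⟨u, hu⟩ ⟨w, hw⟩

theorem isGraphOn_valAdj : IsGraphOn n (valAdj G) :=
  ⟨fun ⟨hu, hw, h⟩ => ⟨hw, hu, h.symm⟩, fun ⟨_, hw, _⟩ => hw⟩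

/-- A set of vertices, as a set of natural numbers. -/
def vals (S : Finset (Fin n)) : Finset ℕ := S.map Fin.valEmbedding

theorem val_mem_vals {v : Fin n} : v.val ∈ vals S ↔ v ∈ S := by
  simp [vals, Fin.val_inj]

theorem reachable_iff {u w : {v | v ∉ S}} :
    (G.induce {v | v ∉ S}).Reachable u w ↔ w.1.val ∈ reach n (valAdj G) (vals S) u.1.val := by
  constructor
  · intro h
    rw [SimpleGraph.reachable_iff_reflTransGen] at h
    refine mem_reach.2 ⟨w.1.2, h.lift (fun x => x.1.val) fun a b hab => ?_⟩
    exact ⟨⟨a.1.2, b.1.2, hab⟩, fun hb => b.2 (val_mem_vals.1 hb)⟩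
  · intro h
    have key : ∀ x ∈ reach n (valAdj G) (vals S) u.1.val,
        ∃ (hx : x < n) (hS : ⟨x, hx⟩ ∈ {v | v ∉ S}),
        (G.induce {v | v ∉ S}).Reachable u ⟨⟨x, hx⟩, hS⟩ := by
      refine reach_induction ⟨u.1.2, u.2, .refl _⟩ ?_ isGraphOn_valAdj u.1.2
      rintro x - ⟨hx, hxS, hr⟩ y hy ⟨_, _, hxy⟩ hyS
      have hyS' : (⟨y, hy⟩ : Fin n) ∉ S := fun h => hyS (val_mem_vals.2 h)
      refine ⟨hy, hyS', hr.trans (SimpleGraph.Adj.reachable ?_)⟩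
      exact hxy
    exact (key _ h).2.2

theorem isSeparator_iff : IsSeparator G s t S ↔ s.val ∉ vals S ∧ t.val ∉ vals S ∧
    t.val ∉ reach n (valAdj G) (vals S) s.val := by
  rw [val_mem_vals, val_mem_vals]
  constructor
  · rintro ⟨hs, ht, h⟩
    exact ⟨hs, ht, fun hr => h (SimpleGraph.ConnectedComponent.eq.2 (reachable_iff.2 hr))⟩
  · rintro ⟨hs, ht, h⟩
    exact ⟨hs, ht, fun hr => h (reachable_iff.1 (SimpleGraph.ConnectedComponent.eq.1 hr))⟩

theorem isMinimalSeparator_iff :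
    IsMinimalSeparator G s t S ↔ MinSep n (valAdj G) s t (vals S) := by
  have hE : IsGraphOn n (valAdj G) := isGraphOn_valAdj
  constructor
  · rintro ⟨h1, h2⟩
    obtain ⟨hs, ht, hst⟩ := isSeparator_iff.1 h1
    obtain ⟨hm, hsub, -⟩ := minSep_shrink hE s.2 t.2 hs ht hst
    generalize nb n (valAdj G) _ = Z at hm hsub
    have hZ : vals (S.filter fun v => v.val ∈ Z) = Z := by
      ext x
      constructor
      · intro hx
        obtain ⟨v, hv, rfl⟩ := Finset.mem_map.1 hx
        exact (Finset.mem_filter.1 hv).2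
      · intro hx
        obtain ⟨v, hv, rfl⟩ := Finset.mem_map.1 (hsub hx)
        exact Finset.mem_map_of_mem _ (Finset.mem_filter.2 ⟨hv, hx⟩)
    have hsep : IsSeparator G s t (S.filter fun v => v.val ∈ Z) := by
      rw [isSeparator_iff, hZ]
      exact ⟨hm.left_not_mem, hm.right_not_mem, hm.separates⟩
    have heq : (S.filter fun v => v.val ∈ Z) = S := by
      by_contra hne
      exact h2 _ ((Finset.filter_subset _ _).ssubset_of_ne hne) hsep
    rw [heq] at hZ
    rwa [hZ]
  · intro h
    refine ⟨isSeparator_iff.2 ⟨h.left_not_mem, h.right_not_mem, h.separates⟩, fun S' hS' h' => ?_⟩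
    obtain ⟨-, ht, hst⟩ := isSeparator_iff.1 h'
    obtain ⟨v, hv, hvS'⟩ := Finset.exists_of_ssubset hS'
    have hsub : vals S' ⊆ vals S := Finset.map_subset_map.2 hS'.1
    rw [← val_mem_vals] at hv hvS'
    obtain ⟨-, -, x, hx, hxv⟩ := mem_nb.1 (h.full_left hv)
    obtain ⟨-, -, y, hy, hyv⟩ := mem_nb.1 (h.full_right hv)
    have h1 := reach_step hE (reach_anti hsub hx) hxv hvS'
    have h2 := mem_reach_comm hE ht (reach_step hE (reach_anti hsub hy) hyv hvS')
    exact hst (mem_reach.2 ⟨t.2, (mem_reach.1 h1).2.trans (mem_reach.1 h2).2⟩)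

/-! ### Adjacency lists in memory -/

theorem offset_succ (params : List ℕ) (u : Fin n) :
    (graphInput nbrs params).arrs 0 (u + 1) =
      (graphInput nbrs params).arrs 0 u + (nbrs u).length := by
  have h : ∀ v : Fin n, (if v.val < u.val + 1 then (nbrs v).length else 0) =
      (if v.val < u.val then (nbrs v).length else 0) + if v = u then (nbrs v).length else 0 := by
    intro v
    have := Fin.ext_iff (a := v) (b := u)
    split_ifs <;> omega
  simp only [graphInput, if_pos, if_pos (show u.val + 1 ≤ n from u.2), if_pos u.2.le, h,
    Finset.sum_add_distrib]
  simp

theorem length_flatMap_take (params : List ℕ) {i : ℕ} (hi : i ≤ n) :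
    (((List.finRange n).take i).flatMap nbrs).length = (graphInput nbrs params).arrs 0 i := by
  induction i with
  | zero => simp [graphInput]
  | succ i ih =>
    rw [offset_succ params ⟨i, hi⟩, ← ih (by omega), List.take_add_one, List.flatMap_append,
      List.length_append, List.getElem?_eq_getElem (by simpa using hi)]
    simp

theorem flatMap_eq_append (u : Fin n) :
    (List.finRange n).flatMap nbrs = ((List.finRange n).take u).flatMap nbrs ++
      (nbrs u ++ ((List.finRange n).drop (u + 1)).flatMap nbrs) := by
  conv_lhs => rw [← List.take_append_drop u (List.finRange n),
    List.drop_eq_getElem_cons (by simp)]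
  simp

/-- Each edge occurs in two adjacency lists. -/
theorem adjArrays_graphInput (h : IsAdjacencyLists G nbrs) (params : List ℕ) :
    AdjArrays n (valAdj G) (2 * G.edgeSet.ncard) ((graphInput nbrs params).arrs 0)
      ((graphInput nbrs params).arrs 1) := by
  refine ⟨fun u hu w => ?_, fun u hu => ?_, ?_⟩
  · have h1 : (graphInput nbrs params).arrs 0 (u + 1) = (graphInput nbrs params).arrs 0 u +
        (nbrs ⟨u, hu⟩).length := offset_succ params ⟨u, hu⟩
    have h2 : ∀ i, (graphInput nbrs params).arrs 1 ((graphInput nbrs params).arrs 0 u + i) =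
        ((nbrs ⟨u, hu⟩ ++ ((List.finRange n).drop (u + 1)).flatMap nbrs).map Fin.val).getD i 0 := by
      intro i
      have : (graphInput nbrs params).arrs 1 =
        fun j => (((List.finRange n).flatMap nbrs).map Fin.val).getD j 0 := rfl
      rw [this, flatMap_eq_append ⟨u, hu⟩, ← length_flatMap_take params hu.le]
      simp only [List.map_append]
      rw [List.getD_append_right _ _ _ _ (by simp)]
      simp
    have h3 : ∀ i (hi : i < (nbrs ⟨u, hu⟩).length),
        (graphInput nbrs params).arrs 1 ((graphInput nbrs params).arrs 0 u + i) =
          ((nbrs ⟨u, hu⟩)[i]).val := by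
      intro i hi
      rw [h2, List.map_append, List.getD_append _ _ _ _ (by simpa using hi),
        List.getD_eq_getElem _ _ (by simpa using hi)]
      simp
    constructor
    · rintro ⟨_, hw, huw⟩
      obtain ⟨i, hi, hiw⟩ := List.mem_iff_getElem.1 (((h ⟨u, hu⟩).2 ⟨w, hw⟩).2 huw)
      refine ⟨_, Nat.le_add_right _ i, ?_, by rw [h3 i hi, hiw]⟩
      rw [h1]
      omega
    · rintro ⟨j, hj, hj', hjw⟩
      obtain ⟨i, rfl⟩ := Nat.exists_eq_add_of_le hj
      rw [h1] at hj'
      have hi : i < (nbrs ⟨u, hu⟩).length := by omega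
      rw [h3 i hi] at hjw
      subst hjw
      exact ⟨hu, Fin.is_lt _, ((h ⟨u, hu⟩).2 _).1 (List.getElem_mem hi)⟩
  · rw [offset_succ params ⟨u, hu⟩]
    exact Nat.le_add_right _ _
  · classical
    rw [← Fin.sum_univ_eq_sum_range (fun u => (graphInput nbrs params).arrs 0 (u + 1) -
      (graphInput nbrs params).arrs 0 u)]
    have hdeg : ∀ u : Fin n, (graphInput nbrs params).arrs 0 (u + 1) -
        (graphInput nbrs params).arrs 0 u = G.degree u := by
      intro u
      rw [offset_succ, Nat.add_sub_cancel_left, ← List.toFinset_card_of_nodup (h u).1,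
        ← SimpleGraph.card_neighborFinset_eq_degree]
      congr 1
      ext w
      simp [(h u).2]
    rw [Finset.sum_congr rfl fun u _ => hdeg u, G.sum_degrees_eq_twice_card_edges,
      Set.ncard_eq_toFinset_card']
    rfl

theorem spells_wordOf : Spells (wordOf n (vals S)) S := by
  refine ⟨(List.finRange n).filter (· ∈ S), (List.nodup_finRange n).filter _, by ext; simp, ?_⟩
  rw [wordOf, ← List.map_coe_finRange_eq_range, List.filter_map]
  congr 1
  refine List.filter_congr fun v _ => ?_
  simp [val_mem_vals]

end

/-- The delay of `listSeparators`, in a graph with `n` vertices and `m` edges. The adjacency lists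
have total length `2 * m`. -/
theorem pause_le {n m k T : ℕ} (hn : 1 ≤ n) (hk : 1 ≤ k) (hT : n + m ≤ T) :
    pause n (2 * m) k + (24 * n + 20) ≤ 27000 * (n * k * 4 ^ k * T) := by
  have hW : n * 4 ^ (k + 1) * ((k + 2) * (700 * (n + 2 * m) + 700) + 1) ≤
      25204 * (n * k * 4 ^ k * T) :=
    calc _ ≤ n * 4 ^ (k + 1) * (3 * k * (2100 * T) + k * T) := by
          refine Nat.mul_le_mul_left _ (Nat.add_le_add (Nat.mul_le_mul ?_ ?_) ?_)
          · omega
          · omega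
          · exact Nat.mul_pos hk (by omega)
      _ = _ := by ring
  have hX : n * T ≤ n * k * 4 ^ k * T := by
    refine Nat.mul_le_mul_right _ ?_
    rw [mul_assoc]
    exact Nat.le_mul_of_pos_right _ (Nat.mul_pos hk (by positivity))
  have hn2 : n * (19 * n + 40) ≤ 59 * (n * T) :=
    calc _ ≤ n * (59 * T) := Nat.mul_le_mul_left _ (by omega)
      _ = _ := by ring
  have hT1 : T ≤ n * T := Nat.le_mul_of_pos_left _ hn
  rw [pause]
  omega

theorem theorem1 :
    ∃ C : ℕ, ∀ (P : RamProg) (T : ℕ → ℕ → ℕ),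
      FindsMinimumSeparatorInTime P T → (∀ n m : ℕ, n + m ≤ T n m) →
      ∃ Q : RamProg, ∀ (n : ℕ) (G : SimpleGraph (Fin n)) (nbrs : Fin n → List (Fin n))
        (s t : Fin n) (k : ℕ),
        IsAdjacencyLists G nbrs → s ≠ t → ¬ G.Adj s t → 1 ≤ k →
        ListsWithDelay Q (graphInput nbrs [s.val, t.val, k])
          {S | IsMinimalSeparator G s t S ∧ S.card ≤ k}
          (C * (n * k * 4 ^ k * T n G.edgeSet.ncard)) := by
  refine ⟨27000, fun _ T _ hT => ⟨listSeparators, fun n G nbrs s t k hG hst _ hk => ?_⟩⟩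
  obtain ⟨tr, σ', F, hexec, hmem, hnd, hwords, hdelay⟩ :=
    exec_listSeparators isGraphOn_valAdj s.2 t.2 (Fin.val_ne_of_ne hst)
      (σ := graphInput nbrs [s.val, t.val, k]) (k := k) ⟨rfl, adjArrays_graphInput hG _⟩ rfl rfl rfl
      (fun _ => rfl) (fun _ => rfl) rfl rfl
  have hvals : ∀ S ∈ F, vals (Finset.univ.filter fun v : Fin n => v.val ∈ S) = S := by
    intro S hS
    ext x
    simp only [vals, Finset.mem_map, Finset.mem_filter, Finset.mem_univ, true_and]
    refine ⟨fun ⟨v, hv, hvx⟩ => hvx ▸ hv, fun hx => ?_⟩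
    have hxn : x < n := Finset.mem_range.1 (((hmem S).1 hS).1.subset_range hx)
    exact ⟨⟨x, hxn⟩, hx, rfl⟩
  refine ⟨tr, σ', F.map (wordOf n), F.map fun S => Finset.univ.filter fun v => v.val ∈ S, hexec,
    hwords, ?_, ?_, fun S => ?_, fun b hb => (hdelay b hb).trans (pause_le s.pos hk (hT _ _))⟩
  · rw [List.forall₂_map_left_iff, List.forall₂_map_right_iff, List.forall₂_same]
    intro S hS
    have := spells_wordOf (S := Finset.univ.filter fun v : Fin n => v.val ∈ S)
    rwa [hvals S hS] at this
  · refine hnd.map_on fun S hS S' hS' h => ?_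
    rw [← hvals S hS, ← hvals S' hS', h]
  · rw [Set.mem_ofPred_eq, isMinimalSeparator_iff, ← Finset.card_map Fin.valEmbedding, ← vals,
      ← hmem, List.mem_map]
    refine ⟨?_, fun h => ⟨_, h, ?_⟩⟩
    · rintro ⟨S', hS', rfl⟩
      rwa [hvals S' hS']
    · ext v
      simp [val_mem_vals]
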